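/- Let $R_1$ be the first Riesz transform on $L^2(\mathbb{R}^2)$, i.e. the Fourier multiplier with symbol $-i\xi_1/|\xi|$, and consider the Cauchy problem $$\partial_t\omega=\omega\,R_1^2\omega,\qquad \omega(0,\cdot)=\omega_0 .$$ A smooth solution on $[0,T)$ is a real-valued $\omega\in C^\infty([0,T)\times\mathbb{R}^2)$ with $\omega(t,\cdot)\in L^2(\mathbb{R}^2)$ for every $t\in[0,T)$, such that $R_1^2\omega$ is (has a representative that is) continuous on $[0,T)\times\mathbb{R}^2$, the equation holds at every point of $[0,T)\times\mathbb{R}^2$, and $\omega(0,\cdot)=\omega_0$. There exists a non-negative, smooth, compactly supported $\omega_0:\mathbb{R}^2\to\mathbb{R}$ whose unique solution develops a singularity in finite time. That is, there are $0<T<\infty$ and a smooth solution $\omega$ on $[0,T)$ with initial datum $\omega_0$ such that every smooth solution with initial datum $\omega_0$ on an interval $[0,T')$ satisfies $T'\le T$ and coincides with $\omega$ on $[0,T')$; and $\omega$ does not extend to a $C^\infty$ function on $[0,T]\times\mathbb{R}^2$. -/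

import Mathlib

open MeasureTheory Set
open scoped ContDiff FourierTransform

noncomputable section

/-- The Euclidean plane. -/
abbrev Plane : Type := EuclideanSpace ℝ (Fin 2)

/-- The symbol `-i ξ₁ / |ξ|` of the first Riesz transform (with value `0` at the origin, a null
set). -/
def rieszSymbol (ξ : Plane) : ℂ := -Complex.I * (ξ 0 : ℂ) / (‖ξ‖ : ℂ)

lemma norm_rieszSymbol_le (ξ : Plane) : ‖rieszSymbol ξ‖ ≤ 1 := by
  have h : |ξ 0| ≤ ‖ξ‖ := by
    simpa using PiLp.norm_apply_le ξ 0
  have h2 : ‖rieszSymbol ξ‖ = |ξ 0| / ‖ξ‖ := by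
    simp [rieszSymbol]
  rw [h2]
  exact div_le_one_of_le₀ h (norm_nonneg _)

lemma measurable_rieszSymbol : Measurable rieszSymbol := by
  unfold rieszSymbol
  fun_prop

lemma memLp_rieszSymbol_mul (f : Lp ℂ 2 (volume : Measure Plane)) :
    MemLp (fun ξ => rieszSymbol ξ * f ξ) 2 (volume : Measure Plane) :=
  (Lp.memLp f).of_le
    (measurable_rieszSymbol.aestronglyMeasurable.mul (Lp.aestronglyMeasurable f))
    (Filter.Eventually.of_forall fun ξ => by
      rw [norm_mul]
      exact mul_le_of_le_one_left (norm_nonneg _) (norm_rieszSymbol_le ξ))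

/-- The first Riesz transform `R₁` on `L²(ℝ²; ℂ)`: the Fourier multiplier with symbol
`-i ξ₁ / |ξ|`. -/
def rieszTransform (f : Lp ℂ 2 (volume : Measure Plane)) : Lp ℂ 2 (volume : Measure Plane) :=
  𝓕⁻ ((memLp_rieszSymbol_mul (𝓕 f)).toLp (fun ξ => rieszSymbol ξ * (𝓕 f) ξ))

/-- `f` is a real function in `L²(ℝ²)` and `g` is a real-valued representative of `R₁ (R₁ f)`. -/
def IsRieszSq (f g : Plane → ℝ) : Prop :=
  ∃ hf : MemLp (fun x => (f x : ℂ)) 2 (volume : Measure Plane),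
    (fun x => (g x : ℂ)) =ᵐ[volume] rieszTransform (rieszTransform (hf.toLp fun x => (f x : ℂ)))

/-- `w` is a smooth solution on `[0, T) × ℝ²` of `∂ₜ w = w R₁² w` with initial datum `w₀`: it is
jointly smooth up to the initial time, each `w t` lies in `L²` (so that `R₁² (w t)` is defined),
`R₁² w` is continuous on `[0, T) × ℝ²`, and the equation holds at every point (at `t = 0` with
the one-sided time derivative). The values of `w t` for `t ∉ [0, T)` play no role, except that
`w 0 = w₀` is required in any case. -/
structure IsSmoothSolution (T : ℝ) (w₀ : Plane → ℝ) (w : ℝ → Plane → ℝ) : Prop where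
  initial : w 0 = w₀
  smooth : ContDiffOn ℝ ∞ (fun p : ℝ × Plane => w p.1 p.2) (Ico 0 T ×ˢ univ)
  equation : ∃ g : ℝ → Plane → ℝ,
    ContinuousOn (fun p : ℝ × Plane => g p.1 p.2) (Ico 0 T ×ˢ univ) ∧
    ∀ t ∈ Ico 0 T, IsRieszSq (w t) (g t) ∧
      ∀ x, HasDerivWithinAt (fun s => w s x) (w t x * g t x) (Ico 0 T) t

end

/-!
Local existence comes from the Taylor series in time, whose coefficients are controlled in the
Wiener algebra `{f̂ ∈ L¹}`, on which `R₁²` is bounded. A solution is `w = w₀ exp (∫ R₁² w)`, so its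
support does not move, and an `L²` estimate gives uniqueness. As long as the Wiener norm stays
bounded, a solution can be continued by a fixed amount of time; a smooth extension to `[0, T]` would
bound it, so the maximal solution has none. It remains to choose `w₀` with a finite lifespan.

If a weight `φ ≥ 0` satisfies `∫ φ R₁² u ≥ ∫ φ u` for all `u` comparable to `w₀`, then
`F = ∫ φ log w` satisfies `F' = ∫ φ R₁² w ≥ ∫ φ w ≥ m exp (F / m)` with `m = ∫ φ`, by Jensen's
inequality, and `F` blows up in finite time. For this one needs `R₁² φ ≥ φ` on the support of `w₀`.
Since `∫ φ R₁² φ ≤ 0` for `φ ∈ L²`, such a `φ` is singular: it is a sum `∑ q ^ j ρ_j` of radial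
densities `ρ_j` concentrated near `(2⁻ʲ, 0)`, and `w₀` is a sum of bumps around the same points. Off
the support of `ρ_j`, the function `R₁² ρ_j` is a positive multiple of
`((x₁ - 2⁻ʲ)² - x₂²) / |x - (2⁻ʲ, 0)|⁴`, which is positive near the horizontal axis. Near the `k`-th
bump the terms with `j > k` are all at least of order `q ^ j 4 ^ k`, and for `q` close to `1` their
sum outweighs the negative part of `R₁² ρ_k - ρ_k`, which is of order `4 ^ k`.
-/

noncomputable section

section FourierIntegral

variable {V E : Type*} [NormedAddCommGroup V] [InnerProductSpace ℝ V] [FiniteDimensional ℝ V]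
  [MeasurableSpace V] [BorelSpace V] [NormedAddCommGroup E]

lemma integrable_pow_norm_mul_comp_neg {F : V → E}
    (hF : ∀ k : ℕ, Integrable fun ξ => ‖ξ‖ ^ k * ‖F ξ‖) (k : ℕ) :
    Integrable fun ξ => ‖ξ‖ ^ k * ‖F (-ξ)‖ := by
  simpa using (hF k).comp_neg

lemma integrable_of_integrable_pow_norm_mul {F : V → E} (hm : AEStronglyMeasurable F)
    (hF : ∀ k : ℕ, Integrable fun ξ => ‖ξ‖ ^ k * ‖F ξ‖) : Integrable F :=
  (integrable_norm_iff hm).1 (by simpa using hF 0)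

variable [NormedSpace ℂ E]

lemma norm_fourierInv_le_integral_norm (F : V → E) (x : V) : ‖𝓕⁻ F x‖ ≤ ∫ ξ, ‖F ξ‖ := by
  rw [Real.fourierInv_eq_fourier_neg]
  exact VectorFourier.norm_fourierIntegral_le_integral_norm _ _ _ F _

lemma continuous_fourier {F : V → E} (hF : Integrable F) : Continuous (𝓕 F) :=
  VectorFourier.fourierIntegral_continuous Real.continuous_fourierChar continuous_inner hF

lemma continuous_fourierInv {F : V → E} (hF : Integrable F) : Continuous (𝓕⁻ F) := by
  rw [Real.fourierInv_eq_fourier_comp_neg]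
  exact continuous_fourier hF.comp_neg

lemma integral_fourier_smul_eq [CompleteSpace E] {F : V → ℂ} {G : V → E} (hF : Integrable F)
    (hG : Integrable G) : ∫ x, 𝓕 F x • G x = ∫ x, F x • 𝓕 G x := by
  have h := VectorFourier.integral_fourierIntegral_smul_eq_flip (L := innerₗ V)
    (μ := volume) (ν := volume) Real.continuous_fourierChar continuous_inner hF hG
  rwa [flip_innerₗ] at h

lemma integral_fourierInv_smul_eq [CompleteSpace E] {F : V → ℂ} {G : V → E} (hF : Integrable F)
    (hG : Integrable G) : ∫ x, 𝓕⁻ F x • G x = ∫ x, F x • 𝓕⁻ G x := by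
  rw [Real.fourierInv_eq_fourier_comp_neg, integral_fourier_smul_eq hF.comp_neg hG,
    ← integral_neg_eq_self]
  simp [Real.fourierInv_eq_fourier_neg]

lemma fourierInv_sub {F G : V → E} (hF : Integrable F) (hG : Integrable G) (x : V) :
    𝓕⁻ (fun ξ => F ξ - G ξ) x = 𝓕⁻ F x - 𝓕⁻ G x := by
  simp only [Real.fourierInv_eq, smul_sub]
  refine integral_sub ?_ ?_
  · simpa using (Real.fourierIntegral_convergent_iff (-x)).2 hF
  · simpa using (Real.fourierIntegral_convergent_iff (-x)).2 hG

lemma contDiff_fourierInv {F : V → E} (hF : ∀ k : ℕ, Integrable fun ξ => ‖ξ‖ ^ k * ‖F ξ‖) :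
    ContDiff ℝ ∞ (𝓕⁻ F) := by
  rw [Real.fourierInv_eq_fourier_comp_neg]
  exact Real.contDiff_fourier (N := ⊤) fun k _ => integrable_pow_norm_mul_comp_neg hF k

lemma norm_iteratedFDeriv_fourierInv_le {F : V → E} (hm : AEStronglyMeasurable F)
    (hF : ∀ k : ℕ, Integrable fun ξ => ‖ξ‖ ^ k * ‖F ξ‖) (k : ℕ) (x : V) :
    ‖iteratedFDeriv ℝ k (𝓕⁻ F) x‖ ≤ (2 * Real.pi) ^ k * ∫ ξ, ‖ξ‖ ^ k * ‖F ξ‖ := by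
  have hm_neg : AEStronglyMeasurable (fun ξ : V => F (-ξ)) :=
    hm.comp_quasiMeasurePreserving (Measure.measurePreserving_neg volume).quasiMeasurePreserving
  have h_int : Integrable fun ξ : V => (2 * Real.pi) ^ k * (‖ξ‖ ^ k * ‖F ξ‖) :=
    (hF k).const_mul _
  rw [Real.fourierInv_eq_fourier_comp_neg, Real.iteratedFDeriv_fourier (N := ⊤)
    (fun k _ => integrable_pow_norm_mul_comp_neg hF k) hm_neg le_top]
  refine (VectorFourier.norm_fourierIntegral_le_integral_norm _ _ _ _ _).trans ?_
  rw [← integral_neg_eq_self, ← integral_const_mul]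
  refine integral_mono_of_nonneg (ae_of_all _ fun _ => norm_nonneg _) h_int
    (ae_of_all _ fun ξ => ?_)
  refine (VectorFourier.norm_fourierPowSMulRight_le _ _ _ _).trans ?_
  simp only [neg_neg, norm_neg]
  rw [mul_assoc]
  have h_inner : 2 * Real.pi * ‖innerSL ℝ (E := V)‖ ≤ 2 * Real.pi :=
    mul_le_of_le_one_right (by positivity) (norm_innerSL_le ℝ)
  gcongr

lemma hasSum_fourier {F : ℕ → V → E} (hF : ∀ n, Integrable (F n))
    (h_sum : Summable fun n => ∫ x, ‖F n x‖) (ξ : V) :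
    HasSum (fun n => 𝓕 (F n) ξ) (𝓕 (fun x => ∑' n, F n x) ξ) := by
  simp only [Real.fourier_eq, ← tsum_const_smul']
  exact hasSum_integral_of_summable_integral_norm
    (fun n => (Real.fourierIntegral_convergent_iff ξ).2 (hF n))
    (by simpa only [Circle.norm_smul] using h_sum)

lemma hasSum_fourierInv {F : ℕ → V → E} (hF : ∀ n, Integrable (F n))
    (h_sum : Summable fun n => ∫ ξ, ‖F n ξ‖) (x : V) :
    HasSum (fun n => 𝓕⁻ (F n) x) (𝓕⁻ (fun ξ => ∑' n, F n ξ) x) := by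
  simpa only [Real.fourierInv_eq_fourier_neg] using hasSum_fourier hF h_sum (-x)

end FourierIntegral

lemma fourierInv_toLp_ae_eq {V E : Type*} [NormedAddCommGroup V] [InnerProductSpace ℝ V]
    [FiniteDimensional ℝ V] [MeasurableSpace V] [BorelSpace V] [NormedAddCommGroup E]
    [InnerProductSpace ℂ E] [CompleteSpace E] {F : V → E} (h1 : Integrable F) (h2 : MemLp F 2) :
    ((𝓕⁻ (h2.toLp F) : Lp E 2 (volume : Measure V)) : V → E) =ᵐ[volume] 𝓕⁻ F := by
  refine ae_eq_of_integral_contDiff_smul_eq ((Lp.memLp _).locallyIntegrable (by norm_num))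
    (continuous_fourierInv h1).locallyIntegrable fun η hη hη_supp => ?_
  have h_smooth : ContDiff ℝ ∞ (fun x => (η x : ℂ)) := Complex.ofRealCLM.contDiff.comp hη
  have h_supp : HasCompactSupport (fun x => (η x : ℂ)) :=
    hη_supp.comp_left (g := ((↑) : ℝ → ℂ)) rfl
  let ψ := h_supp.toSchwartzMap h_smooth
  have h_complex (f : V → E) : ∫ x, η x • f x = ∫ x, ψ x • f x :=
    integral_congr_ae (ae_of_all _ fun x => (Complex.coe_smul (η x) (f x)).symm)
  have h_weak : ∫ x, (𝓕⁻ ψ) x • (h2.toLp F) x =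
      ∫ x, ψ x • (𝓕⁻ (h2.toLp F) : Lp E 2 (volume : Measure V)) x := by
    simpa only [TemperedDistribution.fourierInv_apply, Lp.toTemperedDistribution_apply]
      using congrArg (fun d => d ψ) (Lp.fourierInv_toTemperedDistribution_eq (h2.toLp F))
  rw [h_complex, h_complex, ← h_weak]
  refine Eq.trans (integral_congr_ae ?_) (integral_fourierInv_smul_eq ψ.integrable h1)
  filter_upwards [h2.coeFn_toLp] with x hx
  rw [hx, SchwartzMap.fourierInv_coe]

/-- Test functions: real-valued, smooth and compactly supported. An unbundled predicate, since it
is applied to the time slices of solutions. -/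
structure IsTest {V : Type*} [NormedAddCommGroup V] [NormedSpace ℝ V] (f : V → ℝ) : Prop where
  smooth : ContDiff ℝ ∞ f
  compact : HasCompactSupport f

namespace IsTest

variable {V : Type*} [NormedAddCommGroup V] [NormedSpace ℝ V] {f g : V → ℝ}

lemma zero : IsTest fun _ : V => (0 : ℝ) := ⟨contDiff_const, HasCompactSupport.zero⟩

lemma add (hf : IsTest f) (hg : IsTest g) : IsTest fun x => f x + g x :=
  ⟨hf.smooth.add hg.smooth, hf.compact.add hg.compact⟩

lemma sub (hf : IsTest f) (hg : IsTest g) : IsTest fun x => f x - g x :=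
  ⟨hf.smooth.sub hg.smooth, hf.compact.sub hg.compact⟩

lemma const_mul (hf : IsTest f) (c : ℝ) : IsTest fun x => c * f x :=
  ⟨contDiff_const.mul hf.smooth, hf.compact.mul_left⟩

lemma mul_smooth (hf : IsTest f) (hg : ContDiff ℝ ∞ g) : IsTest fun x => f x * g x :=
  ⟨hf.smooth.mul hg, hf.compact.mul_right⟩

lemma sum {ι : Type*} (s : Finset ι) {h : ι → V → ℝ} (hh : ∀ i ∈ s, IsTest (h i)) :
    IsTest fun x => ∑ i ∈ s, h i x := by
  classical
  induction s using Finset.induction_on with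
  | empty => simpa using zero
  | insert i s hi ih =>
    simp only [Finset.sum_insert hi]
    exact (hh i (Finset.mem_insert_self i s)).add
      (ih fun j hj => hh j (Finset.mem_insert_of_mem hj))

lemma continuous (hf : IsTest f) : Continuous f := hf.smooth.continuous

end IsTest

/-- The Fourier transform of a real-valued function. -/
def realFourier {V : Type*} [NormedAddCommGroup V] [InnerProductSpace ℝ V] [FiniteDimensional ℝ V]
    [MeasurableSpace V] [BorelSpace V] (f : V → ℝ) : V → ℂ := 𝓕 fun x => (f x : ℂ)

/-- The norm of the Wiener algebra, `‖f̂‖` in `L¹`. -/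
def wienerNorm {V : Type*} [NormedAddCommGroup V] [InnerProductSpace ℝ V] [FiniteDimensional ℝ V]
    [MeasurableSpace V] [BorelSpace V] (f : V → ℝ) : ℝ := ∫ ξ, ‖realFourier f ξ‖

/-- Real even symbols bounded by `1`: those of Fourier multipliers that map real functions to real
functions, are symmetric, and are contractions of `L²`. -/
structure IsEvenSymbol {V : Type*} [Norm V] [Neg V] [MeasurableSpace V] (m : V → ℝ) : Prop where
  measurable : Measurable m
  abs_le_one (ξ : V) : |m ξ| ≤ 1
  even (ξ : V) : m (-ξ) = m ξ

namespace IsEvenSymbol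

variable {V : Type*} [Norm V] [Neg V] [MeasurableSpace V] {m : V → ℝ}

lemma norm_mul_le (hm : IsEvenSymbol m) (F : V → ℂ) (ξ : V) : ‖(m ξ : ℂ) * F ξ‖ ≤ ‖F ξ‖ := by
  rw [norm_mul, Complex.norm_real]
  exact mul_le_of_le_one_left (norm_nonneg _) (hm.abs_le_one ξ)

lemma aestronglyMeasurable_mul (hm : IsEvenSymbol m) {μ : Measure V} {F : V → ℂ}
    (hF : AEStronglyMeasurable F μ) :
    AEStronglyMeasurable (fun ξ => (m ξ : ℂ) * F ξ) μ :=
  (Complex.measurable_ofReal.comp hm.measurable).aestronglyMeasurable.mul hF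

end IsEvenSymbol

section Multiplier

variable {V : Type*} [NormedAddCommGroup V] [InnerProductSpace ℝ V] [FiniteDimensional ℝ V]
  [MeasurableSpace V] [BorelSpace V]

/-- The Fourier multiplier `m(D) f`, given pointwise by a Fourier integral; it is meant for test
functions `f` and even symbols `m`, for which the integral converges and is real. -/
def multiplier (m f : V → ℝ) (x : V) : ℝ := (𝓕⁻ (fun ξ => (m ξ : ℂ) * realFourier f ξ) x).re

lemma realFourier_neg (f : V → ℝ) (ξ : V) :
    realFourier f (-ξ) = (starRingEnd ℂ) (realFourier f ξ) := by
  simp only [realFourier, Real.fourier_eq', ← integral_conj]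
  congr 1
  ext x
  simp [← Complex.exp_conj, map_ofNat]

lemma realFourier_const_mul (c : ℝ) (f : V → ℝ) (ξ : V) :
    realFourier (fun x => c * f x) ξ = c * realFourier f ξ := by
  simp only [realFourier, Real.fourier_eq', ← integral_const_mul, smul_eq_mul, Complex.ofReal_mul]
  congr 1
  ext x
  ring

lemma realFourier_add {f g : V → ℝ} (hf : Integrable f) (hg : Integrable g) (ξ : V) :
    realFourier (fun x => f x + g x) ξ = realFourier f ξ + realFourier g ξ := by
  have h := VectorFourier.fourierIntegral_add (L := innerₗ V) Real.continuous_fourierChar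
    continuous_inner (hf.ofReal (𝕜 := ℂ)) (hg.ofReal (𝕜 := ℂ))
  simp only [realFourier, Complex.ofReal_add]
  exact congrFun h ξ

lemma realFourier_sub {f g : V → ℝ} (hf : Integrable f) (hg : Integrable g) (ξ : V) :
    realFourier (fun x => f x - g x) ξ = realFourier f ξ - realFourier g ξ := by
  have h := realFourier_add hf (hg.const_mul (-1)) ξ
  rw [realFourier_const_mul] at h
  simpa [sub_eq_add_neg] using h

lemma wienerNorm_nonneg (f : V → ℝ) : 0 ≤ wienerNorm f := integral_nonneg fun _ => norm_nonneg _

variable {m f g : V → ℝ}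

lemma IsEvenSymbol.ofReal_multiplier (hm : IsEvenSymbol m) (f : V → ℝ) (x : V) :
    (multiplier m f x : ℂ) = 𝓕⁻ (fun ξ => (m ξ : ℂ) * realFourier f ξ) x := by
  refine Complex.conj_eq_iff_re.1 ?_
  simp only [Real.fourierInv_eq', ← integral_conj]
  rw [← integral_neg_eq_self]
  congr 1
  ext ξ
  simp [hm.even, realFourier_neg, ← Complex.exp_conj, map_ofNat]

namespace IsTest

lemma integrable (hf : IsTest f) : Integrable f :=
  hf.continuous.integrable_of_hasCompactSupport hf.compact

lemma memLp (hf : IsTest f) (p : ENNReal) : MemLp f p :=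
  hf.continuous.memLp_of_hasCompactSupport hf.compact

/-- A test function as a complex-valued Schwartz function. -/
def toSchwartzMap (hf : IsTest f) : SchwartzMap V ℂ :=
  HasCompactSupport.toSchwartzMap (f := fun x => (f x : ℂ))
    (hf.compact.comp_left (g := ((↑) : ℝ → ℂ)) rfl) (Complex.ofRealCLM.contDiff.comp hf.smooth)

lemma integrable_ofReal (hf : IsTest f) : Integrable fun x => (f x : ℂ) := hf.integrable.ofReal

lemma memLp_ofReal (hf : IsTest f) (p : ENNReal) : MemLp (fun x => (f x : ℂ)) p :=
  (hf.memLp p).ofReal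

lemma toLp_eq_toLp_toSchwartzMap (hf : IsTest f) (h : MemLp (fun x => (f x : ℂ)) 2) :
    h.toLp (fun x => (f x : ℂ)) = hf.toSchwartzMap.toLp 2 := rfl

lemma realFourier_eq (hf : IsTest f) :
    realFourier f = (𝓕 hf.toSchwartzMap : SchwartzMap V ℂ) := rfl

lemma continuous_realFourier (hf : IsTest f) : Continuous (realFourier f) :=
  continuous_fourier hf.integrable_ofReal

lemma integrable_pow_norm_mul_realFourier (hf : IsTest f) (k : ℕ) :
    Integrable fun ξ => ‖ξ‖ ^ k * ‖realFourier f ξ‖ := by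
  rw [hf.realFourier_eq]
  exact (𝓕 hf.toSchwartzMap).integrable_pow_mul volume k

lemma integrable_realFourier (hf : IsTest f) : Integrable (realFourier f) :=
  integrable_of_integrable_pow_norm_mul hf.continuous_realFourier.aestronglyMeasurable
    hf.integrable_pow_norm_mul_realFourier

lemma fourierInv_realFourier (hf : IsTest f) (x : V) : 𝓕⁻ (realFourier f) x = f x :=
  congrFun ((Complex.continuous_ofReal.comp hf.continuous).fourierInv_fourier_eq
    hf.integrable_ofReal hf.integrable_realFourier) x

lemma norm_iteratedFDeriv_le (hf : IsTest f) (k : ℕ) (x : V) :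
    ‖iteratedFDeriv ℝ k f x‖ ≤ (2 * Real.pi) ^ k * ∫ ξ, ‖ξ‖ ^ k * ‖realFourier f ξ‖ := by
  have h := norm_iteratedFDeriv_fourierInv_le
    hf.continuous_realFourier.aestronglyMeasurable hf.integrable_pow_norm_mul_realFourier k x
  have h_inv : 𝓕⁻ (realFourier f) = Complex.ofRealLI ∘ f := funext hf.fourierInv_realFourier
  rwa [h_inv, LinearIsometry.norm_iteratedFDeriv_comp_left (n := ∞) _ hf.smooth.contDiffAt
    (mod_cast le_top)] at h

lemma integrable_mul_realFourier (hf : IsTest f) (hm : IsEvenSymbol m) :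
    Integrable fun ξ => (m ξ : ℂ) * realFourier f ξ :=
  hf.integrable_realFourier.mono
    (hm.aestronglyMeasurable_mul hf.continuous_realFourier.aestronglyMeasurable)
    (ae_of_all _ (hm.norm_mul_le _))

lemma memLp_mul_realFourier (hf : IsTest f) (hm : IsEvenSymbol m) :
    MemLp (fun ξ => (m ξ : ℂ) * realFourier f ξ) 2 :=
  ((𝓕 hf.toSchwartzMap).memLp 2 volume).of_le
    (hm.aestronglyMeasurable_mul hf.continuous_realFourier.aestronglyMeasurable)
    (ae_of_all _ (hm.norm_mul_le _))

lemma multiplier_ae_eq (hf : IsTest f) (hm : IsEvenSymbol m) :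
    (fun x => (multiplier m f x : ℂ)) =ᵐ[volume]
      (𝓕⁻ ((hf.memLp_mul_realFourier hm).toLp _) : Lp ℂ 2 (volume : Measure V)) := by
  filter_upwards [fourierInv_toLp_ae_eq (hf.integrable_mul_realFourier hm)
    (hf.memLp_mul_realFourier hm)] with x hx
  rw [hx, hm.ofReal_multiplier]

lemma contDiff_multiplier (hf : IsTest f) (hm : IsEvenSymbol m) :
    ContDiff ℝ ∞ (multiplier m f) := by
  refine Complex.reCLM.contDiff.comp (contDiff_fourierInv fun k => ?_)
  refine (hf.integrable_pow_norm_mul_realFourier k).mono' ?_ (ae_of_all _ fun ξ => ?_)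
  · exact ((continuous_norm.pow k).aestronglyMeasurable).mul
      (hf.integrable_mul_realFourier hm).aestronglyMeasurable.norm
  · rw [norm_mul, norm_norm, norm_pow, norm_norm]
    gcongr
    exact hm.norm_mul_le _ ξ

lemma abs_multiplier_le (hf : IsTest f) (hm : IsEvenSymbol m) (x : V) :
    |multiplier m f x| ≤ wienerNorm f := by
  rw [← Real.norm_eq_abs, ← Complex.norm_real, hm.ofReal_multiplier]
  exact (norm_fourierInv_le_integral_norm _ x).trans (integral_mono
    (hf.integrable_mul_realFourier hm).norm hf.integrable_realFourier.norm (hm.norm_mul_le _))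

lemma multiplier_sub (hf : IsTest f) (hg : IsTest g) (hm : IsEvenSymbol m) (x : V) :
    multiplier m (fun x => f x - g x) x = multiplier m f x - multiplier m g x := by
  simp only [multiplier, realFourier_sub hf.integrable hg.integrable, mul_sub]
  rw [fourierInv_sub (hf.integrable_mul_realFourier hm) (hg.integrable_mul_realFourier hm),
    Complex.sub_re]

lemma integral_mul_multiplier (hf : IsTest f) (hg : IsTest g) (hm : IsEvenSymbol m) :
    ∫ x, f x * multiplier m g x = ∫ x, multiplier m f x * g x := by
  have h : (∫ x, (f x : ℂ) • (multiplier m g x : ℂ)) = ∫ x, (multiplier m f x : ℂ) • (g x : ℂ) := by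
    simp only [hm.ofReal_multiplier]
    rw [← integral_fourierInv_smul_eq hf.integrable_ofReal (hg.integrable_mul_realFourier hm),
      integral_fourierInv_smul_eq (hf.integrable_mul_realFourier hm) hg.integrable_ofReal,
      ← integral_neg_eq_self]
    congr 1
    ext ξ
    rw [Real.fourierInv_eq_fourier_neg, Real.fourierInv_eq_fourier_neg, neg_neg, hm.even]
    change realFourier f ξ * (_ * realFourier g (-ξ)) = _ * _ * realFourier g (-ξ)
    ring
  simp only [smul_eq_mul, ← Complex.ofReal_mul, integral_complex_ofReal] at h
  exact_mod_cast h

lemma memLp_multiplier (hf : IsTest f) (hm : IsEvenSymbol m) : MemLp (multiplier m f) 2 :=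
  ((memLp_congr_ae (hf.multiplier_ae_eq hm)).2 (Lp.memLp _)).re

end IsTest

lemma norm_toLp_ofReal_sq {α : Type*} [MeasurableSpace α] {μ : Measure α} {u : α → ℝ}
    (hu : MemLp (fun x => (u x : ℂ)) 2 μ) : ‖hu.toLp _‖ ^ 2 = ∫ x, u x ^ 2 ∂μ := by
  have h_inner : (‖hu.toLp _‖ ^ 2 : ℝ) = RCLike.re (inner ℂ (hu.toLp _) (hu.toLp _)) :=
    norm_sq_eq_re_inner (𝕜 := ℂ) _
  rw [h_inner, L2.inner_def, ← integral_re (L2.integrable_inner _ _)]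
  refine integral_congr_ae ?_
  filter_upwards [hu.coeFn_toLp] with x hx
  rw [hx]
  simp [← Complex.ofReal_mul, sq]

lemma IsTest.integral_multiplier_sq_le (hf : IsTest f) (hm : IsEvenSymbol m) :
    ∫ x, multiplier m f x ^ 2 ≤ ∫ x, f x ^ 2 := by
  have hmf : MemLp (fun x => (multiplier m f x : ℂ)) 2 := (hf.memLp_multiplier hm).ofReal
  have hf_toLp : MemLp (fun x => (f x : ℂ)) 2 := hf.memLp_ofReal 2
  rw [← norm_toLp_ofReal_sq hmf, ← norm_toLp_ofReal_sq hf_toLp]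
  gcongr
  have h_inv : hmf.toLp _ = 𝓕⁻ ((hf.memLp_mul_realFourier hm).toLp _) :=
    Lp.ext (hmf.coeFn_toLp.trans (hf.multiplier_ae_eq hm))
  have h_plancherel : ‖hf.toSchwartzMap.toLp 2‖ = ‖(𝓕 hf.toSchwartzMap).toLp 2‖ := by
    rw [← SchwartzMap.toLp_fourier_eq, Lp.norm_fourier_eq]
  rw [h_inv, ← Lp.norm_fourier_eq (𝓕⁻ _), FourierTransform.fourier_fourierInv_eq,
    hf.toLp_eq_toLp_toSchwartzMap, h_plancherel]
  refine Lp.norm_le_norm_of_ae_le ?_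
  filter_upwards [(hf.memLp_mul_realFourier hm).coeFn_toLp,
    (𝓕 hf.toSchwartzMap).coeFn_toLp 2 volume] with ξ hξ hξ'
  rw [hξ, hξ', ← hf.realFourier_eq]
  exact hm.norm_mul_le _ ξ

end Multiplier

/-- The symbol `-ξ₁² / |ξ|²` of `R₁²`. -/
def rieszSqSymbol (ξ : Plane) : ℝ := -(ξ 0) ^ 2 / ‖ξ‖ ^ 2

/-- The pointwise version of `R₁²` on test functions. -/
abbrev rieszSq (f : Plane → ℝ) : Plane → ℝ := multiplier rieszSqSymbol f

lemma rieszSymbol_mul_self (ξ : Plane) : rieszSymbol ξ * rieszSymbol ξ = rieszSqSymbol ξ := by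
  simp only [rieszSymbol, rieszSqSymbol]
  push_cast
  rw [div_mul_div_comm]
  congr 1
  · linear_combination (ξ 0 : ℂ) ^ 2 * Complex.I_sq
  · ring

lemma isEvenSymbol_rieszSqSymbol : IsEvenSymbol rieszSqSymbol where
  measurable := by
    unfold rieszSqSymbol
    fun_prop
  abs_le_one ξ := by
    have h : |rieszSqSymbol ξ| = ‖rieszSymbol ξ‖ * ‖rieszSymbol ξ‖ := by
      rw [← norm_mul, rieszSymbol_mul_self, Complex.norm_real, Real.norm_eq_abs]
    rw [h]
    exact mul_le_one₀ (norm_rieszSymbol_le ξ) (norm_nonneg _) (norm_rieszSymbol_le ξ)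
  even ξ := by simp [rieszSqSymbol]

lemma rieszTransform_rieszTransform_toLp {f : Plane → ℝ} (hf : IsTest f)
    (h : MemLp (fun x => (f x : ℂ)) 2) :
    rieszTransform (rieszTransform (h.toLp fun x => (f x : ℂ))) =
      𝓕⁻ ((hf.memLp_mul_realFourier isEvenSymbol_rieszSqSymbol).toLp _) := by
  have h_once : 𝓕 (rieszTransform (h.toLp fun x => (f x : ℂ))) =
      (memLp_rieszSymbol_mul (𝓕 (h.toLp fun x => (f x : ℂ)))).toLp _ := by
    rw [rieszTransform, FourierTransform.fourier_fourierInv_eq]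
  have h_fourier : 𝓕 (h.toLp fun x => (f x : ℂ)) = (𝓕 hf.toSchwartzMap).toLp 2 := by
    rw [hf.toLp_eq_toLp_toSchwartzMap, SchwartzMap.toLp_fourier_eq]
  rw [rieszTransform]
  congr 1
  refine MemLp.toLp_congr _ _ ?_
  rw [h_once]
  filter_upwards [(memLp_rieszSymbol_mul (𝓕 (h.toLp fun x => (f x : ℂ)))).coeFn_toLp,
    (𝓕 hf.toSchwartzMap).coeFn_toLp 2 volume] with ξ hξ hξ'
  rw [hξ, h_fourier, hξ', ← mul_assoc, rieszSymbol_mul_self, hf.realFourier_eq]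

lemma IsTest.isRieszSq {f : Plane → ℝ} (hf : IsTest f) : IsRieszSq f (rieszSq f) := by
  refine ⟨hf.memLp_ofReal 2, ?_⟩
  rw [rieszTransform_rieszTransform_toLp hf]
  exact hf.multiplier_ae_eq isEvenSymbol_rieszSqSymbol

lemma IsRieszSq.eq_rieszSq {f g : Plane → ℝ} (h : IsRieszSq f g) (hf : IsTest f)
    (hg : Continuous g) : g = rieszSq f := by
  obtain ⟨_, hg_ae⟩ := h
  obtain ⟨_, hf_ae⟩ := hf.isRieszSq
  refine (Continuous.ae_eq_iff_eq volume hg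
    (hf.contDiff_multiplier isEvenSymbol_rieszSqSymbol).continuous).1 ?_
  filter_upwards [hg_ae, hf_ae] with x hx hy
  exact_mod_cast hx.trans hy.symm

section WeightedWienerNorm

variable {V : Type*} [NormedAddCommGroup V]

/-- The submultiplicative weight `(1 + ε |ξ|) ^ K`. Its parameter `ε` allows the norm with `K`
derivatives to be as close to the Wiener norm as desired, so that all derivatives of a Taylor series
in time converge on the same interval. -/
def frequencyWeight (ε : ℝ) (K : ℕ) (ξ : V) : ℝ := (1 + ε * ‖ξ‖) ^ K

variable {ε : ℝ} (K : ℕ)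

lemma frequencyWeight_nonneg (hε : 0 ≤ ε) (ξ : V) : 0 ≤ frequencyWeight ε K ξ := by
  unfold frequencyWeight
  positivity

lemma frequencyWeight_add_le (hε : 0 ≤ ε) (ξ η : V) :
    frequencyWeight ε K (ξ + η) ≤ frequencyWeight ε K ξ * frequencyWeight ε K η := by
  unfold frequencyWeight
  rw [← mul_pow]
  refine pow_le_pow_left₀ (by positivity) ?_ K
  calc 1 + ε * ‖ξ + η‖ ≤ 1 + ε * (‖ξ‖ + ‖η‖) := by gcongr; exact norm_add_le ξ η
    _ ≤ 1 + ε * (‖ξ‖ + ‖η‖) + (ε * ‖ξ‖) * (ε * ‖η‖) := le_add_of_nonneg_right (by positivity)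
    _ = (1 + ε * ‖ξ‖) * (1 + ε * ‖η‖) := by ring

lemma frequencyWeight_le_one_add (hε : 0 ≤ ε) (hε1 : ε ≤ 1) (ξ : V) :
    frequencyWeight ε K ξ ≤ 1 + ε * frequencyWeight 1 K ξ := by
  have h_convex := (convexOn_pow K).2 (x := (1 : ℝ)) (by simp) (y := 1 + ‖ξ‖)
    (mem_Ici.2 (by positivity)) (sub_nonneg.2 hε1) hε (by ring)
  have h_combo : (1 - ε) * 1 + ε * (1 + ‖ξ‖) = 1 + ε * ‖ξ‖ := by ring
  simp only [smul_eq_mul, one_pow, h_combo] at h_convex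
  simp only [frequencyWeight, one_mul]
  linarith

variable [InnerProductSpace ℝ V] [FiniteDimensional ℝ V] [MeasurableSpace V] [BorelSpace V]

/-- The norm of the Wiener algebra weighted by `frequencyWeight ε K`. -/
def weightedWienerNorm (ε : ℝ) (K : ℕ) (f : V → ℝ) : ℝ :=
  ∫ ξ, frequencyWeight ε K ξ * ‖realFourier f ξ‖

lemma weightedWienerNorm_nonneg (hε : 0 ≤ ε) (f : V → ℝ) : 0 ≤ weightedWienerNorm ε K f :=
  integral_nonneg fun ξ => mul_nonneg (frequencyWeight_nonneg K hε ξ) (norm_nonneg _)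

lemma weightedWienerNorm_zero_left (f : V → ℝ) : weightedWienerNorm 0 K f = wienerNorm f := by
  simp [weightedWienerNorm, wienerNorm, frequencyWeight]

lemma weightedWienerNorm_const_mul (c : ℝ) (f : V → ℝ) :
    weightedWienerNorm ε K (fun x => c * f x) = |c| * weightedWienerNorm ε K f := by
  unfold weightedWienerNorm
  rw [← integral_const_mul]
  congr 1
  ext ξ
  rw [realFourier_const_mul, norm_mul, Complex.norm_real, Real.norm_eq_abs]
  ring

namespace IsTest

variable {m f g : V → ℝ}

lemma integrable_frequencyWeight_mul (hf : IsTest f) (ε : ℝ) :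
    Integrable fun ξ => frequencyWeight ε K ξ * ‖realFourier f ξ‖ := by
  have h_binomial : (fun ξ => frequencyWeight ε K ξ * ‖realFourier f ξ‖) = fun ξ =>
      ∑ j ∈ Finset.range (K + 1), (ε ^ j * K.choose j) * (‖ξ‖ ^ j * ‖realFourier f ξ‖) := by
    ext ξ
    rw [frequencyWeight, add_comm, add_pow, Finset.sum_mul]
    refine Finset.sum_congr rfl fun j _ => ?_
    rw [mul_pow, one_pow]
    ring
  rw [h_binomial]
  exact integrable_finsetSum _ fun j _ => (hf.integrable_pow_norm_mul_realFourier j).const_mul _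

lemma weightedWienerNorm_add_le (hε : 0 ≤ ε) (hf : IsTest f) (hg : IsTest g) :
    weightedWienerNorm ε K (fun x => f x + g x) ≤
      weightedWienerNorm ε K f + weightedWienerNorm ε K g := by
  have hf_int := hf.integrable_frequencyWeight_mul K ε
  have hg_int := hg.integrable_frequencyWeight_mul K ε
  unfold weightedWienerNorm
  rw [← integral_add hf_int hg_int]
  refine integral_mono ((hf.add hg).integrable_frequencyWeight_mul K ε) (hf_int.add hg_int)
    fun ξ => ?_
  dsimp only
  rw [← mul_add, realFourier_add hf.integrable hg.integrable]
  exact mul_le_mul_of_nonneg_left (norm_add_le _ _) (frequencyWeight_nonneg K hε ξ)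

lemma weightedWienerNorm_sum_le (hε : 0 ≤ ε) {ι : Type*} (s : Finset ι) {h : ι → V → ℝ}
    (hh : ∀ i ∈ s, IsTest (h i)) :
    weightedWienerNorm ε K (fun x => ∑ i ∈ s, h i x) ≤ ∑ i ∈ s, weightedWienerNorm ε K (h i) := by
  classical
  induction s using Finset.induction_on with
  | empty => simp [weightedWienerNorm, realFourier, Real.fourier_eq]
  | insert i s hi ih =>
    simp only [Finset.sum_insert hi]
    have hs : ∀ j ∈ s, IsTest (h j) := fun j hj => hh j (Finset.mem_insert_of_mem hj)
    exact (weightedWienerNorm_add_le K hε (hh i (Finset.mem_insert_self i s)) (sum s hs)).trans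
      (by gcongr; exact ih hs)

lemma integral_pow_norm_mul_realFourier_le (hε : 0 < ε) (hf : IsTest f) :
    ∫ ξ, ‖ξ‖ ^ K * ‖realFourier f ξ‖ ≤ (ε⁻¹) ^ K * weightedWienerNorm ε K f := by
  unfold weightedWienerNorm
  rw [← integral_const_mul]
  refine integral_mono (hf.integrable_pow_norm_mul_realFourier K)
    ((hf.integrable_frequencyWeight_mul K ε).const_mul _) fun ξ => ?_
  dsimp only
  rw [← mul_assoc, frequencyWeight, ← mul_pow, mul_add, inv_mul_cancel_left₀ hε.ne']
  gcongr
  exact le_add_of_nonneg_left (by positivity)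

lemma weightedWienerNorm_le_add (hε : 0 ≤ ε) (hε1 : ε ≤ 1) (hf : IsTest f) :
    weightedWienerNorm ε K f ≤ wienerNorm f + ε * weightedWienerNorm 1 K f := by
  have h_int := (hf.integrable_frequencyWeight_mul K 1).const_mul ε
  unfold weightedWienerNorm wienerNorm
  rw [← integral_const_mul, ← integral_add hf.integrable_realFourier.norm h_int]
  refine integral_mono (hf.integrable_frequencyWeight_mul K ε)
    (hf.integrable_realFourier.norm.add h_int) fun ξ => ?_
  linarith [mul_le_mul_of_nonneg_right (frequencyWeight_le_one_add K hε hε1 ξ)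
    (norm_nonneg (realFourier f ξ))]

open scoped Convolution in
lemma realFourier_mul_multiplier (hf : IsTest f) (hg : IsTest g) (hm : IsEvenSymbol m) :
    realFourier (fun x => f x * multiplier m g x) =
      realFourier f ⋆[ContinuousLinearMap.mul ℂ ℂ] fun ξ => (m ξ : ℂ) * realFourier g ξ := by
  set F := realFourier f
  set G : V → ℂ := fun ξ => (m ξ : ℂ) * realFourier g ξ
  have hF : Integrable F := hf.integrable_realFourier
  have hG : Integrable G := hg.integrable_mul_realFourier hm
  have h_cont : Continuous (F ⋆[ContinuousLinearMap.mul ℂ ℂ] G) := by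
    refine BddAbove.continuous_convolution_left_of_integrable _ ⟨∫ x, ‖(f x : ℂ)‖, ?_⟩
      hf.continuous_realFourier hG
    rintro _ ⟨ξ, rfl⟩
    exact VectorFourier.norm_fourierIntegral_le_integral_norm _ _ _ _ ξ
  have h_inv : 𝓕⁻ (F ⋆[ContinuousLinearMap.mul ℂ ℂ] G) =
      fun x => ((f x * multiplier m g x : ℝ) : ℂ) := by
    ext x
    rw [Real.fourierInv_eq_fourier_neg, Real.fourier_mul_convolution_eq hF hG,
      ← Real.fourierInv_eq_fourier_neg, ← Real.fourierInv_eq_fourier_neg, Complex.ofReal_mul,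
      hm.ofReal_multiplier, hf.fourierInv_realFourier]
  have h_fourier_int : Integrable (𝓕 (F ⋆[ContinuousLinearMap.mul ℂ ℂ] G)) := by
    have h_prod := (hf.mul_smooth (hg.contDiff_multiplier hm)).integrable_ofReal.comp_neg
    convert h_prod using 2 with x
    have hx := congrFun h_inv (-x)
    rwa [Real.fourierInv_eq_fourier_neg, neg_neg] at hx
  rw [← h_cont.fourier_fourierInv_eq (hF.integrable_convolution _ hG) h_fourier_int, h_inv]
  rfl

lemma frequencyWeight_mul_norm_realFourier_mul_multiplier_le (hε : 0 ≤ ε) (hf : IsTest f)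
    (hg : IsTest g) (hm : IsEvenSymbol m) {ξ : V}
    (hξ : Integrable fun η => (frequencyWeight ε K η * ‖realFourier f η‖) *
      (frequencyWeight ε K (ξ - η) * ‖realFourier g (ξ - η)‖)) :
    frequencyWeight ε K ξ * ‖realFourier (fun x => f x * multiplier m g x) ξ‖ ≤
      ∫ η, (frequencyWeight ε K η * ‖realFourier f η‖) *
        (frequencyWeight ε K (ξ - η) * ‖realFourier g (ξ - η)‖) := by
  have hw (η : V) := frequencyWeight_nonneg K hε η
  rw [hf.realFourier_mul_multiplier hg hm, convolution_def]
  refine (mul_le_mul_of_nonneg_left (norm_integral_le_integral_norm _) (hw ξ)).trans ?_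
  rw [← integral_const_mul]
  refine integral_mono_of_nonneg
    (ae_of_all _ fun η => mul_nonneg (hw ξ) (norm_nonneg _)) hξ (ae_of_all _ fun η => ?_)
  have h_weight := frequencyWeight_add_le K hε η (ξ - η)
  rw [add_sub_cancel] at h_weight
  simp only [ContinuousLinearMap.mul_apply', norm_mul (realFourier f η)]
  calc frequencyWeight ε K ξ * (‖realFourier f η‖ * ‖(m (ξ - η) : ℂ) * realFourier g (ξ - η)‖)
      ≤ (frequencyWeight ε K η * frequencyWeight ε K (ξ - η)) *
          (‖realFourier f η‖ * ‖realFourier g (ξ - η)‖) :=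
        mul_le_mul h_weight
          (mul_le_mul_of_nonneg_left (hm.norm_mul_le _ _) (norm_nonneg _))
          (by positivity) (mul_nonneg (hw _) (hw _))
    _ = _ := by ring

lemma weightedWienerNorm_mul_multiplier_le (hε : 0 ≤ ε) (hf : IsTest f) (hg : IsTest g)
    (hm : IsEvenSymbol m) :
    weightedWienerNorm ε K (fun x => f x * multiplier m g x) ≤
      weightedWienerNorm ε K f * weightedWienerNorm ε K g := by
  have hF := hf.integrable_frequencyWeight_mul K ε
  have hG := hg.integrable_frequencyWeight_mul K ε
  have h_prod := integral_convolution (ContinuousLinearMap.mul ℝ ℝ) hF hG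
  rw [ContinuousLinearMap.mul_apply'] at h_prod
  unfold weightedWienerNorm
  rw [← h_prod]
  refine integral_mono_ae
    ((hf.mul_smooth (hg.contDiff_multiplier hm)).integrable_frequencyWeight_mul K ε)
    (hF.integrable_convolution (ContinuousLinearMap.mul ℝ ℝ) hG) ?_
  filter_upwards [hF.ae_convolution_exists (ContinuousLinearMap.mul ℝ ℝ) hG] with ξ hξ
  exact frequencyWeight_mul_norm_realFourier_mul_multiplier_le K hε hf hg hm hξ

end IsTest

end WeightedWienerNorm

section TaylorCoeff

variable {V : Type*} [NormedAddCommGroup V] [InnerProductSpace ℝ V] [FiniteDimensional ℝ V]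
  [MeasurableSpace V] [BorelSpace V]

/-- The Taylor coefficients in time of the solution of `∂ₜ w = w m(D) w` with initial datum `u`. -/
def taylorCoeff (m u : V → ℝ) : ℕ → V → ℝ
  | 0 => u
  | n + 1 => fun x => ((n : ℝ) + 1)⁻¹ *
      ∑ i : Fin (n + 1), taylorCoeff m u i x * multiplier m (taylorCoeff m u (n - i)) x
decreasing_by all_goals omega

lemma taylorCoeff_zero (m u : V → ℝ) : taylorCoeff m u 0 = u := by rw [taylorCoeff]

lemma taylorCoeff_succ (m u : V → ℝ) (n : ℕ) :
    taylorCoeff m u (n + 1) = fun x => ((n : ℝ) + 1)⁻¹ * ∑ i ∈ Finset.range (n + 1),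
      taylorCoeff m u i x * multiplier m (taylorCoeff m u (n - i)) x := by
  rw [taylorCoeff]
  ext x
  rw [Finset.sum_range fun i => taylorCoeff m u i x * multiplier m (taylorCoeff m u (n - i)) x]

variable {m u : V → ℝ}

lemma taylorCoeff_eq_zero {x : V} (hx : u x = 0) (n : ℕ) : taylorCoeff m u n x = 0 := by
  induction n using Nat.strong_induction_on with
  | _ n ih =>
    cases n with
    | zero => rwa [taylorCoeff_zero]
    | succ n =>
      simp only [taylorCoeff_succ]
      rw [Finset.sum_eq_zero, mul_zero]
      intro i hi
      rw [ih i (Finset.mem_range.1 hi), zero_mul]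

lemma isTest_taylorCoeff (hm : IsEvenSymbol m) (hu : IsTest u) (n : ℕ) :
    IsTest (taylorCoeff m u n) := by
  induction n using Nat.strong_induction_on with
  | _ n ih =>
    cases n with
    | zero => rwa [taylorCoeff_zero]
    | succ n =>
      rw [taylorCoeff_succ]
      refine (IsTest.sum _ fun i hi => ?_).const_mul _
      rw [Finset.mem_range] at hi
      exact (ih i hi).mul_smooth ((ih (n - i) (by lia)).contDiff_multiplier hm)

lemma weightedWienerNorm_taylorCoeff_le {ε : ℝ} (hε : 0 ≤ ε) (K : ℕ) (hm : IsEvenSymbol m)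
    (hu : IsTest u) (n : ℕ) :
    weightedWienerNorm ε K (taylorCoeff m u n) ≤ weightedWienerNorm ε K u ^ (n + 1) := by
  induction n using Nat.strong_induction_on with
  | _ n ih =>
    cases n with
    | zero => rw [taylorCoeff_zero, zero_add, pow_one]
    | succ n =>
      have h_nonneg := weightedWienerNorm_nonneg K hε u
      have h_test := isTest_taylorCoeff hm hu
      have h_term : ∀ i ∈ Finset.range (n + 1), weightedWienerNorm ε K (fun x =>
          taylorCoeff m u i x * multiplier m (taylorCoeff m u (n - i)) x) ≤
            weightedWienerNorm ε K u ^ (n + 2) := fun i hi => by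
        rw [Finset.mem_range] at hi
        calc _ ≤ weightedWienerNorm ε K (taylorCoeff m u i) *
              weightedWienerNorm ε K (taylorCoeff m u (n - i)) :=
              (h_test i).weightedWienerNorm_mul_multiplier_le K hε (h_test (n - i)) hm
          _ ≤ weightedWienerNorm ε K u ^ (i + 1) * weightedWienerNorm ε K u ^ (n - i + 1) :=
              mul_le_mul (ih i hi) (ih (n - i) (by lia)) (weightedWienerNorm_nonneg K hε _)
                (by positivity)
          _ = _ := by rw [← pow_add]; congr 1; lia
      have h_sum := (IsTest.weightedWienerNorm_sum_le K hε (Finset.range (n + 1)) fun i _ =>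
        (h_test i).mul_smooth ((h_test (n - i)).contDiff_multiplier hm)).trans
          (Finset.sum_le_sum h_term)
      rw [Finset.sum_const, Finset.card_range, nsmul_eq_mul] at h_sum
      push_cast at h_sum
      rw [taylorCoeff_succ, weightedWienerNorm_const_mul, abs_of_pos (by positivity)]
      calc _ ≤ ((n : ℝ) + 1)⁻¹ * (((n : ℝ) + 1) * weightedWienerNorm ε K u ^ (n + 2)) := by gcongr
        _ = weightedWienerNorm ε K u ^ (n + 1 + 1) := by field_simp

lemma mul_wienerNorm_lt_one {ρ r : ℝ} (hρ : ρ * wienerNorm u ≤ 1) (hr : r < ρ) :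
    r * wienerNorm u < 1 := by
  rcases (wienerNorm_nonneg u).eq_or_lt with h | h
  · simp [← h]
  · exact (mul_lt_mul_of_pos_right hr h).trans_le hρ

lemma exists_pos_mul_weightedWienerNorm_le_one (hu : IsTest u) {r : ℝ} (hr : 0 ≤ r)
    (hlt : r * wienerNorm u < 1) (K : ℕ) : ∃ ε, 0 < ε ∧ r * weightedWienerNorm ε K u ≤ 1 := by
  have h_nonneg : 0 ≤ weightedWienerNorm 1 K u := weightedWienerNorm_nonneg K zero_le_one u
  have h_pos : 0 < r * weightedWienerNorm 1 K u + 1 := by positivity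
  set ε := min 1 ((1 - r * wienerNorm u) / (r * weightedWienerNorm 1 K u + 1))
  have hε : 0 < ε := lt_min one_pos (div_pos (by linarith) h_pos)
  have hε_le : ε * (r * weightedWienerNorm 1 K u + 1) ≤ 1 - r * wienerNorm u :=
    (le_div_iff₀ h_pos).1 (min_le_right _ _)
  refine ⟨ε, hε, ?_⟩
  calc r * weightedWienerNorm ε K u
      ≤ r * (wienerNorm u + ε * weightedWienerNorm 1 K u) := by
        gcongr
        exact hu.weightedWienerNorm_le_add K hε.le (min_le_left _ _)
    _ ≤ 1 := by linarith

lemma weightedWienerNorm_taylorCoeff_mul_pow_le {ε r : ℝ} (hε : 0 ≤ ε) (K : ℕ)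
    (hm : IsEvenSymbol m) (hu : IsTest u) (hr : 0 ≤ r) (hr1 : r * weightedWienerNorm ε K u ≤ 1)
    (n : ℕ) :
    weightedWienerNorm ε K (taylorCoeff m u n) * r ^ n ≤ weightedWienerNorm ε K u := by
  have h_nonneg := weightedWienerNorm_nonneg K hε u
  calc weightedWienerNorm ε K (taylorCoeff m u n) * r ^ n
      ≤ weightedWienerNorm ε K u ^ (n + 1) * r ^ n := by
        gcongr
        exact weightedWienerNorm_taylorCoeff_le hε K hm hu n
    _ = weightedWienerNorm ε K u * (r * weightedWienerNorm ε K u) ^ n := by ring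
    _ ≤ weightedWienerNorm ε K u :=
        mul_le_of_le_one_right h_nonneg (pow_le_one₀ (by positivity) hr1)

lemma exists_norm_iteratedFDeriv_taylorCoeff_le (hm : IsEvenSymbol m) (hu : IsTest u) {ρ r : ℝ}
    (hρ : ρ * wienerNorm u ≤ 1) (hr : 0 ≤ r) (hrρ : r < ρ) (k : ℕ) :
    ∃ C, ∀ n x, ‖iteratedFDeriv ℝ k (taylorCoeff m u n) x‖ * r ^ n ≤ C := by
  obtain ⟨ε, hε, hr1⟩ :=
    exists_pos_mul_weightedWienerNorm_le_one hu hr (mul_wienerNorm_lt_one hρ hrρ) k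
  refine ⟨(2 * Real.pi) ^ k * ((ε⁻¹) ^ k * weightedWienerNorm ε k u), fun n x => ?_⟩
  have h_test := isTest_taylorCoeff hm hu n
  calc ‖iteratedFDeriv ℝ k (taylorCoeff m u n) x‖ * r ^ n
      ≤ ((2 * Real.pi) ^ k * ((ε⁻¹) ^ k * weightedWienerNorm ε k (taylorCoeff m u n))) * r ^ n := by
        gcongr
        exact (h_test.norm_iteratedFDeriv_le k x).trans
          (by gcongr; exact h_test.integral_pow_norm_mul_realFourier_le k hε)
    _ = (2 * Real.pi) ^ k *
          ((ε⁻¹) ^ k * (weightedWienerNorm ε k (taylorCoeff m u n) * r ^ n)) := by ring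
    _ ≤ _ := by
        gcongr
        exact weightedWienerNorm_taylorCoeff_mul_pow_le hε.le k hm hu hr hr1 n

lemma summable_pow_mul_wienerNorm_taylorCoeff (hm : IsEvenSymbol m) (hu : IsTest u) {ρ t : ℝ}
    (hρ : ρ * wienerNorm u ≤ 1) (ht : |t| < ρ) :
    Summable fun n => |t| ^ n * wienerNorm (taylorCoeff m u n) := by
  have h_nonneg := wienerNorm_nonneg u
  refine Summable.of_nonneg_of_le
    (fun n => mul_nonneg (by positivity) (wienerNorm_nonneg _)) (fun n => ?_)
    ((summable_geometric_of_lt_one (by positivity)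
      (mul_wienerNorm_lt_one hρ ht)).mul_left (wienerNorm u))
  have h_coeff := weightedWienerNorm_taylorCoeff_le le_rfl 0 hm hu n
  simp only [weightedWienerNorm_zero_left] at h_coeff
  calc |t| ^ n * wienerNorm (taylorCoeff m u n) ≤ |t| ^ n * wienerNorm u ^ (n + 1) := by gcongr
    _ = _ := by ring

end TaylorCoeff

/-! ### Power series in time with smooth coefficients -/

lemma pow_succ_add_mul_le_add_pow_succ {r δ : ℝ} (hr : 0 ≤ r) (hδ : 0 ≤ δ) (n : ℕ) :
    r ^ (n + 1) + (n + 1) * r ^ n * δ ≤ (r + δ) ^ (n + 1) := by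
  induction n with
  | zero => simp
  | succ n ih =>
    rw [pow_succ (r + δ)]
    refine le_trans ?_ (mul_le_mul_of_nonneg_right ih (add_nonneg hr hδ))
    have h_square : 0 ≤ (n + 1) * r ^ n * δ ^ 2 := by positivity
    push_cast
    ring_nf at h_square ⊢
    linarith

section SmoothSeries

universe u

-- `V` and `F` share a universe because derivatives turn `F` into `V →L[ℝ] F` in an induction.
variable {V F : Type u} [NormedAddCommGroup V] [NormedSpace ℝ V] [NormedAddCommGroup F]
  [NormedSpace ℝ F]

/-- The coefficients `b n` are smooth, and all space derivatives of `∑ tⁿ b n` converge for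
`|t| < ρ`, uniformly in space. -/
structure SmoothSeries (ρ : ℝ) (b : ℕ → V → F) : Prop where
  smooth : ∀ n, ContDiff ℝ ∞ (b n)
  bound : ∀ (k : ℕ) (r : ℝ), 0 ≤ r → r < ρ → ∃ C, ∀ n x, ‖iteratedFDeriv ℝ k (b n) x‖ * r ^ n ≤ C

namespace SmoothSeries

variable {ρ : ℝ} {b : ℕ → V → F}

lemma timeDeriv (h : SmoothSeries ρ b) :
    SmoothSeries ρ fun n x => ((n : ℝ) + 1) • b (n + 1) x where
  smooth n := contDiff_const.smul (h.smooth (n + 1))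
  bound k r hr hrρ := by
    obtain ⟨r', hr', hr'ρ⟩ := exists_between hrρ
    obtain ⟨C, hC⟩ := h.bound k r' (hr.trans hr'.le) hr'ρ
    refine ⟨C / (r' - r), fun n x => ?_⟩
    have h_smul : iteratedFDeriv ℝ k (fun x => ((n : ℝ) + 1) • b (n + 1) x) x =
        ((n : ℝ) + 1) • iteratedFDeriv ℝ k (b (n + 1)) x :=
      iteratedFDeriv_const_smul_apply' ((h.smooth (n + 1)).of_le (mod_cast le_top)).contDiffAt
    have h_pow := pow_succ_add_mul_le_add_pow_succ hr (sub_nonneg.2 hr'.le) n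
    rw [add_sub_cancel] at h_pow
    have hr_pow : 0 ≤ r ^ (n + 1) := by positivity
    rw [h_smul, norm_smul, le_div_iff₀ (by linarith), Real.norm_of_nonneg (by positivity)]
    calc _ = ‖iteratedFDeriv ℝ k (b (n + 1)) x‖ * ((n + 1) * r ^ n * (r' - r)) := by ring
      _ ≤ ‖iteratedFDeriv ℝ k (b (n + 1)) x‖ * r' ^ (n + 1) := by gcongr; linarith
      _ ≤ C := hC _ _

lemma fderiv (h : SmoothSeries ρ b) : SmoothSeries ρ fun n => fderiv ℝ (b n) where
  smooth n := (h.smooth n).fderiv_right (mod_cast le_top)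
  bound k r hr hrρ := by
    obtain ⟨C, hC⟩ := h.bound (k + 1) r hr hrρ
    refine ⟨C, fun n x => ?_⟩
    rw [norm_iteratedFDeriv_fderiv]
    exact hC n x

lemma exists_summable (h : SmoothSeries ρ b) {r : ℝ} (hr : 0 ≤ r) (hrρ : r < ρ) :
    ∃ v : ℕ → ℝ, Summable v ∧ ∀ n x, ‖b n x‖ * r ^ n ≤ v n := by
  obtain ⟨r', hr', hr'ρ⟩ := exists_between hrρ
  have hr'_pos : 0 < r' := hr.trans_lt hr'
  obtain ⟨C, hC⟩ := h.bound 0 r' hr'_pos.le hr'ρ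
  simp only [norm_iteratedFDeriv_zero] at hC
  refine ⟨fun n => C * (r / r') ^ n, (summable_geometric_of_lt_one (by positivity)
    ((div_lt_one hr'_pos).2 hr')).mul_left C, fun n x => ?_⟩
  calc ‖b n x‖ * r ^ n = (‖b n x‖ * r' ^ n) * (r / r') ^ n := by
        rw [div_pow]; field_simp
    _ ≤ _ := mul_le_mul_of_nonneg_right (hC n x) (by positivity)

lemma summable_norm (h : SmoothSeries ρ b) {t : ℝ} (ht : |t| < ρ) (x : V) :
    Summable fun n => ‖t ^ n • b n x‖ := by
  obtain ⟨v, hv, hvb⟩ := h.exists_summable (abs_nonneg t) ht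
  refine Summable.of_nonneg_of_le (fun _ => norm_nonneg _) (fun n => ?_) hv
  rw [norm_smul, norm_pow, Real.norm_eq_abs, mul_comm]
  exact hvb n x

/-- The time part of the derivative of the term `tⁿ b n` of the series. -/
def termTimeFDeriv (b : ℕ → V → F) (n : ℕ) (p : ℝ × V) : ℝ × V →L[ℝ] F :=
  (ContinuousLinearMap.fst ℝ ℝ V).smulRight ((n * p.1 ^ (n - 1)) • b n p.2)

/-- The space part of the derivative of the term `tⁿ b n` of the series. -/
def termSpaceFDeriv (b : ℕ → V → F) (n : ℕ) (p : ℝ × V) : ℝ × V →L[ℝ] F :=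
  (p.1 ^ n • _root_.fderiv ℝ (b n) p.2).comp (ContinuousLinearMap.snd ℝ ℝ V)

lemma hasFDerivAt_term (h : SmoothSeries ρ b) (n : ℕ) (p : ℝ × V) :
    HasFDerivAt (fun p : ℝ × V => p.1 ^ n • b n p.2)
      (termTimeFDeriv b n p + termSpaceFDeriv b n p) p := by
  have h_time : HasFDerivAt (fun p : ℝ × V => p.1 ^ n)
      (((n : ℝ) * p.1 ^ (n - 1)) • ContinuousLinearMap.fst ℝ ℝ V) p := by
    simpa using (hasFDerivAt_fst (𝕜 := ℝ) (p := p)).pow n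
  have h_space : HasFDerivAt (fun p : ℝ × V => b n p.2)
      ((_root_.fderiv ℝ (b n) p.2).comp (ContinuousLinearMap.snd ℝ ℝ V)) p :=
    (((h.smooth n).differentiable (by simp)) p.2).hasFDerivAt.comp p hasFDerivAt_snd
  refine (h_time.smul h_space).congr_fderiv ?_
  ext q <;> simp [termTimeFDeriv, termSpaceFDeriv, mul_smul]

lemma exists_summable_norm_termTimeFDeriv_le (h : SmoothSeries ρ b) {r : ℝ} (hr : 0 ≤ r)
    (hrρ : r < ρ) : ∃ v : ℕ → ℝ, Summable v ∧
      ∀ n (p : ℝ × V), |p.1| ≤ r → ‖termTimeFDeriv b n p‖ ≤ v n := by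
  obtain ⟨v, hv, hvb⟩ := h.timeDeriv.exists_summable hr hrρ
  refine ⟨fun n => Nat.casesOn n 0 v, (summable_nat_add_iff 1).1 hv, fun n p hp => ?_⟩
  refine (ContinuousLinearMap.norm_smulRight_apply _ _).trans_le
    ((mul_le_of_le_one_left (norm_nonneg _) (ContinuousLinearMap.norm_fst_le ..)).trans ?_)
  cases n with
  | zero => simp
  | succ n =>
    refine le_trans ?_ (hvb n p.2)
    rw [norm_smul, norm_smul, norm_mul, norm_pow, Nat.add_sub_cancel, Real.norm_eq_abs p.1]
    push_cast
    rw [mul_right_comm]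
    gcongr

lemma exists_summable_norm_termSpaceFDeriv_le (h : SmoothSeries ρ b) {r : ℝ} (hr : 0 ≤ r)
    (hrρ : r < ρ) : ∃ v : ℕ → ℝ, Summable v ∧
      ∀ n (p : ℝ × V), |p.1| ≤ r → ‖termSpaceFDeriv b n p‖ ≤ v n := by
  obtain ⟨v, hv, hvb⟩ := h.fderiv.exists_summable hr hrρ
  refine ⟨v, hv, fun n p hp => ?_⟩
  refine (ContinuousLinearMap.opNorm_comp_le _ _).trans
    ((mul_le_of_le_one_right (norm_nonneg _) (ContinuousLinearMap.norm_snd_le ..)).trans ?_)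
  refine le_trans ?_ (hvb n p.2)
  rw [norm_smul, norm_pow, Real.norm_eq_abs p.1, mul_comm]
  gcongr

variable [CompleteSpace F]

lemma tsum_termTimeFDeriv (h : SmoothSeries ρ b) {p : ℝ × V} (hp : |p.1| < ρ) :
    ∑' n, termTimeFDeriv b n p = ContinuousLinearMap.smulRightL ℝ (ℝ × V) F
      (ContinuousLinearMap.fst ℝ ℝ V) (∑' n : ℕ, p.1 ^ n • (((n : ℝ) + 1) • b (n + 1) p.2)) := by
  obtain ⟨v, hv, hvb⟩ := h.exists_summable_norm_termTimeFDeriv_le (abs_nonneg _) hp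
  have h_zero : termTimeFDeriv b 0 p = 0 := by simp [termTimeFDeriv]
  rw [(Summable.of_norm_bounded hv fun n => hvb n p le_rfl).tsum_eq_zero_add, h_zero, zero_add,
    ContinuousLinearMap.map_tsum _ (h.timeDeriv.summable_norm hp p.2).of_norm]
  refine tsum_congr fun n => ?_
  simp only [termTimeFDeriv, Nat.add_sub_cancel, smul_smul]
  push_cast
  rw [mul_comm]
  rfl

lemma tsum_termSpaceFDeriv (h : SmoothSeries ρ b) {p : ℝ × V} (hp : |p.1| < ρ) :
    ∑' n, termSpaceFDeriv b n p = (ContinuousLinearMap.compL ℝ (ℝ × V) V F).flip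
      (ContinuousLinearMap.snd ℝ ℝ V) (∑' n : ℕ, p.1 ^ n • _root_.fderiv ℝ (b n) p.2) := by
  rw [ContinuousLinearMap.map_tsum _ (h.fderiv.summable_norm hp p.2).of_norm]
  rfl

lemma hasFDerivAt (h : SmoothSeries ρ b) {p : ℝ × V} (hp : |p.1| < ρ) :
    HasFDerivAt (fun p : ℝ × V => ∑' n, p.1 ^ n • b n p.2)
      (ContinuousLinearMap.smulRightL ℝ (ℝ × V) F (ContinuousLinearMap.fst ℝ ℝ V)
          (∑' n : ℕ, p.1 ^ n • (((n : ℝ) + 1) • b (n + 1) p.2)) +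
        (ContinuousLinearMap.compL ℝ (ℝ × V) V F).flip (ContinuousLinearMap.snd ℝ ℝ V)
          (∑' n : ℕ, p.1 ^ n • _root_.fderiv ℝ (b n) p.2)) p := by
  obtain ⟨r, hpr, hrρ⟩ := exists_between hp
  have hr : 0 ≤ r := (abs_nonneg _).trans hpr.le
  obtain ⟨u, hu, hub⟩ := h.exists_summable_norm_termTimeFDeriv_le hr hrρ
  obtain ⟨v, hv, hvb⟩ := h.exists_summable_norm_termSpaceFDeriv_le hr hrρ
  have h_mem : p ∈ Ioo (-r) r ×ˢ (univ : Set V) := ⟨abs_lt.1 hpr, mem_univ _⟩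
  rw [← h.tsum_termTimeFDeriv hp, ← h.tsum_termSpaceFDeriv hp,
    ← (Summable.of_norm_bounded hu fun n => hub n p hpr.le).tsum_add
      (Summable.of_norm_bounded hv fun n => hvb n p hpr.le)]
  refine hasFDerivAt_tsum_of_isPreconnected (hu.add hv) (isOpen_Ioo.prod isOpen_univ)
    (isPreconnected_Ioo.prod isPreconnected_univ) (fun n q _ => h.hasFDerivAt_term n q)
    (fun n q hq => ?_) h_mem (h.summable_norm hp p.2).of_norm h_mem
  have hq_le : |q.1| ≤ r := (abs_lt.2 hq.1).le
  exact (norm_add_le _ _).trans (add_le_add (hub n q hq_le) (hvb n q hq_le))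

lemma contDiffOn_nat (h : SmoothSeries ρ b) (k : ℕ) :
    ContDiffOn ℝ k (fun p : ℝ × V => ∑' n, p.1 ^ n • b n p.2) (Ioo (-ρ) ρ ×ˢ univ) := by
  have h_open : IsOpen (Ioo (-ρ) ρ ×ˢ (univ : Set V)) := isOpen_Ioo.prod isOpen_univ
  induction k generalizing F with
  | zero =>
    exact contDiffOn_zero.2 fun p hp =>
      (h.hasFDerivAt (abs_lt.2 hp.1)).continuousAt.continuousWithinAt
  | succ k ih =>
    push_cast
    rw [contDiffOn_succ_iff_fderiv_of_isOpen h_open]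
    refine ⟨fun p hp => (h.hasFDerivAt (abs_lt.2 hp.1)).differentiableAt.differentiableWithinAt,
      by simp, ?_⟩
    exact ContDiffOn.congr
      (((ContinuousLinearMap.contDiff _).comp_contDiffOn (ih h.timeDeriv)).add
        ((ContinuousLinearMap.contDiff _).comp_contDiffOn (ih h.fderiv)))
      fun p hp => (h.hasFDerivAt (abs_lt.2 hp.1)).fderiv

lemma contDiffOn (h : SmoothSeries ρ b) :
    ContDiffOn ℝ ∞ (fun p : ℝ × V => ∑' n, p.1 ^ n • b n p.2) (Ioo (-ρ) ρ ×ˢ univ) :=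
  contDiffOn_infty.2 h.contDiffOn_nat

end SmoothSeries

end SmoothSeries

/-! ### Local existence -/

section TaylorSolution

variable {V : Type} [NormedAddCommGroup V] [InnerProductSpace ℝ V] [FiniteDimensional ℝ V]
  [MeasurableSpace V] [BorelSpace V]

/-- The sum of the Taylor series in time with coefficients `taylorCoeff m u`: the local solution of
`∂ₜ w = w m(D) w` with initial datum `u`. -/
def taylorSolution (m u : V → ℝ) (t : ℝ) (x : V) : ℝ := ∑' n, t ^ n • taylorCoeff m u n x

lemma taylorSolution_zero (m u : V → ℝ) : taylorSolution m u 0 = u := by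
  ext x
  rw [taylorSolution, tsum_eq_single 0 fun n hn => by simp [hn]]
  simp [taylorCoeff_zero]

variable {m u : V → ℝ} {ρ t : ℝ}

lemma taylorSolution_eq_zero {x : V} (hx : u x = 0) (t : ℝ) : taylorSolution m u t x = 0 := by
  simp [taylorSolution, taylorCoeff_eq_zero hx]

lemma smoothSeries_taylorCoeff (hm : IsEvenSymbol m) (hu : IsTest u)
    (hρ : ρ * wienerNorm u ≤ 1) : SmoothSeries ρ (taylorCoeff m u) where
  smooth n := (isTest_taylorCoeff hm hu n).smooth
  bound k _ hr hrρ := exists_norm_iteratedFDeriv_taylorCoeff_le hm hu hρ hr hrρ k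

lemma contDiffOn_taylorSolution (hm : IsEvenSymbol m) (hu : IsTest u)
    (hρ : ρ * wienerNorm u ≤ 1) :
    ContDiffOn ℝ ∞ (fun p : ℝ × V => taylorSolution m u p.1 p.2) (Ioo (-ρ) ρ ×ˢ univ) :=
  (smoothSeries_taylorCoeff hm hu hρ).contDiffOn

lemma isTest_taylorSolution (hm : IsEvenSymbol m) (hu : IsTest u) (hρ : ρ * wienerNorm u ≤ 1)
    (ht : |t| < ρ) : IsTest (taylorSolution m u t) where
  smooth := contDiffOn_univ.1 <|
    (contDiffOn_taylorSolution hm hu hρ).comp (f := fun x : V => (t, x)) (by fun_prop)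
      fun _ _ => ⟨abs_lt.1 ht, mem_univ _⟩
  compact := hu.compact.mono fun _ hx hux => hx (taylorSolution_eq_zero hux t)

lemma summable_integral_norm_taylorCoeff (hm : IsEvenSymbol m) (hu : IsTest u)
    (hρ : ρ * wienerNorm u ≤ 1) (ht : |t| < ρ) :
    Summable fun n => ∫ x, ‖(t : ℂ) ^ n * (taylorCoeff m u n x : ℂ)‖ := by
  obtain ⟨v, hv, hvb⟩ :=
    (smoothSeries_taylorCoeff hm hu hρ).exists_summable (abs_nonneg t) ht
  have h_compact : IsCompact (tsupport u) := hu.compact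
  refine Summable.of_nonneg_of_le (fun n => integral_nonneg fun _ => norm_nonneg _) (fun n => ?_)
    (hv.mul_right (volume.real (tsupport u)))
  rw [← setIntegral_eq_integral_of_forall_compl_eq_zero (s := tsupport u) fun x hx => by
    rw [taylorCoeff_eq_zero (image_eq_zero_of_notMem_tsupport hx)]; simp]
  refine (Real.le_norm_self _).trans
    (norm_setIntegral_le_of_norm_le_const h_compact.measure_lt_top fun x _ => ?_)
  simpa [mul_comm] using hvb n x

lemma hasSum_realFourier_taylorSolution (hm : IsEvenSymbol m) (hu : IsTest u)
    (hρ : ρ * wienerNorm u ≤ 1) (ht : |t| < ρ) (ξ : V) :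
    HasSum (fun n => (t : ℂ) ^ n * realFourier (taylorCoeff m u n) ξ)
      (realFourier (taylorSolution m u t) ξ) := by
  have h_sum := hasSum_fourier
    (fun n => (isTest_taylorCoeff hm hu n).integrable_ofReal.const_mul ((t : ℂ) ^ n))
    (summable_integral_norm_taylorCoeff hm hu hρ ht) ξ
  have h_term (n : ℕ) : 𝓕 (fun x => (t : ℂ) ^ n * (taylorCoeff m u n x : ℂ)) ξ =
      (t : ℂ) ^ n * realFourier (taylorCoeff m u n) ξ := by
    have h_const := realFourier_const_mul (t ^ n) (taylorCoeff m u n) ξ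
    simpa only [realFourier, Complex.ofReal_mul, Complex.ofReal_pow] using h_const
  simp only [h_term] at h_sum
  simpa [realFourier, taylorSolution, Complex.ofReal_tsum] using h_sum

lemma hasSum_multiplier_taylorSolution (hm : IsEvenSymbol m) (hu : IsTest u)
    (hρ : ρ * wienerNorm u ≤ 1) (ht : |t| < ρ) (x : V) :
    HasSum (fun n => t ^ n * multiplier m (taylorCoeff m u n) x)
      (multiplier m (taylorSolution m u t) x) := by
  have h_test := isTest_taylorCoeff hm hu
  have h_int (n : ℕ) : Integrable fun ξ =>
      (t : ℂ) ^ n * ((m ξ : ℂ) * realFourier (taylorCoeff m u n) ξ) :=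
    ((h_test n).integrable_mul_realFourier hm).const_mul _
  have h_norm (n : ℕ) : ∫ ξ, ‖(t : ℂ) ^ n * ((m ξ : ℂ) * realFourier (taylorCoeff m u n) ξ)‖ ≤
      |t| ^ n * wienerNorm (taylorCoeff m u n) := by
    rw [wienerNorm, ← integral_const_mul]
    refine integral_mono (h_int n).norm ((h_test n).integrable_realFourier.norm.const_mul _)
      fun ξ => ?_
    dsimp only
    rw [norm_mul, norm_pow, Complex.norm_real, Real.norm_eq_abs]
    gcongr
    exact hm.norm_mul_le _ ξ
  have h_sum := hasSum_fourierInv h_int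
    (Summable.of_nonneg_of_le (fun n => integral_nonneg fun _ => norm_nonneg _) h_norm
      (summable_pow_mul_wienerNorm_taylorCoeff hm hu hρ ht)) x
  have h_term (n : ℕ) :
      𝓕⁻ (fun ξ => (t : ℂ) ^ n * ((m ξ : ℂ) * realFourier (taylorCoeff m u n) ξ)) x =
        ((t ^ n * multiplier m (taylorCoeff m u n) x : ℝ) : ℂ) := by
    rw [Complex.ofReal_mul, hm.ofReal_multiplier, Real.fourierInv_eq, Real.fourierInv_eq,
      ← integral_const_mul, Complex.ofReal_pow]
    simp only [mul_smul_comm]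
  have h_tsum (ξ : V) : ∑' n, (t : ℂ) ^ n * ((m ξ : ℂ) * realFourier (taylorCoeff m u n) ξ) =
      (m ξ : ℂ) * realFourier (taylorSolution m u t) ξ := by
    rw [← (hasSum_realFourier_taylorSolution hm hu hρ ht ξ).tsum_eq, ← tsum_mul_left]
    exact tsum_congr fun n => mul_left_comm _ _ _
  simp only [h_term, h_tsum, ← hm.ofReal_multiplier] at h_sum
  exact_mod_cast h_sum

lemma continuousOn_multiplier_taylorSolution (hm : IsEvenSymbol m) (hu : IsTest u)
    (hρ : ρ * wienerNorm u ≤ 1) :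
    ContinuousOn (fun p : ℝ × V => multiplier m (taylorSolution m u p.1) p.2)
      (Ioo (-ρ) ρ ×ˢ univ) := by
  intro p hp
  obtain ⟨r, hpr, hrρ⟩ := exists_between (abs_lt.2 hp.1)
  have hr : 0 ≤ r := (abs_nonneg _).trans hpr.le
  have hr_abs : |r| = r := abs_of_nonneg hr
  have h_nhds : Ioo (-r) r ×ˢ (univ : Set V) ∈ nhds p :=
    (isOpen_Ioo.prod isOpen_univ).mem_nhds ⟨abs_lt.1 hpr, mem_univ _⟩
  have h_tsum : ContinuousOn
      (fun p : ℝ × V => ∑' n, p.1 ^ n * multiplier m (taylorCoeff m u n) p.2)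
      (Ioo (-r) r ×ˢ univ) := by
    refine continuousOn_tsum (fun n => ?_)
      (summable_pow_mul_wienerNorm_taylorCoeff hm hu hρ (hr_abs.trans_lt hrρ)) fun n q hq => ?_
    · have h_cont := ((isTest_taylorCoeff hm hu n).contDiff_multiplier hm).continuous
      exact Continuous.continuousOn (by fun_prop)
    · rw [norm_mul, norm_pow, Real.norm_eq_abs, Real.norm_eq_abs, hr_abs]
      have hq_le := (abs_lt.2 hq.1).le
      gcongr
      exact (isTest_taylorCoeff hm hu n).abs_multiplier_le hm q.2
  refine ContinuousAt.continuousWithinAt ((h_tsum.congr fun q hq => ?_).continuousAt h_nhds)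
  exact (hasSum_multiplier_taylorSolution hm hu hρ
    ((abs_lt.2 hq.1).trans hrρ) q.2).tsum_eq.symm

lemma hasDerivAt_taylorSolution (hm : IsEvenSymbol m) (hu : IsTest u)
    (hρ : ρ * wienerNorm u ≤ 1) (ht : |t| < ρ) (x : V) :
    HasDerivAt (fun s => taylorSolution m u s x)
      (taylorSolution m u t x * multiplier m (taylorSolution m u t) x) t := by
  have h_series := smoothSeries_taylorCoeff hm hu hρ
  have h_multiplier := hasSum_multiplier_taylorSolution hm hu hρ ht x
  have h_deriv := (h_series.hasFDerivAt (p := (t, x)) ht).comp_hasDerivAt t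
    ((hasDerivAt_id t).prodMk (hasDerivAt_const t x))
  refine h_deriv.congr_deriv ?_
  rw [← h_multiplier.tsum_eq, taylorSolution,
    tsum_mul_tsum_eq_tsum_sum_range_of_summable_norm (h_series.summable_norm ht x)
      h_multiplier.summable.norm]
  simp only [add_apply, ContinuousLinearMap.smulRightL_apply_apply,
    ContinuousLinearMap.smulRight_apply, ContinuousLinearMap.coe_fst',
    ContinuousLinearMap.flip_apply, ContinuousLinearMap.compL_apply,
    ContinuousLinearMap.comp_apply, ContinuousLinearMap.coe_snd', map_zero, add_zero, one_smul]
  refine tsum_congr fun n => ?_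
  rw [taylorCoeff_succ]
  simp only [smul_eq_mul]
  rw [mul_inv_cancel_left₀ (by positivity), Finset.mul_sum]
  refine Finset.sum_congr rfl fun i hi => ?_
  rw [← pow_mul_pow_sub t (Finset.mem_range_succ_iff.1 hi)]
  ring

end TaylorSolution

/-! ### Uniqueness -/

lemma eq_mul_exp_integral {T : ℝ} {a y : ℝ → ℝ} (ha : ContinuousOn a (Ico 0 T))
    (hy : ∀ t ∈ Ico 0 T, HasDerivWithinAt y (y t * a t) (Ico 0 T) t) {t : ℝ} (ht : t ∈ Ico 0 T) :
    y t = y 0 * Real.exp (∫ s in (0 : ℝ)..t, a s) := by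
  have h_sub : Icc 0 t ⊆ Ico 0 T := fun s hs => ⟨hs.1, hs.2.trans_lt ht.2⟩
  -- a continuous extension, because the primitive of `a` must be differentiable at the end points
  set A : ℝ → ℝ := IccExtend ht.1 ((Icc 0 t).domRestrict a)
  have hA : Continuous A := (ha.mono h_sub).domRestrict.Icc_extend'
  have hA_eq : ∀ s ∈ Icc 0 t, A s = a s := fun s hs => IccExtend_of_mem _ _ hs
  set G : ℝ → ℝ := fun s => ∫ r in (0 : ℝ)..s, A r
  have hG_deriv (s : ℝ) : HasDerivAt G (A s) s := (hA.integral_hasStrictDerivAt 0 s).hasDerivAt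
  have hG_eq : ∫ s in (0 : ℝ)..t, a s = G t :=
    intervalIntegral.integral_congr fun s hs => (hA_eq s (by rwa [uIcc_of_le ht.1] at hs)).symm
  have h_deriv : ∀ s ∈ Icc 0 t,
      HasDerivWithinAt (fun s => y s * Real.exp (-G s)) 0 (Ico 0 T) s := fun s hs => by
    refine ((hy s (h_sub hs)).mul ((hG_deriv s).neg.exp.hasDerivWithinAt)).congr_deriv ?_
    rw [hA_eq s hs]
    ring
  have h_const : y t * Real.exp (-G t) = y 0 * Real.exp (-G 0) :=
    constant_of_has_deriv_right_zero (f := fun s => y s * Real.exp (-G s))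
      (fun s hs => ((h_deriv s hs).mono h_sub).continuousWithinAt)
      (fun s hs => (h_deriv s (Ico_subset_Icc_self hs)).mono_of_mem_nhdsWithin <|
        Filter.mem_of_superset (Ico_mem_nhdsGE (hs.2.trans ht.2)) (Ico_subset_Ico_left hs.1))
      t (right_mem_Icc.2 ht.1)
  have hG_zero : G 0 = 0 := intervalIntegral.integral_same
  rw [hG_zero, neg_zero, Real.exp_zero, mul_one] at h_const
  rw [hG_eq, ← h_const, mul_assoc, ← Real.exp_add, neg_add_cancel, Real.exp_zero, mul_one]

lemma nonpos_of_hasDerivAt_le_mul {E E' : ℝ → ℝ} {b C : ℝ} (hb : 0 ≤ b)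
    (h_cont : ContinuousOn E (Icc 0 b)) (h_deriv : ∀ s ∈ Ioo 0 b, HasDerivAt E (E' s) s)
    (h_le : ∀ s ∈ Ioo 0 b, E' s ≤ C * E s) (h_zero : E 0 ≤ 0) : E b ≤ 0 := by
  have h_exp_deriv : ∀ s ∈ Ioo 0 b, HasDerivAt (fun s => E s * Real.exp (-(C * s)))
      (E' s * Real.exp (-(C * s)) + E s * (Real.exp (-(C * s)) * -C)) s := fun s hs => by
    have h_linear : HasDerivAt (fun s => -(C * s)) (-C) s := by
      simpa using ((hasDerivAt_id s).const_mul C).fun_neg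
    exact (h_deriv s hs).mul h_linear.exp
  have h_anti : AntitoneOn (fun s => E s * Real.exp (-(C * s))) (Icc 0 b) := by
    refine antitoneOn_of_deriv_nonpos (convex_Icc 0 b) (h_cont.mul (by fun_prop)) ?_ ?_ <;>
      rw [interior_Icc] <;> intro s hs
    · exact (h_exp_deriv s hs).differentiableAt.differentiableWithinAt
    · rw [(h_exp_deriv s hs).deriv]
      linarith [mul_le_mul_of_nonneg_right (h_le s hs) (Real.exp_pos (-(C * s))).le]
  have h_end := h_anti (left_mem_Icc.2 hb) (right_mem_Icc.2 hb) hb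
  simp only [mul_zero, neg_zero, Real.exp_zero, mul_one] at h_end
  exact nonpos_of_mul_nonpos_left (h_end.trans h_zero) (Real.exp_pos _)

lemma hasDerivAt_integral_of_compact_support {X : Type*} [TopologicalSpace X] [T2Space X]
    [MeasurableSpace X] [OpensMeasurableSpace X] {μ : Measure X} [IsFiniteMeasureOnCompacts μ]
    {K : Set X} (hK : IsCompact K) {I : Set ℝ} (hI : IsOpen I) {F F' : ℝ → X → ℝ}
    (hF : ∀ s ∈ I, Continuous (F s))
    (hF' : ContinuousOn (fun p : ℝ × X => F' p.1 p.2) (I ×ˢ univ))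
    (h_deriv : ∀ s ∈ I, ∀ x, HasDerivAt (fun s => F s x) (F' s x) s)
    (h_supp : ∀ s ∈ I, ∀ x ∉ K, F s x = 0) {t : ℝ} (ht : t ∈ I) :
    HasDerivAt (fun s => ∫ x, F s x ∂μ) (∫ x, F' t x ∂μ) t := by
  obtain ⟨r, hr, h_ball⟩ := Metric.nhds_basis_closedBall.mem_iff.1 (hI.mem_nhds ht)
  obtain ⟨M, hM⟩ := ((isCompact_closedBall t r).prod hK).exists_bound_of_continuousOn
    (hF'.mono (prod_mono h_ball (subset_univ K)))
  have hF'_slice : Continuous (F' t) := continuousOn_univ.1 <|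
    hF'.comp (f := fun x : X => (t, x)) (by fun_prop) fun _ _ => ⟨ht, mem_univ _⟩
  have h_supp' : ∀ s ∈ I, ∀ x ∉ K, F' s x = 0 := fun s hs x hx =>
    (h_deriv s hs x).unique <| (hasDerivAt_const s 0).congr_of_eventuallyEq <|
      Filter.mem_of_superset (hI.mem_nhds hs) fun r hr => h_supp r hr x hx
  refine (hasDerivAt_integral_of_dominated_loc_of_deriv_le (F := F) (F' := F')
    (bound := K.indicator fun _ => M) (Metric.closedBall_mem_nhds t hr)
    (Filter.mem_of_superset (hI.mem_nhds ht) fun s hs => (hF s hs).aestronglyMeasurable)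
    ((hF t ht).integrable_of_hasCompactSupport (HasCompactSupport.intro hK (h_supp t ht)))
    hF'_slice.aestronglyMeasurable (ae_of_all _ fun x s hs => ?_)
    ((integrable_indicator_iff hK.measurableSet).2 (integrableOn_const hK.measure_lt_top.ne))
    (ae_of_all _ fun x s hs => h_deriv s (h_ball hs) x)).2
  by_cases hx : x ∈ K
  · rw [indicator_of_mem hx]
    exact hM (s, x) ⟨hs, hx⟩
  · rw [indicator_of_notMem hx, h_supp' s (h_ball hs) x hx, norm_zero]

section SolvesAt

variable {V : Type} [NormedAddCommGroup V] [InnerProductSpace ℝ V] [FiniteDimensional ℝ V]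
  [MeasurableSpace V] [BorelSpace V] {m : V → ℝ}

/-- `v` solves `∂ₜ v = v m(D) v` at the time `t`, relative to the set of times `S`, and it is smooth
with compact support there. Unlike `IsSmoothSolution`, this notion is local in time, so that
solutions can be glued. -/
structure SolvesAt (m : V → ℝ) (S : Set ℝ) (v : ℝ → V → ℝ) (t : ℝ) : Prop where
  isTest : IsTest (v t)
  smooth : ∀ x, ContDiffWithinAt ℝ ∞ (fun p : ℝ × V => v p.1 p.2) (S ×ˢ univ) (t, x)
  cont : ∀ x, ContinuousWithinAt (fun p : ℝ × V => multiplier m (v p.1) p.2) (S ×ˢ univ) (t, x)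
  deriv : ∀ x, HasDerivWithinAt (fun s => v s x) (v t x * multiplier m (v t) x) S t

namespace SolvesAt

variable {S S' : Set ℝ} {v v' : ℝ → V → ℝ} {t : ℝ}

lemma congr (h : SolvesAt m S v t) (hS : S ∈ nhdsWithin t S')
    (hv : ∀ᶠ s in nhdsWithin t S', v' s = v s) (ht : v' t = v t) : SolvesAt m S' v' t := by
  have h_prod (x : V) : S ×ˢ (univ : Set V) ∈ nhdsWithin (t, x) (S' ×ˢ univ) := by
    rw [nhdsWithin_prod_eq]
    exact Filter.prod_mem_prod hS Filter.univ_mem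
  have h_eventually (x : V) : ∀ᶠ p : ℝ × V in nhdsWithin (t, x) (S' ×ˢ univ), v' p.1 = v p.1 := by
    rw [nhdsWithin_prod_eq]
    exact Filter.tendsto_fst.eventually hv
  refine ⟨by rw [ht]; exact h.isTest, fun x => ?_, fun x => ?_, fun x => ?_⟩
  · exact ((h.smooth x).mono_of_mem_nhdsWithin (h_prod x)).congr_of_eventuallyEq
      ((h_eventually x).mono fun p hp => by simp only [hp]) (by simp only [ht])
  · exact ((h.cont x).mono_of_mem_nhdsWithin (h_prod x)).congr_of_eventuallyEq
      ((h_eventually x).mono fun p hp => by simp only [hp]) (by simp only [ht])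
  · rw [ht]
    exact ((h.deriv x).mono_of_mem_nhdsWithin hS).congr_of_eventuallyEq
      (hv.mono fun s hs => by simp only [hs]) (by simp only [ht])

lemma comp_sub {c : ℝ} (h : SolvesAt m S v (t - c)) (hS : ∀ s ∈ S', s - c ∈ S) :
    SolvesAt m S' (fun s => v (s - c)) t := by
  have h_maps : MapsTo (fun p : ℝ × V => (p.1 - c, p.2)) (S' ×ˢ univ) (S ×ˢ univ) :=
    fun p hp => ⟨hS p.1 hp.1, mem_univ _⟩
  refine ⟨h.isTest, fun x => ?_, fun x => ?_, fun x => ?_⟩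
  · exact (h.smooth x).comp (t, x) (f := fun p : ℝ × V => (p.1 - c, p.2)) (by fun_prop) h_maps
  · exact (h.cont x).comp (f := fun p : ℝ × V => (p.1 - c, p.2)) (x := (t, x)) (by fun_prop) h_maps
  · simpa [Function.comp_def] using (h.deriv x).scomp t (h := fun s => s - c) (s := S')
      ((hasDerivWithinAt_id t S').sub_const c) hS

end SolvesAt

lemma solvesAt_taylorSolution {u : V → ℝ} {ρ t : ℝ} (hm : IsEvenSymbol m) (hu : IsTest u)
    (hρ : ρ * wienerNorm u ≤ 1) (ht : |t| < ρ) :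
    SolvesAt m (Ioo (-ρ) ρ) (taylorSolution m u) t where
  isTest := isTest_taylorSolution hm hu hρ ht
  smooth x := contDiffOn_taylorSolution hm hu hρ (t, x) ⟨abs_lt.1 ht, mem_univ _⟩
  cont x := continuousOn_multiplier_taylorSolution hm hu hρ (t, x) ⟨abs_lt.1 ht, mem_univ _⟩
  deriv x := (hasDerivAt_taylorSolution hm hu hρ ht x).hasDerivWithinAt

end SolvesAt

section EnergyEstimate

variable {V : Type*} [NormedAddCommGroup V] [InnerProductSpace ℝ V] [FiniteDimensional ℝ V]
  [MeasurableSpace V] [BorelSpace V] {m f g : V → ℝ} {M : ℝ}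

lemma sub_mul_nonlinearity_sub_le {a b Ra Rb : ℝ} (hRa : |Ra| ≤ M) (hb : |b| ≤ M) :
    2 * (a - b) * (a * Ra - b * Rb) ≤ 3 * M * (a - b) ^ 2 + M * (Ra - Rb) ^ 2 := by
  have hM : 0 ≤ M := (abs_nonneg b).trans hb
  have h_square : Ra * (a - b) ^ 2 ≤ M * (a - b) ^ 2 := by
    gcongr
    exact (le_abs_self _).trans hRa
  have h_cross : b * (2 * (a - b) * (Ra - Rb)) ≤ M * ((a - b) ^ 2 + (Ra - Rb) ^ 2) := by
    refine (le_abs_self _).trans ?_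
    rw [abs_mul]
    refine mul_le_mul hb ?_ (abs_nonneg _) hM
    rw [abs_le]
    constructor <;> nlinarith [sq_nonneg (a - b - (Ra - Rb)), sq_nonneg (a - b + (Ra - Rb))]
  linarith

lemma IsTest.integral_sub_mul_nonlinearity_sub_le (hf : IsTest f) (hg : IsTest g)
    (hm : IsEvenSymbol m) (hM : 0 ≤ M)
    (h_le : ∀ x, f x ≠ g x → |multiplier m f x| ≤ M ∧ |g x| ≤ M) :
    ∫ x, 2 * (f x - g x) * (f x * multiplier m f x - g x * multiplier m g x) ≤
      4 * M * ∫ x, (f x - g x) ^ 2 := by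
  have hd : IsTest fun x => f x - g x := hf.sub hg
  set Rd := multiplier m fun x => f x - g x
  have hRd (x : V) : Rd x = multiplier m f x - multiplier m g x := hf.multiplier_sub hg hm x
  have h_int_sq : Integrable fun x => (f x - g x) ^ 2 := (hd.memLp 2).integrable_sq
  have h_int_Rd_sq : Integrable fun x => Rd x ^ 2 := (hd.memLp_multiplier hm).integrable_sq
  have h_int : Integrable fun x =>
      2 * (f x - g x) * (f x * multiplier m f x - g x * multiplier m g x) :=
    ((hd.const_mul 2).mul_smooth ((hf.smooth.mul (hf.contDiff_multiplier hm)).sub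
      (hg.smooth.mul (hg.contDiff_multiplier hm)))).integrable
  have h_pointwise (x : V) : 2 * (f x - g x) * (f x * multiplier m f x - g x * multiplier m g x) ≤
      3 * M * (f x - g x) ^ 2 + M * Rd x ^ 2 := by
    by_cases hx : f x = g x
    · rw [hx, sub_self, mul_zero, zero_mul]
      positivity
    · rw [hRd]
      exact sub_mul_nonlinearity_sub_le (h_le x hx).1 (h_le x hx).2
  calc _ ≤ ∫ x, (3 * M * (f x - g x) ^ 2 + M * Rd x ^ 2) :=
        integral_mono h_int ((h_int_sq.const_mul _).add (h_int_Rd_sq.const_mul _)) h_pointwise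
    _ = (3 * M * ∫ x, (f x - g x) ^ 2) + M * ∫ x, Rd x ^ 2 := by
        rw [integral_add (h_int_sq.const_mul _) (h_int_Rd_sq.const_mul _), integral_const_mul,
          integral_const_mul]
    _ ≤ (3 * M * ∫ x, (f x - g x) ^ 2) + M * ∫ x, (f x - g x) ^ 2 := by
        exact add_le_add_right (mul_le_mul_of_nonneg_left (hd.integral_multiplier_sq_le hm) hM) _
    _ = _ := by ring

end EnergyEstimate

namespace IsSmoothSolution

variable {T : ℝ} {w₀ : Plane → ℝ} {v w : ℝ → Plane → ℝ}

lemma of_solvesAt (h0 : w 0 = w₀) (h : ∀ t ∈ Ico 0 T, SolvesAt rieszSqSymbol (Ico 0 T) w t) :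
    IsSmoothSolution T w₀ w where
  initial := h0
  smooth p hp := (h p.1 hp.1).smooth p.2
  equation := ⟨fun t => rieszSq (w t), fun p hp => (h p.1 hp.1).cont p.2,
    fun t ht => ⟨(h t ht).isTest.isRieszSq, (h t ht).deriv⟩⟩

lemma eq_zero (h : IsSmoothSolution T w₀ w) {t : ℝ} (ht : t ∈ Ico 0 T) {x : Plane}
    (hx : w₀ x = 0) : w t x = 0 := by
  obtain ⟨g, hg, h_eq⟩ := h.equation
  have hg_slice : ContinuousOn (fun s => g s x) (Ico 0 T) :=
    hg.comp (f := fun s => (s, x)) (by fun_prop) fun s hs => ⟨hs, mem_univ _⟩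
  rw [eq_mul_exp_integral hg_slice (fun s hs => (h_eq s hs).2 x) ht, h.initial, hx, zero_mul]

lemma isTest (h : IsSmoothSolution T w₀ w) (h0 : IsTest w₀) {t : ℝ} (ht : t ∈ Ico 0 T) :
    IsTest (w t) where
  smooth := contDiffOn_univ.1 (h.smooth.comp (f := fun x : Plane => (t, x)) (by fun_prop)
    fun _ _ => ⟨ht, mem_univ _⟩)
  compact := h0.compact.mono fun _ hx hux => hx (h.eq_zero ht hux)

lemma solvesAt (h : IsSmoothSolution T w₀ w) (h0 : IsTest w₀) {t : ℝ} (ht : t ∈ Ico 0 T) :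
    SolvesAt rieszSqSymbol (Ico 0 T) w t := by
  obtain ⟨g, hg, h_eq⟩ := h.equation
  have hg_eq : ∀ s ∈ Ico 0 T, g s = rieszSq (w s) := fun s hs =>
    (h_eq s hs).1.eq_rieszSq (h.isTest h0 hs) <| continuousOn_univ.1 <|
      hg.comp (f := fun x : Plane => (s, x)) (by fun_prop) fun _ _ => ⟨hs, mem_univ _⟩
  refine ⟨h.isTest h0 ht, fun x => h.smooth (t, x) ⟨ht, mem_univ _⟩, fun x => ?_, fun x => ?_⟩
  · exact (hg (t, x) ⟨ht, mem_univ _⟩).congr (fun p hp => by rw [hg_eq p.1 hp.1])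
      (by rw [hg_eq t ht])
  · simpa only [hg_eq t ht] using (h_eq t ht).2 x

lemma mono (h : IsSmoothSolution T w₀ w) (h0 : IsTest w₀) {T' : ℝ} (hT : T' ≤ T) :
    IsSmoothSolution T' w₀ w :=
  of_solvesAt h.initial fun _ ht => (h.solvesAt h0 ⟨ht.1, ht.2.trans_le hT⟩).congr
    (Filter.mem_of_superset self_mem_nhdsWithin fun _ hs => ⟨hs.1, hs.2.trans_le hT⟩)
    (Filter.Eventually.of_forall fun _ => rfl) rfl

lemma continuousOn_rieszSq (h : IsSmoothSolution T w₀ w) (h0 : IsTest w₀) :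
    ContinuousOn (fun p : ℝ × Plane => rieszSq (w p.1) p.2) (Ico 0 T ×ˢ univ) :=
  fun p hp => (h.solvesAt h0 hp.1).cont p.2

lemma hasDerivAt (h : IsSmoothSolution T w₀ w) (h0 : IsTest w₀) {t : ℝ} (ht : t ∈ Ioo 0 T)
    (x : Plane) : HasDerivAt (fun s => w s x) (w t x * rieszSq (w t) x) t :=
  ((h.solvesAt h0 (Ioo_subset_Ico_self ht)).deriv x).hasDerivAt (Ico_mem_nhds ht.1 ht.2)

lemma eq_mul_exp (h : IsSmoothSolution T w₀ w) (h0 : IsTest w₀) {t : ℝ} (ht : t ∈ Ico 0 T)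
    (x : Plane) : w t x = w₀ x * Real.exp (∫ s in (0 : ℝ)..t, rieszSq (w s) x) := by
  have h_slice : ContinuousOn (fun s => rieszSq (w s) x) (Ico 0 T) :=
    (h.continuousOn_rieszSq h0).comp (f := fun s => (s, x)) (by fun_prop)
      fun s hs => ⟨hs, mem_univ _⟩
  rw [← h.initial]
  exact eq_mul_exp_integral h_slice (fun s hs => (h.solvesAt h0 hs).deriv x) ht

lemma exists_bound (h : IsSmoothSolution T w₀ w) (h0 : IsTest w₀) {b : ℝ} (hb : b < T) :
    ∃ M, 0 ≤ M ∧ ∀ t ∈ Icc 0 b, ∀ x ∈ tsupport w₀, |w t x| ≤ M ∧ |rieszSq (w t) x| ≤ M := by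
  have hK : IsCompact (Icc 0 b ×ˢ tsupport w₀) := isCompact_Icc.prod h0.compact
  have h_sub : Icc 0 b ×ˢ tsupport w₀ ⊆ Ico 0 T ×ˢ univ :=
    prod_mono (fun s hs => ⟨hs.1, hs.2.trans_lt hb⟩) (subset_univ _)
  obtain ⟨C, hC⟩ := hK.exists_bound_of_continuousOn (h.smooth.continuousOn.mono h_sub)
  obtain ⟨D, hD⟩ := hK.exists_bound_of_continuousOn ((h.continuousOn_rieszSq h0).mono h_sub)
  refine ⟨max 0 (max C D), le_max_left _ _, fun _ ht _ hx => ⟨?_, ?_⟩⟩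
  · exact (hC (_, _) ⟨ht, hx⟩).trans ((le_max_left _ _).trans (le_max_right _ _))
  · exact (hD (_, _) ⟨ht, hx⟩).trans ((le_max_right _ _).trans (le_max_right _ _))

lemma hasDerivAt_integral_sub_sq (hv : IsSmoothSolution T w₀ v) (hw : IsSmoothSolution T w₀ w)
    (h0 : IsTest w₀) {t : ℝ} (ht : t ∈ Ioo 0 T) :
    HasDerivAt (fun s => ∫ x, (v s x - w s x) ^ 2)
      (∫ x, 2 * (v t x - w t x) * (v t x * rieszSq (v t) x - w t x * rieszSq (w t) x)) t := by
  have hv_cont := hv.smooth.continuousOn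
  have hw_cont := hw.smooth.continuousOn
  refine hasDerivAt_integral_of_compact_support h0.compact isOpen_Ioo
    (F := fun s x => (v s x - w s x) ^ 2)
    (F' := fun s x => 2 * (v s x - w s x) * (v s x * rieszSq (v s) x - w s x * rieszSq (w s) x))
    (fun s hs => ?_) ?_ (fun s hs x => ?_) (fun s hs x hx => ?_) ht
  · have hs' := Ioo_subset_Ico_self hs
    exact ((hv.isTest h0 hs').continuous.sub (hw.isTest h0 hs').continuous).pow 2
  · exact ((continuousOn_const.mul (hv_cont.sub hw_cont)).mul
      ((hv_cont.mul (hv.continuousOn_rieszSq h0)).sub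
        (hw_cont.mul (hw.continuousOn_rieszSq h0)))).mono
      (prod_mono Ioo_subset_Ico_self subset_rfl)
  · refine (((hv.hasDerivAt h0 hs x).sub (hw.hasDerivAt h0 hs x)).pow 2).congr_deriv ?_
    simp
  · have hx0 := image_eq_zero_of_notMem_tsupport hx
    have hs' := Ioo_subset_Ico_self hs
    simp [hv.eq_zero hs' hx0, hw.eq_zero hs' hx0]

lemma continuousOn_integral_sub_sq (hv : IsSmoothSolution T w₀ v) (hw : IsSmoothSolution T w₀ w)
    (h0 : IsTest w₀) : ContinuousOn (fun s => ∫ x, (v s x - w s x) ^ 2) (Ico 0 T) := by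
  refine continuousOn_integral_of_compact_support (k := tsupport w₀) h0.compact
    ((hv.smooth.continuousOn.sub hw.smooth.continuousOn).pow 2) fun s x hs hx => ?_
  have hx0 := image_eq_zero_of_notMem_tsupport hx
  simp [hv.eq_zero hs hx0, hw.eq_zero hs hx0]

lemma integral_sub_sq_nonpos (hv : IsSmoothSolution T w₀ v) (hw : IsSmoothSolution T w₀ w)
    (h0 : IsTest w₀) {b : ℝ} (hb : b ∈ Ico 0 T) : ∫ x, (v b x - w b x) ^ 2 ≤ 0 := by
  obtain ⟨M, hM0, hM⟩ := hv.exists_bound h0 hb.2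
  obtain ⟨N, -, hN⟩ := hw.exists_bound h0 hb.2
  have h_sub : Icc 0 b ⊆ Ico 0 T := fun s hs => ⟨hs.1, hs.2.trans_lt hb.2⟩
  refine nonpos_of_hasDerivAt_le_mul (E := fun s => ∫ x, (v s x - w s x) ^ 2) (C := 4 * max M N)
    hb.1 ((hv.continuousOn_integral_sub_sq hw h0).mono h_sub)
    (fun s hs => hv.hasDerivAt_integral_sub_sq hw h0 ⟨hs.1, hs.2.trans hb.2⟩) (fun s hs => ?_)
    (by simp [hv.initial, hw.initial])
  have hs' := Ioo_subset_Icc_self hs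
  refine (hv.isTest h0 (h_sub hs')).integral_sub_mul_nonlinearity_sub_le
    (hw.isTest h0 (h_sub hs')) isEvenSymbol_rieszSqSymbol (hM0.trans (le_max_left M N))
    fun x hx => ?_
  have hx_supp : x ∈ tsupport w₀ := by
    contrapose! hx
    have hx0 := image_eq_zero_of_notMem_tsupport hx
    rw [hv.eq_zero (h_sub hs') hx0, hw.eq_zero (h_sub hs') hx0]
  exact ⟨(hM s hs' x hx_supp).2.trans (le_max_left _ _),
    (hN s hs' x hx_supp).1.trans (le_max_right _ _)⟩

theorem unique (hv : IsSmoothSolution T w₀ v) (hw : IsSmoothSolution T w₀ w) (h0 : IsTest w₀)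
    {b : ℝ} (hb : b ∈ Ico 0 T) : v b = w b := by
  have hd := (hv.isTest h0 hb).sub (hw.isTest h0 hb)
  have h_ae := (integral_eq_zero_iff_of_nonneg (fun x => sq_nonneg (v b x - w b x))
    (hd.memLp 2).integrable_sq).1
      (le_antisymm (hv.integral_sub_sq_nonpos hw h0 hb) (integral_nonneg fun x => sq_nonneg _))
  have h_eq := (Continuous.ae_eq_iff_eq volume (hd.continuous.pow 2) continuous_zero).1 h_ae
  ext x
  exact sub_eq_zero.1 (eq_zero_of_pow_eq_zero (congrFun h_eq x))

end IsSmoothSolution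

/-! ### Continuation and the maximal solution -/

section FourierDecay

variable {V : Type*} [NormedAddCommGroup V] [InnerProductSpace ℝ V] [FiniteDimensional ℝ V]
  [MeasurableSpace V] [BorelSpace V] {K : Set V} {M : ℝ} {f : V → ℝ}

namespace IsTest

lemma integral_norm_iteratedFDeriv_le (hf : IsTest f) (hK : IsCompact K)
    (h_supp : ∀ x ∉ K, f x = 0) {k : ℕ} (hM : ∀ x ∈ K, ‖iteratedFDeriv ℝ k f x‖ ≤ M) :
    ∫ x, ‖iteratedFDeriv ℝ k f x‖ ≤ M * volume.real K := by
  have h_tsupport : tsupport f ⊆ K :=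
    closure_minimal (fun x hx => by_contra fun hxK => hx (h_supp x hxK)) hK.isClosed
  have h_zero : ∀ x ∉ K, ‖iteratedFDeriv ℝ k f x‖ = 0 := fun x hx => norm_eq_zero.2 <|
    Function.notMem_support.1 fun h => hx (h_tsupport (support_iteratedFDeriv_subset k h))
  have h_cont : Continuous fun x => ‖iteratedFDeriv ℝ k f x‖ :=
    (hf.smooth.continuous_iteratedFDeriv (mod_cast le_top)).norm
  calc ∫ x, ‖iteratedFDeriv ℝ k f x‖ = ∫ x in K, ‖iteratedFDeriv ℝ k f x‖ :=
        (setIntegral_eq_integral_of_forall_compl_eq_zero h_zero).symm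
    _ ≤ ∫ _ in K, M := setIntegral_mono_on (h_cont.continuousOn.integrableOn_compact hK)
        (integrableOn_const hK.measure_lt_top.ne) hK.measurableSet hM
    _ = M * volume.real K := by rw [setIntegral_const, smul_eq_mul, mul_comm]

lemma pow_norm_mul_realFourier_le (hf : IsTest f) (hK : IsCompact K)
    (h_supp : ∀ x ∉ K, f x = 0) {n : ℕ}
    (hM : ∀ k ≤ n, ∀ x ∈ K, ‖iteratedFDeriv ℝ k f x‖ ≤ M) (ξ : V) :
    ‖ξ‖ ^ n * ‖realFourier f ξ‖ ≤ 2 ^ n * ((n + 1) * (M * volume.real K)) := by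
  have h_norm (k : ℕ) (x : V) :
      ‖iteratedFDeriv ℝ k (fun x => (f x : ℂ)) x‖ = ‖iteratedFDeriv ℝ k f x‖ :=
    LinearIsometry.norm_iteratedFDeriv_comp_left (n := ∞) Complex.ofRealLI
      hf.smooth.contDiffAt (mod_cast le_top)
  have h_fourier := Real.pow_mul_norm_iteratedFDeriv_fourier_le (f := fun x => (f x : ℂ))
    (K := 0) (N := ⊤) (hf.toSchwartzMap.smooth ⊤)
    (fun k n _ _ => hf.toSchwartzMap.integrable_pow_mul_iteratedFDeriv volume k n) (k := 0)
    (n := n) le_rfl le_top ξ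
  have h_sum : ∑ k ∈ Finset.range (n + 1), ∫ x, ‖iteratedFDeriv ℝ k f x‖ ≤
      (n + 1) * (M * volume.real K) := by
    refine (Finset.sum_le_card_nsmul _ _ _ fun k hk => hf.integral_norm_iteratedFDeriv_le hK h_supp
      (hM k (Finset.mem_range_succ_iff.1 hk))).trans_eq ?_
    rw [Finset.card_range, nsmul_eq_mul, Nat.cast_add_one]
  refine le_trans ?_ (mul_le_mul_of_nonneg_left h_sum (by positivity))
  simpa [realFourier, Finset.sum_product, h_norm] using h_fourier

end IsTest

lemma exists_wienerNorm_le (hK : IsCompact K) (M : ℕ → ℝ) :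
    ∃ C, ∀ f, IsTest f → (∀ x ∉ K, f x = 0) →
      (∀ k, ∀ x ∈ K, ‖iteratedFDeriv ℝ k f x‖ ≤ M k) → wienerNorm f ≤ C := by
  set n := (volume : Measure V).integrablePower
  set N := ∑ k ∈ Finset.range (n + 1), |M k|
  set A := N * volume.real K
  refine ⟨2 ^ n * (∫ ξ : V, (1 + ‖ξ‖) ^ (-(n : ℝ))) * (A + 2 ^ n * ((n + 1) * A)),
    fun f hf h_supp hM => ?_⟩
  have hN : ∀ k ≤ n, ∀ x ∈ K, ‖iteratedFDeriv ℝ k f x‖ ≤ N := fun k hk x hx =>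
    ((hM k x hx).trans (le_abs_self _)).trans <| Finset.single_le_sum (f := fun k => |M k|)
      (fun _ _ => abs_nonneg _) (Finset.mem_range_succ_iff.2 hk)
  have h_zero (ξ : V) := hf.pow_norm_mul_realFourier_le hK h_supp (n := 0)
    (fun k hk => hN k (hk.trans n.zero_le)) ξ
  simp only [pow_zero, one_mul, CharP.cast_eq_zero, zero_add] at h_zero
  have h_top (ξ : V) : ‖ξ‖ ^ (0 + n) * ‖realFourier f ξ‖ ≤ 2 ^ n * ((n + 1) * A) := by
    rw [zero_add]
    exact hf.pow_norm_mul_realFourier_le hK h_supp hN ξ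
  have h_integral := integral_pow_mul_le_of_le_of_pow_mul_le h_zero h_top
  simp only [pow_zero, one_mul] at h_integral
  exact h_integral

end FourierDecay

lemma contDiffOn_iteratedFDeriv_slice {V F : Type*} [NormedAddCommGroup V] [NormedSpace ℝ V]
    [NormedAddCommGroup F] [NormedSpace ℝ F] {S : Set ℝ} {W : ℝ × V → F}
    (hW : ContDiffOn ℝ ∞ W (S ×ˢ univ)) (k : ℕ) :
    ContDiffOn ℝ ∞ (fun p : ℝ × V => iteratedFDeriv ℝ k (fun y => W (p.1, y)) p.2)
      (S ×ˢ univ) := by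
  induction k with
  | zero =>
    simp only [iteratedFDeriv_zero_eq_comp]
    exact (LinearIsometryEquiv.contDiff _).comp_contDiffOn hW
  | succ k ih =>
    simp only [iteratedFDeriv_succ_eq_comp_left, Function.comp_def]
    have h_curry : ContDiff ℝ ∞ (continuousMultilinearCurryLeftEquiv ℝ
        (fun _ : Fin (k + 1) => V) F).symm :=
      LinearIsometryEquiv.contDiff (𝕜 := ℝ) (E := V →L[ℝ] (V [×k]→L[ℝ] F))
        (F := V [×(k + 1)]→L[ℝ] F) _
    refine h_curry.comp_contDiffOn fun p hp => ?_
    have h_fderiv := ContDiffWithinAt.fderivWithin (𝕜 := ℝ) (s := S ×ˢ (univ : Set V)) (x₀ := p)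
      (f := fun (q : ℝ × V) y => iteratedFDeriv ℝ k (fun y => W (q.1, y)) y) (g := Prod.snd)
      (t := univ) (m := ∞) (n := ∞) ?_ contDiffWithinAt_snd uniqueDiffOn_univ (by simp) hp
      (fun _ _ => mem_univ _)
    · simpa only [fderivWithin_univ] using h_fderiv
    · exact (ih (p.1, p.2) ⟨hp.1, mem_univ _⟩).comp (p, p.2)
        (f := fun q : (ℝ × V) × V => (q.1.1, q.2)) (by fun_prop)
        fun q hq => ⟨hq.1.1, mem_univ _⟩

namespace IsSmoothSolution

variable {T : ℝ} {w₀ : Plane → ℝ} {v w : ℝ → Plane → ℝ}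

lemma taylorSolution {u : Plane → ℝ} {ρ : ℝ} (hu : IsTest u) (hρ : ρ * wienerNorm u ≤ 1) :
    IsSmoothSolution ρ u (taylorSolution rieszSqSymbol u) :=
  of_solvesAt (taylorSolution_zero rieszSqSymbol u) fun t ht => by
    have ht_abs : |t| < ρ := (abs_of_nonneg ht.1).trans_lt ht.2
    exact (solvesAt_taylorSolution isEvenSymbol_rieszSqSymbol hu hρ ht_abs).congr
      (mem_nhdsWithin_of_mem_nhds (Ioo_mem_nhds (abs_lt.1 ht_abs).1 ht.2))
      (Filter.Eventually.of_forall fun _ => rfl) rfl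

lemma shift (h : IsSmoothSolution T w₀ w) (h0 : IsTest w₀) {c : ℝ} (hc : 0 ≤ c) :
    IsSmoothSolution (T - c) (w c) fun s => w (s + c) := by
  refine of_solvesAt (by simp only [zero_add]) fun t ht => ?_
  have h_solves : SolvesAt rieszSqSymbol (Ico 0 T) w (t - -c) := by
    rw [sub_neg_eq_add]
    exact h.solvesAt h0 ⟨add_nonneg ht.1 hc, by linarith [ht.2]⟩
  simpa only [sub_neg_eq_add] using h_solves.comp_sub (S' := Ico 0 (T - c)) fun s hs =>
    ⟨by linarith [hs.1], by linarith [hs.2]⟩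

lemma piecewise (h : IsSmoothSolution T w₀ w) (h0 : IsTest w₀) {t₀ T' : ℝ} (ht₀ : t₀ ∈ Ico 0 T)
    (h_eq : ∀ t ∈ Ico t₀ T, w t = v t)
    (hv : ∀ t ∈ Ico t₀ T', SolvesAt rieszSqSymbol (Ico t₀ T') v t) :
    IsSmoothSolution T' w₀ (fun t => if t < T then w t else v t) := by
  set z : ℝ → Plane → ℝ := fun t => if t < T then w t else v t
  have hz_lt : ∀ t < T, z t = w t := fun t ht => if_pos ht
  have hz_ge : ∀ t, t₀ ≤ t → z t = v t := fun t ht => by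
    by_cases htT : t < T
    · rw [hz_lt t htT, h_eq t ⟨ht, htT⟩]
    · exact if_neg htT
  refine of_solvesAt ((hz_lt 0 (ht₀.1.trans_lt ht₀.2)).trans h.initial) fun t ht => ?_
  rcases lt_or_ge t T with htT | htT
  · refine (h.solvesAt h0 ⟨ht.1, htT⟩).congr ?_
      (mem_nhdsWithin_of_mem_nhds (Filter.mem_of_superset (Iio_mem_nhds htT) hz_lt)) (hz_lt t htT)
    filter_upwards [self_mem_nhdsWithin,
      mem_nhdsWithin_of_mem_nhds (Iio_mem_nhds htT)] with s hs hsT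
    exact ⟨hs.1, hsT⟩
  · have ht₀t : t₀ < t := ht₀.2.trans_le htT
    have h_after : ∀ᶠ s in nhdsWithin t (Ico 0 T'), t₀ < s :=
      mem_nhdsWithin_of_mem_nhds (Ioi_mem_nhds ht₀t)
    refine (hv t ⟨ht₀t.le, ht.2⟩).congr ?_ (h_after.mono fun s hs => hz_ge s hs.le)
      (hz_ge t ht₀t.le)
    filter_upwards [self_mem_nhdsWithin, h_after] with s hs hst
    exact ⟨hst.le, hs.2⟩

lemma eq_taylorSolution (h : IsSmoothSolution T w₀ w) (h0 : IsTest w₀) {t₀ ρ : ℝ}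
    (ht₀ : t₀ ∈ Ico 0 T) (hρ : ρ * wienerNorm (w t₀) ≤ 1) (hT : T ≤ t₀ + ρ) :
    ∀ t ∈ Ico t₀ T, w t = _root_.taylorSolution rieszSqSymbol (w t₀) (t - t₀) := fun t ht => by
  have hu : IsTest (w t₀) := h.isTest h0 ht₀
  have h_local := (taylorSolution hu hρ).mono hu (T' := T - t₀) (by linarith)
  simpa using (h.shift h0 ht₀.1).unique h_local hu (b := t - t₀)
    ⟨by linarith [ht.1], by linarith [ht.2]⟩

lemma exists_extension (h : IsSmoothSolution T w₀ w) (h0 : IsTest w₀) {t₀ ρ : ℝ}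
    (ht₀ : t₀ ∈ Ico 0 T) (hρ : ρ * wienerNorm (w t₀) ≤ 1) :
    ∃ v, IsSmoothSolution (t₀ + ρ) w₀ v := by
  rcases le_or_gt (t₀ + ρ) T with h_le | h_lt
  · exact ⟨w, h.mono h0 h_le⟩
  refine ⟨_, h.piecewise h0 ht₀ (h.eq_taylorSolution h0 ht₀ hρ h_lt.le) fun t ht => ?_⟩
  refine ((taylorSolution (h.isTest h0 ht₀) hρ).solvesAt (h.isTest h0 ht₀) (t := t - t₀)
    ⟨?_, ?_⟩).comp_sub fun s hs => ⟨?_, ?_⟩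
  · linarith [ht.1]
  · linarith [ht.2]
  · linarith [hs.1]
  · linarith [hs.2]

lemma exists_gt_of_wienerNorm_le (h : IsSmoothSolution T w₀ w) (h0 : IsTest w₀) (hT : 0 < T)
    {C : ℝ} (hC : ∀ t ∈ Ico 0 T, wienerNorm (w t) ≤ C) :
    ∃ T' > T, ∃ v, IsSmoothSolution T' w₀ v := by
  set D := max C 1
  have hD : 0 < D := zero_lt_one.trans_le (le_max_right C 1)
  obtain ⟨t₀, ht₀, ht₀T⟩ := exists_between (max_lt hT (sub_lt_self T (inv_pos.2 hD)))
  have ht₀_mem : t₀ ∈ Ico 0 T := ⟨(le_max_left _ _).trans ht₀.le, ht₀T⟩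
  have hρ : D⁻¹ * wienerNorm (w t₀) ≤ 1 := by
    rw [inv_mul_le_iff₀ hD, mul_one]
    exact (hC t₀ ht₀_mem).trans (le_max_left C 1)
  exact ⟨t₀ + D⁻¹, by linarith [(le_max_right _ _).trans_lt ht₀], h.exists_extension h0 ht₀_mem hρ⟩

lemma exists_wienerNorm_le_of_contDiffOn_Icc (h : IsSmoothSolution T w₀ w) (h0 : IsTest w₀)
    {W : ℝ × Plane → ℝ} (hW : ContDiffOn ℝ ∞ W (Icc 0 T ×ˢ univ))
    (hWw : ∀ t ∈ Ico 0 T, ∀ x, W (t, x) = w t x) :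
    ∃ C, ∀ t ∈ Ico 0 T, wienerNorm (w t) ≤ C := by
  have h_bound (k : ℕ) : ∃ M, ∀ p ∈ Icc 0 T ×ˢ tsupport w₀,
      ‖iteratedFDeriv ℝ k (fun y => W (p.1, y)) p.2‖ ≤ M :=
    (isCompact_Icc.prod h0.compact).exists_bound_of_continuousOn
      ((contDiffOn_iteratedFDeriv_slice hW k).continuousOn.mono
        (prod_mono subset_rfl (subset_univ _)))
  choose M hM using h_bound
  obtain ⟨C, hC⟩ := exists_wienerNorm_le h0.compact M
  refine ⟨C, fun t ht => hC _ (h.isTest h0 ht)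
    (fun x hx => h.eq_zero ht (image_eq_zero_of_notMem_tsupport hx)) fun k x hx => ?_⟩
  have hw_eq : w t = fun y => W (t, y) := funext fun y => (hWw t ht y).symm
  rw [hw_eq]
  exact hM k (t, x) ⟨Ico_subset_Icc_self ht, hx⟩

end IsSmoothSolution

/-- The set of times up to which the Cauchy problem with initial datum `w₀` has a smooth
solution. -/
def lifespans (w₀ : Plane → ℝ) : Set ℝ := {T | ∃ v, IsSmoothSolution T w₀ v}

lemma exists_pos_mem_lifespans {w₀ : Plane → ℝ} (h0 : IsTest w₀) : ∃ T ∈ lifespans w₀, 0 < T := by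
  have h_pos : 0 < 1 + wienerNorm w₀ := add_pos_of_pos_of_nonneg one_pos (wienerNorm_nonneg w₀)
  refine ⟨(1 + wienerNorm w₀)⁻¹, ⟨_, IsSmoothSolution.taylorSolution h0 ?_⟩, inv_pos.2 h_pos⟩
  rw [inv_mul_le_iff₀ h_pos]
  linarith

lemma exists_solution_sSup_lifespans {w₀ : Plane → ℝ} (h0 : IsTest w₀)
    (h_bdd : BddAbove (lifespans w₀)) :
    ∃ w, IsSmoothSolution (sSup (lifespans w₀)) w₀ w ∧
      ∀ T v, IsSmoothSolution T w₀ v → ∀ t ∈ Ico 0 T, v t = w t := by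
  set T := sSup (lifespans w₀)
  obtain ⟨T₀, hT₀, hT₀_pos⟩ := exists_pos_mem_lifespans h0
  have h_exists : ∀ t < T, ∃ τ v, t < τ ∧ IsSmoothSolution τ w₀ v := fun t ht => by
    obtain ⟨τ, ⟨v, hv⟩, htτ⟩ := exists_lt_of_lt_csSup ⟨T₀, hT₀⟩ ht
    exact ⟨τ, v, htτ, hv⟩
  choose! τ V hτ hV using h_exists
  have h_agree : ∀ T' v, IsSmoothSolution T' w₀ v → ∀ t ∈ Ico 0 T', v t = V t t := by
    intro T' v hv t ht
    have htT : t < T := ht.2.trans_le (le_csSup h_bdd ⟨v, hv⟩)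
    exact (hv.mono h0 (min_le_left T' (τ t))).unique ((hV t htT).mono h0 (min_le_right _ _)) h0
      ⟨ht.1, lt_min ht.2 (hτ t htT)⟩
  refine ⟨fun t => V t t, ?_, h_agree⟩
  refine IsSmoothSolution.of_solvesAt (hV 0 (hT₀_pos.trans_le (le_csSup h_bdd hT₀))).initial
    fun t ht => ?_
  have h_mem : Ico 0 (τ t) ∈ nhdsWithin t (Ico 0 T) := by
    filter_upwards [self_mem_nhdsWithin,
      mem_nhdsWithin_of_mem_nhds (Iio_mem_nhds (hτ t ht.2))] with s hs hsτ
    exact ⟨hs.1, hsτ⟩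
  refine ((hV t ht.2).solvesAt h0 ⟨ht.1, hτ t ht.2⟩).congr h_mem ?_ rfl
  filter_upwards [h_mem] with s hs
  exact (h_agree _ _ (hV t ht.2) s hs).symm

theorem exists_maximal_solution {w₀ : Plane → ℝ} (h0 : IsTest w₀)
    (h_bdd : BddAbove (lifespans w₀)) :
    ∃ (T : ℝ) (w : ℝ → Plane → ℝ), 0 < T ∧ IsSmoothSolution T w₀ w ∧
      (∀ (T' : ℝ) (v : ℝ → Plane → ℝ), IsSmoothSolution T' w₀ v →
        T' ≤ T ∧ ∀ t ∈ Ico 0 T', v t = w t) ∧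
      ¬ ∃ W : ℝ × Plane → ℝ, ContDiffOn ℝ ∞ W (Icc 0 T ×ˢ univ) ∧
        ∀ t ∈ Ico 0 T, ∀ x, W (t, x) = w t x := by
  obtain ⟨T₀, hT₀, hT₀_pos⟩ := exists_pos_mem_lifespans h0
  have hT_pos : 0 < sSup (lifespans w₀) := hT₀_pos.trans_le (le_csSup h_bdd hT₀)
  obtain ⟨w, hw, h_agree⟩ := exists_solution_sSup_lifespans h0 h_bdd
  refine ⟨_, w, hT_pos, hw, fun T' v hv => ⟨le_csSup h_bdd ⟨v, hv⟩, h_agree T' v hv⟩, ?_⟩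
  rintro ⟨W, hW, hWw⟩
  obtain ⟨C, hC⟩ := hw.exists_wienerNorm_le_of_contDiffOn_Icc h0 hW hWw
  obtain ⟨T', h_gt, h_mem⟩ := hw.exists_gt_of_wienerNorm_le h0 hT_pos hC
  exact (le_csSup h_bdd h_mem).not_gt h_gt

/-! ### Radial weights and their duality with `R₁²` -/

/-- The derivative of `f` in the direction `v`, as a function of the point. -/
def dirDeriv {V : Type*} [NormedAddCommGroup V] [NormedSpace ℝ V] (v : V) (f : V → ℝ) (x : V) : ℝ :=
  fderiv ℝ f x v

lemma IsTest.dirDeriv {V : Type*} [NormedAddCommGroup V] [NormedSpace ℝ V] {f : V → ℝ}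
    (hf : IsTest f) (v : V) : IsTest (dirDeriv v f) where
  smooth := (hf.smooth.fderiv_right (m := ∞) (by simp)).clm_apply contDiff_const
  compact := (hf.compact.fderiv (𝕜 := ℝ)).comp_left (g := fun L : V →L[ℝ] ℝ => L v) rfl

section RadialDerivatives

variable {V : Type*} [NormedAddCommGroup V] [InnerProductSpace ℝ V] {L h : ℝ → ℝ}

lemma hasFDerivAt_norm_sub_sq (x p : V) :
    HasFDerivAt (fun x : V => ‖x - p‖ ^ 2) (2 • (innerSL ℝ (x - p))) x := by
  simpa using ((hasFDerivAt_id x).sub_const p).norm_sq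

lemma dirDeriv_comp_norm_sub_sq {l : ℝ} (v p x : V) (hL : HasDerivAt L l (‖x - p‖ ^ 2)) :
    dirDeriv v (fun x => L (‖x - p‖ ^ 2)) x = 2 * inner ℝ (x - p) v * l := by
  have h_fderiv : HasFDerivAt (fun x => L (‖x - p‖ ^ 2)) _ x :=
    hL.comp_hasFDerivAt x (hasFDerivAt_norm_sub_sq x p)
  rw [dirDeriv, h_fderiv.fderiv]
  simp only [smul_apply, innerSL_apply_apply, nsmul_eq_mul, Nat.cast_ofNat, smul_eq_mul]
  ring

lemma dirDeriv_inner_mul_comp_norm_sub_sq {h' : ℝ} (v p x : V)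
    (hh : HasDerivAt h h' (‖x - p‖ ^ 2)) :
    dirDeriv v (fun x => 2 * inner ℝ (x - p) v * h (‖x - p‖ ^ 2)) x =
      2 * ‖v‖ ^ 2 * h (‖x - p‖ ^ 2) + 4 * inner ℝ (x - p) v ^ 2 * h' := by
  have h_radial := hh.comp_hasFDerivAt x (hasFDerivAt_norm_sub_sq x p)
  have h_inner : HasFDerivAt (fun x : V => 2 * inner ℝ (x - p) v) ((2 : ℝ) • innerSL ℝ v) x := by
    simp_rw [real_inner_comm v]
    exact (((innerSL ℝ v).hasFDerivAt (x := x - p)).comp x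
      ((hasFDerivAt_id x).sub_const p)).const_mul 2
  have h_fderiv : HasFDerivAt (fun x : V => 2 * inner ℝ (x - p) v * h (‖x - p‖ ^ 2)) _ x :=
    h_inner.mul h_radial
  rw [dirDeriv, h_fderiv.fderiv]
  simp only [add_apply, smul_apply, innerSL_apply_apply, nsmul_eq_mul,
    Nat.cast_ofNat, smul_eq_mul, real_inner_self_eq_norm_sq]
  ring

lemma dirDeriv_dirDeriv_comp_norm_sub_sq (hL : ∀ s, HasDerivAt L (h s) s) (hh : Differentiable ℝ h)
    (v p x : V) :
    dirDeriv v (dirDeriv v fun x => L (‖x - p‖ ^ 2)) x =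
      2 * ‖v‖ ^ 2 * h (‖x - p‖ ^ 2) + 4 * inner ℝ (x - p) v ^ 2 * deriv h (‖x - p‖ ^ 2) := by
  have h_first : (dirDeriv v fun x => L (‖x - p‖ ^ 2)) =
      fun x => 2 * inner ℝ (x - p) v * h (‖x - p‖ ^ 2) :=
    funext fun x => dirDeriv_comp_norm_sub_sq v p x (hL _)
  rw [h_first, dirDeriv_inner_mul_comp_norm_sub_sq v p x (hh _).hasDerivAt]

lemma hasCompactSupport_comp_norm_sub_sq [FiniteDimensional ℝ V] {b : ℝ} (hL : ∀ s > b, L s = 0)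
    (p : V) : HasCompactSupport fun x => L (‖x - p‖ ^ 2) := by
  refine HasCompactSupport.intro (isCompact_closedBall p (Real.sqrt |b|)) fun x hx => hL _ ?_
  rw [Metric.mem_closedBall, dist_eq_norm, not_le] at hx
  calc b ≤ |b| := le_abs_self b
    _ < ‖x - p‖ ^ 2 := (Real.sqrt_lt' ((Real.sqrt_nonneg _).trans_lt hx)).1 hx

end RadialDerivatives

open LineDeriv in
lemma IsTest.realFourier_dirDeriv {V : Type*} [NormedAddCommGroup V] [InnerProductSpace ℝ V]
    [FiniteDimensional ℝ V] [MeasurableSpace V] [BorelSpace V] {f : V → ℝ} (hf : IsTest f)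
    (v ξ : V) :
    realFourier (_root_.dirDeriv v f) ξ =
      2 * Real.pi * Complex.I * (inner ℝ ξ v : ℝ) * realFourier f ξ := by
  have h_toSchwartz : (hf.dirDeriv v).toSchwartzMap = ∂_{v} hf.toSchwartzMap := by
    ext x
    have h_fderiv : HasFDerivAt (hf.toSchwartzMap : V → ℂ)
        (Complex.ofRealCLM.comp (fderiv ℝ f x)) x :=
      Complex.ofRealCLM.hasFDerivAt.comp x
        ((hf.smooth.differentiable (by simp)) x).hasFDerivAt
    rw [SchwartzMap.lineDerivOp_apply_eq_fderiv, h_fderiv.fderiv]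
    rfl
  have h_growth : (fun x : V => inner ℝ x v).HasTemperateGrowth := by fun_prop
  rw [(hf.dirDeriv v).realFourier_eq, hf.realFourier_eq, h_toSchwartz,
    SchwartzMap.fourier_lineDerivOp_eq, smul_apply,
    SchwartzMap.smulLeftCLM_apply_apply h_growth, Complex.real_smul, smul_eq_mul]
  ring

/-- The partial derivative in the direction of the `i`-th coordinate. -/
abbrev partialDeriv (i : Fin 2) : (Plane → ℝ) → Plane → ℝ := dirDeriv (EuclideanSpace.single i 1)

lemma norm_sq_eq_add_sq (x : Plane) : ‖x‖ ^ 2 = x 0 ^ 2 + x 1 ^ 2 := by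
  rw [EuclideanSpace.real_norm_sq_eq, Fin.sum_univ_two]

lemma rieszSqSymbol_mul_norm_sq (ξ : Plane) : rieszSqSymbol ξ * ‖ξ‖ ^ 2 = -(ξ 0) ^ 2 := by
  rcases eq_or_ne ξ 0 with rfl | hξ
  · simp
  · rw [rieszSqSymbol, div_mul_cancel₀]
    positivity

lemma IsTest.rieszSq_laplacian {f : Plane → ℝ} (hf : IsTest f) (x : Plane) :
    rieszSq (fun x => partialDeriv 0 (partialDeriv 0 f) x + partialDeriv 1 (partialDeriv 1 f) x) x =
      -partialDeriv 0 (partialDeriv 0 f) x := by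
  have h_fst := (hf.dirDeriv (EuclideanSpace.single 0 1)).dirDeriv (EuclideanSpace.single 0 1)
  have h_snd := (hf.dirDeriv (EuclideanSpace.single 1 1)).dirDeriv (EuclideanSpace.single 1 1)
  have h_fourier (i : Fin 2) (ξ : Plane) : realFourier (partialDeriv i (partialDeriv i f)) ξ =
      (2 * Real.pi * Complex.I * (ξ i : ℝ)) ^ 2 * realFourier f ξ := by
    rw [(hf.dirDeriv _).realFourier_dirDeriv, hf.realFourier_dirDeriv,
      EuclideanSpace.inner_single_right, one_mul]
    simp only [conj_trivial]
    ring
  apply Complex.ofReal_injective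
  rw [isEvenSymbol_rieszSqSymbol.ofReal_multiplier, neg_eq_neg_one_mul,
    ← (h_fst.const_mul (-1)).fourierInv_realFourier]
  refine congrArg (fun F : Plane → ℂ => 𝓕⁻ F x) (funext fun ξ => ?_)
  rw [realFourier_add h_fst.integrable h_snd.integrable, realFourier_const_mul, h_fourier,
    h_fourier]
  have h_symbol : (rieszSqSymbol ξ : ℂ) * ((ξ 0 : ℝ) ^ 2 + (ξ 1 : ℝ) ^ 2) = -(ξ 0 : ℝ) ^ 2 := by
    exact_mod_cast (norm_sq_eq_add_sq ξ) ▸ rieszSqSymbol_mul_norm_sq ξ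
  push_cast
  linear_combination (2 * Real.pi * Complex.I) ^ 2 * realFourier f ξ * h_symbol

/-- The Laplacian of `x ↦ L (‖x - p‖²)` on the plane, where `L' = h`. -/
def radialLaplacian (h : ℝ → ℝ) (p x : Plane) : ℝ :=
  4 * (h (‖x - p‖ ^ 2) + ‖x - p‖ ^ 2 * deriv h (‖x - p‖ ^ 2))

/-- The second derivative of `x ↦ L (‖x - p‖²)` in the direction of the first coordinate of the
plane, where `L' = h`. -/
def radialSecondDeriv (h : ℝ → ℝ) (p x : Plane) : ℝ :=
  2 * h (‖x - p‖ ^ 2) + 4 * (x 0 - p 0) ^ 2 * deriv h (‖x - p‖ ^ 2)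

section RadialDuality

variable {h : ℝ → ℝ} {w : Plane → ℝ}

lemma integral_radialLaplacian_mul_rieszSq_of_eq_zero (hh : ContDiff ℝ ∞ h) {c : ℝ}
    (hc : ∀ s ≥ c, h s = 0) (p : Plane) (hw : IsTest w) :
    ∫ x, radialLaplacian h p x * rieszSq w x = -∫ x, radialSecondDeriv h p x * w x := by
  set L : ℝ → ℝ := fun s => ∫ u in c..s, h u
  have hL (s : ℝ) : HasDerivAt L (h s) s := (hh.continuous.integral_hasStrictDerivAt c s).hasDerivAt
  have hL_smooth : ContDiff ℝ ∞ L := by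
    rw [contDiff_infty_iff_deriv, funext fun s => (hL s).deriv]
    exact ⟨fun s => (hL s).differentiableAt, hh⟩
  have hL_zero : ∀ s > c, L s = 0 := fun s hs => intervalIntegral.integral_zero_ae <|
    ae_of_all _ fun u hu => hc u (by rw [uIoc_of_le hs.le] at hu; exact hu.1.le)
  have hf : IsTest fun x : Plane => L (‖x - p‖ ^ 2) :=
    ⟨hL_smooth.comp ((contDiff_id.sub contDiff_const).norm_sq ℝ),
      hasCompactSupport_comp_norm_sub_sq hL_zero p⟩
  have h_second (i : Fin 2) (x : Plane) :
      partialDeriv i (partialDeriv i fun x => L (‖x - p‖ ^ 2)) x =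
        2 * h (‖x - p‖ ^ 2) + 4 * (x i - p i) ^ 2 * deriv h (‖x - p‖ ^ 2) := by
    refine (dirDeriv_dirDeriv_comp_norm_sub_sq hL (hh.differentiable (by simp)) _ p x).trans ?_
    simp [EuclideanSpace.inner_single_right]
  have h_laplacian (x : Plane) : radialLaplacian h p x =
      partialDeriv 0 (partialDeriv 0 fun x => L (‖x - p‖ ^ 2)) x +
        partialDeriv 1 (partialDeriv 1 fun x => L (‖x - p‖ ^ 2)) x := by
    have h_norm := norm_sq_eq_add_sq (x - p)
    simp only [PiLp.sub_apply] at h_norm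
    rw [h_second, h_second, radialLaplacian]
    linear_combination 4 * deriv h (‖x - p‖ ^ 2) * h_norm
  simp only [h_laplacian]
  rw [← integral_neg, IsTest.integral_mul_multiplier (((hf.dirDeriv _).dirDeriv _).add
    ((hf.dirDeriv _).dirDeriv _)) hw isEvenSymbol_rieszSqSymbol]
  refine integral_congr_ae (ae_of_all _ fun x => ?_)
  refine (congrArg (· * w x) (hf.rieszSq_laplacian x)).trans ?_
  dsimp only
  rw [h_second, radialSecondDeriv, neg_mul]

/-- A smooth cutoff, equal to `1` on `(-∞, 1]` and to `0` on `[2, ∞)`. -/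
def cutoff (s : ℝ) : ℝ := 1 - Real.smoothTransition (s - 1)

lemma contDiff_cutoff : ContDiff ℝ ∞ cutoff :=
  contDiff_const.sub (Real.smoothTransition.contDiff.comp (contDiff_id.sub contDiff_const))

lemma cutoff_of_le {s : ℝ} (hs : s ≤ 1) : cutoff s = 1 := by
  rw [cutoff, Real.smoothTransition.zero_of_nonpos (by linarith), sub_zero]

lemma cutoff_of_ge {s : ℝ} (hs : 2 ≤ s) : cutoff s = 0 := by
  rw [cutoff, Real.smoothTransition.one_of_one_le (by linarith), sub_self]

lemma deriv_cutoff_of_lt {s : ℝ} (hs : s < 1) : deriv cutoff s = 0 := by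
  have h_eq : cutoff =ᶠ[nhds s] fun _ => 1 :=
    Filter.mem_of_superset (Iio_mem_nhds hs) fun r hr => cutoff_of_le (le_of_lt hr)
  rw [h_eq.deriv_eq, deriv_const]

lemma deriv_cutoff_of_gt {s : ℝ} (hs : 2 < s) : deriv cutoff s = 0 := by
  have h_eq : cutoff =ᶠ[nhds s] fun _ => 0 :=
    Filter.mem_of_superset (Ioi_mem_nhds hs) fun r hr => cutoff_of_ge (le_of_lt hr)
  rw [h_eq.deriv_eq, deriv_const]

/-- The function `h` cut off smoothly between `R²` and `2R²`. -/
def truncate (h : ℝ → ℝ) (R s : ℝ) : ℝ := h s * cutoff (s / R ^ 2)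

lemma contDiff_truncate (hh : ContDiff ℝ ∞ h) (R : ℝ) : ContDiff ℝ ∞ (truncate h R) :=
  hh.mul (contDiff_cutoff.comp (contDiff_id.div_const _))

lemma deriv_truncate (hh : Differentiable ℝ h) (R s : ℝ) :
    deriv (truncate h R) s =
      deriv h s * cutoff (s / R ^ 2) + h s * (deriv cutoff (s / R ^ 2) / R ^ 2) := by
  have h_cutoff :
      HasDerivAt (fun s => cutoff (s / R ^ 2)) (deriv cutoff (s / R ^ 2) / R ^ 2) s := by
    refine (((contDiff_cutoff.differentiable (by simp)) (s / R ^ 2)).hasDerivAt.comp s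
      ((hasDerivAt_id s).div_const (R ^ 2))).congr_deriv ?_
    rw [mul_one_div]
  exact ((hh s).hasDerivAt.mul h_cutoff).deriv

lemma add_mul_deriv_eq_zero_of_mul_eq_one (hh : Differentiable ℝ h) {a : ℝ}
    (h_inv : ∀ s ≥ a, s * h s = 1) {s : ℝ} (hs : a < s) : h s + s * deriv h s = 0 := by
  have h_deriv : HasDerivAt (fun s => s * h s) (1 * h s + s * deriv h s) s :=
    (hasDerivAt_id s).mul (hh s).hasDerivAt
  have h_const : (fun s => s * h s) =ᶠ[nhds s] fun _ => 1 :=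
    Filter.mem_of_superset (Ioi_mem_nhds hs) fun r hr => h_inv r (le_of_lt hr)
  rw [← one_mul (h s), ← h_deriv.deriv, h_const.deriv_eq, deriv_const]

/-- The change of the radial Laplacian caused by truncating `h` at radius `1`, when `h s = 1 / s`
on the truncation annulus. -/
def truncationError (x : Plane) : ℝ := 4 * deriv cutoff (‖x‖ ^ 2)

lemma continuous_truncationError : Continuous truncationError := by
  have h_cont : Continuous (deriv cutoff) := contDiff_cutoff.continuous_deriv (by simp)
  unfold truncationError
  fun_prop

lemma hasCompactSupport_truncationError : HasCompactSupport truncationError := by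
  have h_supp := hasCompactSupport_comp_norm_sub_sq (V := Plane) (L := fun s => 4 * deriv cutoff s)
    (fun s hs => by rw [deriv_cutoff_of_gt hs, mul_zero]) 0
  simp only [sub_zero] at h_supp
  exact h_supp

lemma radialLaplacian_truncate (hh : Differentiable ℝ h) {a : ℝ} (h_inv : ∀ s ≥ a, s * h s = 1)
    {R : ℝ} (hR : 0 < R) (haR : a < R ^ 2) (p x : Plane) :
    radialLaplacian (truncate h R) p x =
      radialLaplacian h p x + truncationError (R⁻¹ • (x - p)) / R ^ 2 := by
  have h_scale : ‖R⁻¹ • (x - p)‖ ^ 2 = ‖x - p‖ ^ 2 / R ^ 2 := by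
    rw [norm_smul, norm_inv, Real.norm_of_nonneg hR.le, mul_pow, inv_pow, inv_mul_eq_div]
  rw [radialLaplacian, radialLaplacian, truncationError, deriv_truncate hh, truncate, h_scale]
  set s := ‖x - p‖ ^ 2
  rcases lt_or_ge s (R ^ 2) with hs | hs
  · have hs_lt : s / R ^ 2 < 1 := (div_lt_one (by positivity)).2 hs
    rw [deriv_cutoff_of_lt hs_lt, cutoff_of_le hs_lt.le]
    ring
  · have h_zero := add_mul_deriv_eq_zero_of_mul_eq_one hh h_inv (haR.trans_le hs)
    linear_combination 4 * (cutoff (s / R ^ 2) - 1) * h_zero +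
      4 * (deriv cutoff (s / R ^ 2) / R ^ 2) * h_inv s (haR.le.trans hs)

lemma radialSecondDeriv_truncate (hh : Differentiable ℝ h) {R : ℝ} {p x : Plane}
    (hx : ‖x - p‖ < R) : radialSecondDeriv (truncate h R) p x = radialSecondDeriv h p x := by
  have hs_lt : ‖x - p‖ ^ 2 / R ^ 2 < 1 := by
    rw [div_lt_one (pow_pos ((norm_nonneg _).trans_lt hx) 2)]
    gcongr
  rw [radialSecondDeriv, radialSecondDeriv, deriv_truncate hh, truncate, deriv_cutoff_of_lt hs_lt,
    cutoff_of_le hs_lt.le]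
  ring

lemma tendsto_integral_dilation_mul {φ ψ : Plane → ℝ} (hφ : MemLp φ 2) (hψ : MemLp ψ 2)
    (p : Plane) :
    Filter.Tendsto (fun R : ℝ => ∫ x, φ (R⁻¹ • (x - p)) / R ^ 2 * ψ x) Filter.atTop (nhds 0) := by
  have h_sq : ∀ R : ℝ, 0 < R → ∫ x, φ (R⁻¹ • (x - p)) ^ 2 = R ^ 2 * ∫ x, φ x ^ 2 := fun R hR => by
    rw [integral_sub_right_eq_self (fun x => φ (R⁻¹ • x) ^ 2) p,
      Measure.integral_comp_inv_smul_of_nonneg volume (fun x => φ x ^ 2) hR.le,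
      finrank_euclideanSpace_fin, smul_eq_mul]
  have h_int_sq : ∀ R : ℝ, 0 < R → Integrable fun x => φ (R⁻¹ • (x - p)) ^ 2 := fun R hR =>
    (hφ.integrable_sq.comp_smul (inv_ne_zero hR.ne')).comp_sub_right p
  refine squeeze_zero_norm' (a := fun R => ((∫ x, φ x ^ 2) + ∫ x, ψ x ^ 2) / R) ?_
    (Filter.Tendsto.div_atTop tendsto_const_nhds Filter.tendsto_id)
  filter_upwards [Filter.eventually_gt_atTop 0] with R hR
  have h_young (x : Plane) : |φ (R⁻¹ • (x - p)) / R ^ 2 * ψ x| ≤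
      1 / R ^ 3 * φ (R⁻¹ • (x - p)) ^ 2 + 1 / R * ψ x ^ 2 := by
    have h_amgm := two_mul_le_add_sq (|φ (R⁻¹ • (x - p))| / R) |ψ x|
    rw [div_pow, sq_abs, sq_abs] at h_amgm
    rw [abs_mul, abs_div, abs_of_pos (pow_pos hR 2)]
    calc |φ (R⁻¹ • (x - p))| / R ^ 2 * |ψ x|
        = 1 / R * (|φ (R⁻¹ • (x - p))| / R * |ψ x|) := by field_simp
      _ ≤ 1 / R * (φ (R⁻¹ • (x - p)) ^ 2 / R ^ 2 + ψ x ^ 2) := by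
          gcongr
          nlinarith [mul_nonneg (div_nonneg (abs_nonneg (φ (R⁻¹ • (x - p)))) hR.le)
            (abs_nonneg (ψ x))]
      _ = _ := by field_simp
  calc ‖∫ x, φ (R⁻¹ • (x - p)) / R ^ 2 * ψ x‖
      ≤ ∫ x, |φ (R⁻¹ • (x - p)) / R ^ 2 * ψ x| := norm_integral_le_integral_norm _
    _ ≤ ∫ x, (1 / R ^ 3 * φ (R⁻¹ • (x - p)) ^ 2 + 1 / R * ψ x ^ 2) :=
        integral_mono_of_nonneg (ae_of_all _ fun _ => abs_nonneg _)
          (((h_int_sq R hR).const_mul _).add (hψ.integrable_sq.const_mul _)) (ae_of_all _ h_young)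
    _ = ((∫ x, φ x ^ 2) + ∫ x, ψ x ^ 2) / R := by
        rw [integral_add ((h_int_sq R hR).const_mul _) (hψ.integrable_sq.const_mul _),
          integral_const_mul, integral_const_mul, h_sq R hR]
        field_simp

lemma continuous_radialLaplacian (hh : ContDiff ℝ ∞ h) (p : Plane) :
    Continuous (radialLaplacian h p) := by
  have h_cont : Continuous h := hh.continuous
  have h_cont_deriv : Continuous (deriv h) := hh.continuous_deriv (by simp)
  unfold radialLaplacian
  fun_prop

lemma continuous_radialSecondDeriv (hh : ContDiff ℝ ∞ h) (p : Plane) :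
    Continuous (radialSecondDeriv h p) := by
  have h_cont : Continuous h := hh.continuous
  have h_cont_deriv : Continuous (deriv h) := hh.continuous_deriv (by simp)
  unfold radialSecondDeriv
  fun_prop

lemma hasCompactSupport_radialLaplacian (hh : Differentiable ℝ h) {a : ℝ}
    (h_inv : ∀ s ≥ a, s * h s = 1) (p : Plane) : HasCompactSupport (radialLaplacian h p) :=
  hasCompactSupport_comp_norm_sub_sq (L := fun s => 4 * (h s + s * deriv h s))
    (fun s hs => by rw [add_mul_deriv_eq_zero_of_mul_eq_one hh h_inv hs, mul_zero]) p

lemma integral_truncationError_mul_rieszSq (hh : ContDiff ℝ ∞ h) {a : ℝ}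
    (h_inv : ∀ s ≥ a, s * h s = 1) {p : Plane} (hw : IsTest w) {R : ℝ} (hR : 0 < R)
    (haR : a < R ^ 2) (hwR : ∀ x ∈ tsupport w, ‖x - p‖ < R) :
    ∫ x, truncationError (R⁻¹ • (x - p)) / R ^ 2 * rieszSq w x =
      -(∫ x, radialSecondDeriv h p x * w x) - ∫ x, radialLaplacian h p x * rieszSq w x := by
  have h_diff : Differentiable ℝ h := hh.differentiable (by simp)
  have h_trunc := contDiff_truncate hh R
  have h_zero : ∀ s ≥ 2 * R ^ 2, truncate h R s = 0 := fun s hs => by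
    rw [truncate, cutoff_of_ge ((le_div_iff₀ (by positivity)).2 hs), mul_zero]
  have h_cont : Continuous (rieszSq w) :=
    (hw.contDiff_multiplier isEvenSymbol_rieszSqSymbol).continuous
  have h_int : Integrable fun x => radialLaplacian h p x * rieszSq w x :=
    ((continuous_radialLaplacian hh p).mul h_cont).integrable_of_hasCompactSupport
      (hasCompactSupport_radialLaplacian h_diff h_inv p).mul_right
  have h_int_trunc : Integrable fun x => radialLaplacian (truncate h R) p x * rieszSq w x :=
    ((continuous_radialLaplacian h_trunc p).mul h_cont).integrable_of_hasCompactSupport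
      (hasCompactSupport_comp_norm_sub_sq
        (L := fun s => 4 * (truncate h R s + s * deriv (truncate h R) s)) (b := 2 * R ^ 2)
        (fun s hs => by
          have h_eq : truncate h R =ᶠ[nhds s] fun _ => 0 :=
            Filter.mem_of_superset (Ioi_mem_nhds hs) fun r hr => h_zero r (le_of_lt hr)
          rw [h_zero s hs.le, h_eq.deriv_eq, deriv_const, mul_zero, add_zero, mul_zero])
        p).mul_right
  have h_second (x : Plane) :
      radialSecondDeriv (truncate h R) p x * w x = radialSecondDeriv h p x * w x := by
    by_cases hx : x ∈ tsupport w
    · rw [radialSecondDeriv_truncate h_diff (hwR x hx)]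
    · rw [image_eq_zero_of_notMem_tsupport hx, mul_zero, mul_zero]
  calc ∫ x, truncationError (R⁻¹ • (x - p)) / R ^ 2 * rieszSq w x
      = ∫ x, (radialLaplacian (truncate h R) p x * rieszSq w x -
          radialLaplacian h p x * rieszSq w x) := by
        refine integral_congr_ae (ae_of_all _ fun x => ?_)
        dsimp only
        rw [radialLaplacian_truncate h_diff h_inv hR haR]
        ring
    _ = _ := by
        rw [integral_sub h_int_trunc h_int,
          integral_radialLaplacian_mul_rieszSq_of_eq_zero h_trunc h_zero p hw]
        simp only [h_second]

/-- For `h s = 1 / s` near infinity, the Laplacian has compact support although the weight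
`radialSecondDeriv h p` is not even integrable, so that `R₁²` cannot be moved onto it directly:
truncate at a radius `R`, and let `R → ∞`. -/
lemma integral_radialLaplacian_mul_rieszSq (hh : ContDiff ℝ ∞ h) {a : ℝ}
    (h_inv : ∀ s ≥ a, s * h s = 1) (p : Plane) (hw : IsTest w) :
    ∫ x, radialLaplacian h p x * rieszSq w x = -∫ x, radialSecondDeriv h p x * w x := by
  obtain ⟨ρ, hρ⟩ := hw.compact.isBounded.subset_closedBall p
  have h_memLp : MemLp truncationError 2 :=
    continuous_truncationError.memLp_of_hasCompactSupport hasCompactSupport_truncationError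
  have h_lim := tendsto_integral_dilation_mul h_memLp
    (hw.memLp_multiplier isEvenSymbol_rieszSqSymbol) p
  have h_truncated : ∀ᶠ R : ℝ in Filter.atTop,
      ∫ x, truncationError (R⁻¹ • (x - p)) / R ^ 2 * rieszSq w x =
        -(∫ x, radialSecondDeriv h p x * w x) - ∫ x, radialLaplacian h p x * rieszSq w x := by
    filter_upwards [Filter.eventually_ge_atTop 1, Filter.eventually_gt_atTop a,
      Filter.eventually_gt_atTop ρ] with R hR haR hρR
    exact integral_truncationError_mul_rieszSq hh h_inv hw (by linarith) (by nlinarith)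
      fun x hx => (mem_closedBall_iff_norm.1 (hρ hx)).trans_lt hρR
  linarith [tendsto_nhds_unique (h_lim.congr' h_truncated) tendsto_const_nhds]

end RadialDuality

/-! ### Radial densities and their `R₁²`-potentials -/

/-- A smooth monotone step, equal to `0` on `(-∞, 1/2]` and to `1` on `[1, ∞)`. -/
def smoothStep (s : ℝ) : ℝ := Real.smoothTransition (2 * s - 1)

lemma contDiff_smoothStep : ContDiff ℝ ∞ smoothStep :=
  Real.smoothTransition.contDiff.comp ((contDiff_const.mul contDiff_id).sub contDiff_const)

lemma smoothStep_of_le {s : ℝ} (hs : s ≤ 1 / 2) : smoothStep s = 0 :=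
  Real.smoothTransition.zero_of_nonpos (by linarith)

lemma smoothStep_of_ge {s : ℝ} (hs : 1 ≤ s) : smoothStep s = 1 :=
  Real.smoothTransition.one_of_one_le (by linarith)

lemma monotone_smoothStep : Monotone smoothStep := fun _ _ hst =>
  Real.smoothTransition.monotone (by linarith)

lemma deriv_smoothStep_of_gt {s : ℝ} (hs : 1 < s) : deriv smoothStep s = 0 := by
  have h_eq : smoothStep =ᶠ[nhds s] fun _ => 1 :=
    Filter.mem_of_superset (Ioi_mem_nhds hs) fun t ht => smoothStep_of_ge (le_of_lt ht)
  rw [h_eq.deriv_eq, deriv_const]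

lemma exists_deriv_smoothStep_le : ∃ C, 0 ≤ C ∧ ∀ s, 0 ≤ s → deriv smoothStep s ≤ C := by
  obtain ⟨C, hC⟩ := isCompact_Icc.exists_bound_of_continuousOn (s := Icc (0 : ℝ) 1)
    (contDiff_smoothStep.continuous_deriv (by simp)).continuousOn
  have hC_nonneg : 0 ≤ C := (norm_nonneg _).trans (hC 0 ⟨le_rfl, zero_le_one⟩)
  refine ⟨C, hC_nonneg, fun s hs => ?_⟩
  rcases le_or_gt s 1 with h_le | h_gt
  · exact (le_abs_self _).trans (hC s ⟨hs, h_le⟩)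
  · rwa [deriv_smoothStep_of_gt h_gt]

/-- A smooth function which equals `1 / s` for `s ≥ 1` and vanishes near `0`. -/
def stepQuotient (s : ℝ) : ℝ := smoothStep s / s

lemma contDiff_stepQuotient : ContDiff ℝ ∞ stepQuotient := by
  refine contDiff_iff_contDiffAt.2 fun s => ?_
  rcases lt_or_ge s (1 / 2) with hs | hs
  · refine contDiffAt_const (c := (0 : ℝ)).congr_of_eventuallyEq ?_
    filter_upwards [Iio_mem_nhds hs] with t ht
    rw [stepQuotient, smoothStep_of_le (le_of_lt ht), zero_div]
  · exact contDiff_smoothStep.contDiffAt.div contDiffAt_id (ne_of_gt (by linarith))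

lemma mul_stepQuotient (s : ℝ) : s * stepQuotient s = smoothStep s := by
  rcases eq_or_ne s 0 with rfl | hs
  · rw [zero_mul, smoothStep_of_le (by norm_num)]
  · rw [stepQuotient, mul_div_cancel₀ _ hs]

lemma hasDerivAt_stepQuotient (s : ℝ) : HasDerivAt stepQuotient (deriv stepQuotient s) s :=
  (contDiff_stepQuotient.differentiable (by simp) s).hasDerivAt

lemma stepQuotient_add_mul_deriv (s : ℝ) :
    stepQuotient s + s * deriv stepQuotient s = deriv smoothStep s := by
  have h_deriv : HasDerivAt (fun s => s * stepQuotient s)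
      (1 * stepQuotient s + s * deriv stepQuotient s) s :=
    (hasDerivAt_id s).mul (hasDerivAt_stepQuotient s)
  rw [← one_mul (stepQuotient s), ← h_deriv.deriv, funext mul_stepQuotient]

lemma abs_stepQuotient_le {s : ℝ} (hs : 0 ≤ s) : |stepQuotient s| ≤ 3 / (1 + s) := by
  rcases le_or_gt s (1 / 2) with h_le | h_gt
  · rw [stepQuotient, smoothStep_of_le h_le, zero_div, abs_zero]
    positivity
  · have h_nonneg : 0 ≤ smoothStep s := Real.smoothTransition.nonneg _
    have h_le_one : smoothStep s ≤ 1 := Real.smoothTransition.le_one _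
    rw [stepQuotient, abs_of_nonneg (by positivity), div_le_div_iff₀ (by linarith) (by linarith)]
    nlinarith

lemma deriv_stepQuotient_of_gt {s : ℝ} (hs : 1 < s) : deriv stepQuotient s = -1 / s ^ 2 := by
  have h_deriv := stepQuotient_add_mul_deriv s
  have h_mul := mul_stepQuotient s
  rw [deriv_smoothStep_of_gt hs] at h_deriv
  rw [smoothStep_of_ge hs.le] at h_mul
  rw [eq_div_iff (by positivity)]
  linear_combination s * h_deriv - h_mul

lemma exists_abs_deriv_stepQuotient_le :
    ∃ C, 0 ≤ C ∧ ∀ s, 0 ≤ s → |deriv stepQuotient s| ≤ C / (1 + s) ^ 2 := by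
  obtain ⟨K, hK⟩ := isCompact_Icc.exists_bound_of_continuousOn (s := Icc (0 : ℝ) 1)
    (contDiff_stepQuotient.continuous_deriv (by simp)).continuousOn
  have hK_nonneg : 0 ≤ K := (norm_nonneg _).trans (hK 0 ⟨le_rfl, zero_le_one⟩)
  refine ⟨4 * K + 4, by positivity, fun s hs => ?_⟩
  rw [le_div_iff₀ (by positivity)]
  rcases le_or_gt s 1 with h_le | h_gt
  · have h_deriv : |deriv stepQuotient s| ≤ K := hK s ⟨hs, h_le⟩
    have h_sq : (1 + s) ^ 2 ≤ 4 := by nlinarith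
    calc |deriv stepQuotient s| * (1 + s) ^ 2 ≤ K * 4 := by gcongr
      _ ≤ 4 * K + 4 := by linarith
  · rw [deriv_stepQuotient_of_gt h_gt, abs_div, abs_neg, abs_one, abs_of_nonneg (by positivity),
      div_mul_eq_mul_div, div_le_iff₀ (by positivity)]
    nlinarith

/-- The radial profile equal to `1 / s` for `s ≥ r²`: as `h` in `radialLaplacian h p`, it is the
derivative of the logarithm, smoothed at scale `r`. -/
def logProfile (r s : ℝ) : ℝ := stepQuotient (s / r ^ 2) / r ^ 2

lemma contDiff_logProfile (r : ℝ) : ContDiff ℝ ∞ (logProfile r) :=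
  (contDiff_stepQuotient.comp (contDiff_id.div_const _)).div_const _

lemma deriv_logProfile (r s : ℝ) :
    deriv (logProfile r) s = deriv stepQuotient (s / r ^ 2) / r ^ 4 := by
  have h_deriv : HasDerivAt (logProfile r) _ s := ((hasDerivAt_stepQuotient (s / r ^ 2)).comp s
    ((hasDerivAt_id s).div_const (r ^ 2))).div_const (r ^ 2)
  rw [h_deriv.deriv]
  field_simp

lemma mul_logProfile_eq_one {r : ℝ} (hr : 0 < r) {s : ℝ} (hs : r ^ 2 ≤ s) :
    s * logProfile r s = 1 := by
  have h_mul := mul_stepQuotient (s / r ^ 2)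
  rw [smoothStep_of_ge ((one_le_div (by positivity)).2 hs)] at h_mul
  rw [← h_mul, logProfile]
  ring

/-- A smooth radial bump around `p`, supported in the ball of radius `r`, of total mass independent
of `p` and `r`: half the Laplacian of a logarithm smoothed at scale `r`. -/
def density (p : Plane) (r : ℝ) (x : Plane) : ℝ := radialLaplacian (logProfile r) p x / 2

/-- The function `R₁² (density p r)`. -/
def potential (p : Plane) (r : ℝ) (x : Plane) : ℝ := -radialSecondDeriv (logProfile r) p x / 2

section Density

variable {p x : Plane} {r : ℝ}

lemma density_eq (hr : r ≠ 0) (p x : Plane) :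
    density p r x = 2 * deriv smoothStep (‖x - p‖ ^ 2 / r ^ 2) / r ^ 2 := by
  rw [density, radialLaplacian, deriv_logProfile, logProfile, ← stepQuotient_add_mul_deriv]
  field_simp
  ring

lemma continuous_density (p : Plane) (r : ℝ) : Continuous (density p r) :=
  (continuous_radialLaplacian (contDiff_logProfile r) p).div_const 2

lemma continuous_potential (p : Plane) (r : ℝ) : Continuous (potential p r) :=
  (continuous_radialSecondDeriv (contDiff_logProfile r) p).neg.div_const 2

lemma density_nonneg (hr : r ≠ 0) (p x : Plane) : 0 ≤ density p r x := by
  have h_deriv : 0 ≤ deriv smoothStep (‖x - p‖ ^ 2 / r ^ 2) := monotone_smoothStep.deriv_nonneg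
  rw [density_eq hr]
  positivity

lemma one_lt_norm_sub_sq_div_sq (hr : 0 < r) (hx : r < ‖x - p‖) : 1 < ‖x - p‖ ^ 2 / r ^ 2 := by
  rw [one_lt_div (by positivity)]
  gcongr

lemma density_of_lt (hr : 0 < r) (hx : r < ‖x - p‖) : density p r x = 0 := by
  rw [density_eq hr.ne', deriv_smoothStep_of_gt (one_lt_norm_sub_sq_div_sq hr hx), mul_zero,
    zero_div]

lemma hasCompactSupport_density (hr : 0 < r) (p : Plane) : HasCompactSupport (density p r) :=
  HasCompactSupport.intro (isCompact_closedBall p r) fun x hx =>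
    density_of_lt hr (by simpa [dist_eq_norm] using hx)

lemma integrable_density (hr : 0 < r) (p : Plane) : Integrable (density p r) :=
  (continuous_density p r).integrable_of_hasCompactSupport (hasCompactSupport_density hr p)

lemma exists_density_le :
    ∃ C, 0 ≤ C ∧ ∀ p r x, 0 < r → density p r x ≤ C / (r ^ 2 + ‖x - p‖ ^ 2) := by
  obtain ⟨C, hC, h_deriv⟩ := exists_deriv_smoothStep_le
  refine ⟨4 * C, by positivity, fun p r x hr => ?_⟩
  rcases le_or_gt ‖x - p‖ r with hx | hx
  · have h_sq : ‖x - p‖ ^ 2 ≤ r ^ 2 := by gcongr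
    calc density p r x ≤ 2 * C / r ^ 2 := by
          rw [density_eq hr.ne']
          gcongr
          exact h_deriv _ (by positivity)
      _ = 4 * C / (r ^ 2 + r ^ 2) := by field_simp; ring
      _ ≤ 4 * C / (r ^ 2 + ‖x - p‖ ^ 2) := by gcongr
  · rw [density_of_lt hr hx]
    positivity

/-- The common total mass of all `density p r`. -/
def densityMass : ℝ := ∫ x, density 0 1 x

lemma integral_density (hr : 0 < r) (p : Plane) : ∫ x, density p r x = densityMass := by
  have h_dilation (x : Plane) : density p r (x + p) = (r ^ 2)⁻¹ * density 0 1 (r⁻¹ • x) := by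
    rw [density_eq hr.ne', density_eq one_ne_zero, add_sub_cancel_right, sub_zero, norm_smul,
      norm_inv, Real.norm_of_nonneg hr.le, mul_pow, inv_pow, inv_mul_eq_div, one_pow, div_one,
      div_one, ← div_eq_inv_mul]
  rw [← integral_add_right_eq_self _ p]
  simp_rw [h_dilation]
  rw [integral_const_mul, Measure.integral_comp_inv_smul_of_nonneg _ _ hr.le,
    finrank_euclideanSpace_fin, smul_eq_mul, inv_mul_cancel_left₀ (by positivity), densityMass]

lemma densityMass_pos : 0 < densityMass := by
  obtain ⟨c, hc, h_slope⟩ := exists_deriv_eq_slope smoothStep (a := 1 / 2) (b := 1) (by norm_num)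
    contDiff_smoothStep.continuous.continuousOn
    (contDiff_smoothStep.differentiable (by simp)).differentiableOn
  rw [smoothStep_of_le le_rfl, smoothStep_of_ge le_rfl] at h_slope
  refine (continuous_density 0 1).integral_pos_of_hasCompactSupport_nonneg_nonzero
    (hasCompactSupport_density one_pos 0) (density_nonneg one_ne_zero 0)
    (x := EuclideanSpace.single 0 (Real.sqrt c)) ?_
  have h_norm : ‖(EuclideanSpace.single 0 (Real.sqrt c) : Plane) - 0‖ ^ 2 / 1 ^ 2 = c := by
    simp [Real.sq_sqrt (show 0 ≤ c by linarith [hc.1])]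
  rw [density_eq one_ne_zero, h_norm, h_slope]
  norm_num

lemma integral_density_mul_rieszSq (hr : 0 < r) (p : Plane) {w : Plane → ℝ} (hw : IsTest w) :
    ∫ x, density p r x * rieszSq w x = ∫ x, potential p r x * w x := by
  have h_duality := integral_radialLaplacian_mul_rieszSq (contDiff_logProfile r)
    (fun _ hs => mul_logProfile_eq_one hr hs) p hw
  simp only [density, potential, div_mul_eq_mul_div, neg_mul, integral_div, integral_neg]
  rw [h_duality]

lemma potential_eq (p : Plane) (r : ℝ) (x : Plane) :
    potential p r x = -(stepQuotient (‖x - p‖ ^ 2 / r ^ 2) / r ^ 2) -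
      2 * (x 0 - p 0) ^ 2 * (deriv stepQuotient (‖x - p‖ ^ 2 / r ^ 2) / r ^ 4) := by
  rw [potential, radialSecondDeriv, deriv_logProfile, logProfile]
  ring

lemma potential_of_lt (hr : 0 < r) (hx : r < ‖x - p‖) :
    potential p r x = ((x 0 - p 0) ^ 2 - (x 1 - p 1) ^ 2) / ‖x - p‖ ^ 4 := by
  have hs := one_lt_norm_sub_sq_div_sq hr hx
  have h_pos : 0 < ‖x - p‖ := hr.trans hx
  have h_norm := norm_sq_eq_add_sq (x - p)
  simp only [PiLp.sub_apply] at h_norm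
  rw [potential_eq, deriv_stepQuotient_of_gt hs, stepQuotient, smoothStep_of_ge hs.le,
    eq_sub_of_add_eq' h_norm.symm]
  field_simp
  ring

lemma sq_sub_le_norm_sub_sq (x p : Plane) : (x 0 - p 0) ^ 2 ≤ ‖x - p‖ ^ 2 := by
  rw [norm_sq_eq_add_sq]
  exact le_add_of_nonneg_right (sq_nonneg _)

lemma exists_abs_potential_le :
    ∃ C, 0 ≤ C ∧ ∀ p r x, 0 < r → |potential p r x| ≤ C / (r ^ 2 + ‖x - p‖ ^ 2) := by
  obtain ⟨C, hC, h_deriv⟩ := exists_abs_deriv_stepQuotient_le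
  refine ⟨3 + 2 * C, by positivity, fun p r x hr => ?_⟩
  obtain ⟨s, hs, hs_eq⟩ : ∃ s, 0 ≤ s ∧ ‖x - p‖ ^ 2 = s * r ^ 2 :=
    ⟨‖x - p‖ ^ 2 / r ^ 2, by positivity, by field_simp⟩
  have h_quotient : |stepQuotient s / r ^ 2| ≤ 3 / (1 + s) / r ^ 2 := by
    rw [abs_div, abs_of_pos (a := r ^ 2) (by positivity)]
    gcongr
    exact abs_stepQuotient_le hs
  have h_derivative : |2 * (x 0 - p 0) ^ 2 * (deriv stepQuotient s / r ^ 4)| ≤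
      2 * C / (1 + s) / r ^ 2 := by
    rw [abs_mul, abs_of_nonneg (a := 2 * (x 0 - p 0) ^ 2) (by positivity), abs_div,
      abs_of_pos (a := r ^ 4) (by positivity)]
    calc 2 * (x 0 - p 0) ^ 2 * (|deriv stepQuotient s| / r ^ 4)
        ≤ 2 * (s * r ^ 2) * (C / (1 + s) ^ 2 / r ^ 4) := by
          gcongr
          · exact hs_eq ▸ sq_sub_le_norm_sub_sq x p
          · exact h_deriv s hs
      _ = 2 * C / (1 + s) / r ^ 2 * (s / (1 + s)) := by field_simp
      _ ≤ 2 * C / (1 + s) / r ^ 2 :=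
          mul_le_of_le_one_right (by positivity) ((div_le_one (by positivity)).2 (by linarith))
  rw [potential_eq, hs_eq, mul_div_cancel_right₀ s (by positivity)]
  calc |-(stepQuotient s / r ^ 2) - 2 * (x 0 - p 0) ^ 2 * (deriv stepQuotient s / r ^ 4)|
      ≤ |stepQuotient s / r ^ 2| + |2 * (x 0 - p 0) ^ 2 * (deriv stepQuotient s / r ^ 4)| :=
        (abs_sub _ _).trans_eq (by rw [abs_neg])
    _ ≤ 3 / (1 + s) / r ^ 2 + 2 * C / (1 + s) / r ^ 2 := add_le_add h_quotient h_derivative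
    _ = (3 + 2 * C) / (r ^ 2 + s * r ^ 2) := by field_simp

end Density

/-! ### The initial datum -/

/-- The dyadic scale `2⁻ʲ`. -/
def scale (j : ℕ) : ℝ := (1 / 2) ^ j

/-- The centre `(2⁻ʲ, 0)` of the `j`-th bump. -/
def bumpCenter (j : ℕ) : Plane := EuclideanSpace.single 0 (scale j)

/-- The radius of the plateau of the `j`-th bump. -/
def bumpRadius (j : ℕ) : ℝ := scale j / 20

/-- The smooth radial plateau function of unit size. -/
def unitBump (y : Plane) : ℝ := cutoff (‖y‖ ^ 2)

/-- The `j`-th bump. Its height `1 / j!` makes the sum of all bumps smooth at the origin, where the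
bumps accumulate. -/
def bump (j : ℕ) (x : Plane) : ℝ :=
  (j.factorial : ℝ)⁻¹ * unitBump ((bumpRadius j)⁻¹ • (x - bumpCenter j))

/-- The initial datum: a sum of bumps accumulating at the origin along the horizontal axis. -/
def initialDatum (x : Plane) : ℝ := ∑' j, bump j x

/-- Membership in the ball which contains the support of the `k`-th bump. -/
def NearBump (k : ℕ) (x : Plane) : Prop := ‖x - bumpCenter k‖ < 2 * bumpRadius k

section InitialDatum

variable {j k : ℕ} {x y : Plane}

lemma scale_pos (j : ℕ) : 0 < scale j := by unfold scale; positivity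

lemma scale_le_one (j : ℕ) : scale j ≤ 1 := pow_le_one₀ (by norm_num) (by norm_num)

lemma two_mul_scale_le (hjk : j < k) : 2 * scale k ≤ scale j := by
  have h_succ : scale (j + 1) = scale j * (1 / 2) := pow_succ _ _
  have h_anti : scale k ≤ scale (j + 1) :=
    pow_le_pow_of_le_one (by norm_num) (by norm_num) (Nat.succ_le_of_lt hjk)
  linarith

lemma bumpRadius_pos (j : ℕ) : 0 < bumpRadius j := div_pos (scale_pos j) (by norm_num)

lemma norm_bumpCenter (j : ℕ) : ‖bumpCenter j‖ = scale j := by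
  simp [bumpCenter, abs_of_pos (scale_pos j)]

lemma norm_le_norm_sub_bumpCenter_add_scale (j : ℕ) (x : Plane) :
    ‖x‖ ≤ ‖x - bumpCenter j‖ + scale j := by
  simpa only [sub_add_cancel, norm_bumpCenter] using norm_add_le (x - bumpCenter j) (bumpCenter j)

lemma norm_sub_bumpCenter_sq (j : ℕ) (x : Plane) :
    ‖x - bumpCenter j‖ ^ 2 = (x 0 - scale j) ^ 2 + x 1 ^ 2 := by
  rw [norm_sq_eq_add_sq]
  simp [bumpCenter]

lemma NearBump.abs_fst_sub_scale_lt (hx : NearBump k x) : |x 0 - scale k| < scale k / 10 := by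
  calc |x 0 - scale k| ≤ ‖x - bumpCenter k‖ := by
        simpa [bumpCenter] using PiLp.norm_apply_le (x - bumpCenter k) 0
    _ < scale k / 10 := hx.trans_eq (by rw [bumpRadius]; ring)

lemma NearBump.abs_snd_lt (hx : NearBump k x) : |x 1| < scale k / 10 := by
  calc |x 1| ≤ ‖x - bumpCenter k‖ := by
        simpa [bumpCenter] using PiLp.norm_apply_le (x - bumpCenter k) 1
    _ < scale k / 10 := hx.trans_eq (by rw [bumpRadius]; ring)

lemma NearBump.two_mul_bumpRadius_lt (hx : NearBump k x) (hj : j ≠ k) :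
    2 * bumpRadius j < ‖x - bumpCenter j‖ := by
  have h_fst : |x 0 - scale j| ≤ ‖x - bumpCenter j‖ := by
    simpa [bumpCenter] using PiLp.norm_apply_le (x - bumpCenter j) 0
  refine lt_of_lt_of_le ?_ h_fst
  have h_near := abs_lt.1 hx.abs_fst_sub_scale_lt
  have hj_pos := scale_pos j
  rw [bumpRadius, lt_abs]
  rcases lt_or_gt_of_ne hj with h_lt | h_gt
  · right
    linarith [two_mul_scale_le h_lt]
  · left
    linarith [two_mul_scale_le h_gt]

lemma NearBump.bumpRadius_lt (hx : NearBump k x) (hj : j ≠ k) :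
    bumpRadius j < ‖x - bumpCenter j‖ := by
  linarith [hx.two_mul_bumpRadius_lt hj, bumpRadius_pos j]

lemma contDiff_unitBump : ContDiff ℝ ∞ unitBump := contDiff_cutoff.comp (contDiff_norm_sq ℝ)

lemma unitBump_nonneg (y : Plane) : 0 ≤ unitBump y :=
  sub_nonneg.2 (Real.smoothTransition.le_one _)

lemma unitBump_le_one (y : Plane) : unitBump y ≤ 1 :=
  sub_le_self _ (Real.smoothTransition.nonneg _)

lemma unitBump_of_le (hy : ‖y‖ ≤ 1) : unitBump y = 1 :=
  cutoff_of_le (pow_le_one₀ (norm_nonneg _) hy)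

lemma unitBump_of_ge (hy : 2 ≤ ‖y‖) : unitBump y = 0 :=
  cutoff_of_ge (by nlinarith)

lemma hasCompactSupport_unitBump : HasCompactSupport unitBump :=
  HasCompactSupport.intro (isCompact_closedBall 0 2) fun y hy =>
    unitBump_of_ge (by simpa using (not_le.1 (mt mem_closedBall_zero_iff.2 hy)).le)

lemma contDiff_bump (j : ℕ) : ContDiff ℝ ∞ (bump j) :=
  contDiff_const.mul (contDiff_unitBump.comp ((contDiff_id.sub contDiff_const).const_smul _))

lemma bump_nonneg (j : ℕ) (x : Plane) : 0 ≤ bump j x :=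
  mul_nonneg (by positivity) (unitBump_nonneg _)

lemma bump_le (j : ℕ) (x : Plane) : bump j x ≤ (j.factorial : ℝ)⁻¹ :=
  mul_le_of_le_one_right (by positivity) (unitBump_le_one _)

lemma norm_inv_bumpRadius_smul (j : ℕ) (x : Plane) :
    ‖(bumpRadius j)⁻¹ • (x - bumpCenter j)‖ = ‖x - bumpCenter j‖ / bumpRadius j := by
  rw [norm_smul, norm_inv, Real.norm_of_nonneg (bumpRadius_pos j).le, inv_mul_eq_div]

lemma bump_of_le (hx : ‖x - bumpCenter j‖ ≤ bumpRadius j) : bump j x = (j.factorial : ℝ)⁻¹ := by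
  have h_le : ‖(bumpRadius j)⁻¹ • (x - bumpCenter j)‖ ≤ 1 := by
    rw [norm_inv_bumpRadius_smul]
    exact div_le_one_of_le₀ hx (bumpRadius_pos j).le
  rw [bump, unitBump_of_le h_le, mul_one]

lemma bump_of_ge (hx : 2 * bumpRadius j ≤ ‖x - bumpCenter j‖) : bump j x = 0 := by
  have h_ge : 2 ≤ ‖(bumpRadius j)⁻¹ • (x - bumpCenter j)‖ := by
    rw [norm_inv_bumpRadius_smul]
    exact (le_div_iff₀ (bumpRadius_pos j)).2 hx
  rw [bump, unitBump_of_ge h_ge, mul_zero]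

lemma initialDatum_of_nearBump (hx : NearBump k x) : initialDatum x = bump k x :=
  tsum_eq_single k fun _ hj => bump_of_ge (hx.two_mul_bumpRadius_lt hj).le

lemma initialDatum_nonneg (x : Plane) : 0 ≤ initialDatum x := tsum_nonneg fun j => bump_nonneg j x

lemma exists_nearBump (hx : initialDatum x ≠ 0) : ∃ k, NearBump k x := by
  by_contra! h_far
  refine hx ?_
  simp only [initialDatum, bump_of_ge (not_lt.1 (h_far _)), tsum_zero]

lemma initialDatum_of_le (hx : ‖x - bumpCenter j‖ ≤ bumpRadius j) :
    initialDatum x = (j.factorial : ℝ)⁻¹ := by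
  have h_near : NearBump j x := hx.trans_lt (by linarith [bumpRadius_pos j])
  rw [initialDatum_of_nearBump h_near, bump_of_le hx]

lemma iteratedFDeriv_bump (n j : ℕ) (x : Plane) :
    iteratedFDeriv ℝ n (bump j) x = (j.factorial : ℝ)⁻¹ • (bumpRadius j)⁻¹ ^ n •
      iteratedFDeriv ℝ n unitBump ((bumpRadius j)⁻¹ • (x - bumpCenter j)) := by
  set u : Plane → ℝ := fun z => unitBump ((bumpRadius j)⁻¹ • z)
  have h_unit : ContDiff ℝ n unitBump := contDiff_unitBump.of_le (by exact_mod_cast le_top)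
  have h_dilated : ContDiff ℝ n fun x => u (x - bumpCenter j) :=
    h_unit.comp ((contDiff_id.sub contDiff_const).const_smul _)
  have h_bump : bump j = fun x => (j.factorial : ℝ)⁻¹ • u (x - bumpCenter j) := rfl
  rw [h_bump, iteratedFDeriv_const_smul_apply' h_dilated.contDiffAt,
    iteratedFDeriv_comp_sub (f := u), iteratedFDeriv_comp_const_smul _ h_unit]

lemma contDiff_initialDatum : ContDiff ℝ ∞ initialDatum := by
  have h_bdd (n : ℕ) : ∃ C, ∀ y, ‖iteratedFDeriv ℝ n unitBump y‖ ≤ C :=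
    (hasCompactSupport_unitBump.iteratedFDeriv n).exists_bound_of_continuous
      (contDiff_unitBump.continuous_iteratedFDeriv (by exact_mod_cast le_top))
  choose C hC using h_bdd
  have h_radius (j : ℕ) : (bumpRadius j)⁻¹ = 20 * 2 ^ j := by simp [bumpRadius, scale]
  have h_le (n j : ℕ) (x : Plane) :
      ‖iteratedFDeriv ℝ n (bump j) x‖ ≤ C n * 20 ^ n * ((2 ^ n) ^ j / j.factorial) := by
    rw [iteratedFDeriv_bump, norm_smul, norm_smul, norm_inv, norm_pow, h_radius,
      Real.norm_of_nonneg (by positivity), Real.norm_of_nonneg (by positivity)]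
    calc (j.factorial : ℝ)⁻¹ * ((20 * 2 ^ j) ^ n * ‖iteratedFDeriv ℝ n unitBump _‖)
        ≤ (j.factorial : ℝ)⁻¹ * ((20 * 2 ^ j) ^ n * C n) := by gcongr; exact hC n _
      _ = C n * 20 ^ n * ((2 ^ n) ^ j / j.factorial) := by
        rw [mul_pow, ← pow_mul, ← pow_mul, mul_comm j n]; ring
  exact contDiff_tsum contDiff_bump (fun n _ => (Real.summable_pow_div_factorial _).mul_left _)
    fun n j x _ => h_le n j x

lemma NearBump.norm_le (hx : NearBump k x) : ‖x‖ ≤ 2 := by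
  have h_near : ‖x - bumpCenter k‖ < 2 * (scale k / 20) := hx
  linarith [norm_le_norm_sub_bumpCenter_add_scale k x, scale_le_one k]

lemma isTest_initialDatum : IsTest initialDatum where
  smooth := contDiff_initialDatum
  compact := HasCompactSupport.intro (isCompact_closedBall 0 2) fun x hx => by
    by_contra h_ne
    obtain ⟨k, hk⟩ := exists_nearBump h_ne
    exact hx (mem_closedBall_zero_iff.2 hk.norm_le)

lemma inv_factorial_le (k : ℕ) : ((k.factorial : ℝ))⁻¹ ≤ Real.exp 4 * scale k ^ 2 := by
  have h_scale : scale k ^ 2 = (4 ^ k)⁻¹ := by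
    rw [scale, ← pow_mul, mul_comm, pow_mul, ← inv_pow]
    norm_num
  rw [h_scale, ← div_eq_mul_inv, le_div_iff₀ (by positivity), inv_mul_eq_div]
  exact Real.pow_div_factorial_le_exp 4 (by norm_num) k

lemma initialDatum_le (x : Plane) : initialDatum x ≤ 2 * Real.exp 4 * ‖x‖ ^ 2 := by
  rcases eq_or_ne (initialDatum x) 0 with hx | hx
  · rw [hx]
    positivity
  obtain ⟨k, hk⟩ := exists_nearBump hx
  have h_fst := abs_lt.1 hk.abs_fst_sub_scale_lt
  have h_scale : scale k ^ 2 ≤ 2 * ‖x‖ ^ 2 := by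
    rw [norm_sq_eq_add_sq]
    nlinarith [scale_pos k, sq_nonneg (x 1)]
  calc initialDatum x = bump k x := initialDatum_of_nearBump hk
    _ ≤ Real.exp 4 * scale k ^ 2 := (bump_le k x).trans (inv_factorial_le k)
    _ ≤ Real.exp 4 * (2 * ‖x‖ ^ 2) := by gcongr
    _ = 2 * Real.exp 4 * ‖x‖ ^ 2 := by ring

lemma ne_zero_of_initialDatum_ne_zero (hx : initialDatum x ≠ 0) : x ≠ 0 := by
  rintro rfl
  exact hx (le_antisymm (by simpa using initialDatum_le 0) (initialDatum_nonneg 0))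

end InitialDatum

/-! ### The weighted family of densities -/

/-- The density attached to the `j`-th bump. -/
def bumpDensity (j : ℕ) (x : Plane) : ℝ := density (bumpCenter j) (bumpRadius j) x

/-- The potential of the density attached to the `j`-th bump. -/
def bumpPotential (j : ℕ) (x : Plane) : ℝ := potential (bumpCenter j) (bumpRadius j) x

/-- The difference of the potential and the density of the `j`-th bump. Its integral against `w` is
that of the density against `R₁² w - w`. -/
def bumpKernel (j : ℕ) (x : Plane) : ℝ := bumpPotential j x - bumpDensity j x

section BumpDensity

variable {j k : ℕ} {x : Plane}

lemma bumpDensity_nonneg (j : ℕ) (x : Plane) : 0 ≤ bumpDensity j x :=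
  density_nonneg (bumpRadius_pos j).ne' _ _

lemma bumpDensity_of_lt (hx : bumpRadius j < ‖x - bumpCenter j‖) : bumpDensity j x = 0 :=
  density_of_lt (bumpRadius_pos j) hx

lemma bumpKernel_of_lt (hx : bumpRadius j < ‖x - bumpCenter j‖) :
    bumpKernel j x = ((x 0 - scale j) ^ 2 - x 1 ^ 2) / ‖x - bumpCenter j‖ ^ 4 := by
  rw [bumpKernel, bumpDensity, density_of_lt (bumpRadius_pos j) hx, sub_zero, bumpPotential,
    potential_of_lt (bumpRadius_pos j) hx]
  simp [bumpCenter]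

lemma NearBump.bumpKernel_nonneg (hx : NearBump k x) (hj : j < k) : 0 ≤ bumpKernel j x := by
  rw [bumpKernel_of_lt (hx.bumpRadius_lt hj.ne)]
  refine div_nonneg (sub_nonneg.2 (sq_le_sq.2 ?_)) (by positivity)
  have h_fst := abs_lt.1 hx.abs_fst_sub_scale_lt
  calc |x 1| ≤ scale k / 10 := hx.abs_snd_lt.le
    _ ≤ -(x 0 - scale j) := by linarith [two_mul_scale_le hj, scale_pos k]
    _ ≤ |x 0 - scale j| := neg_le_abs _

/-- Seen from a point near the `k`-th bump, the bumps closer to the origin lie within a narrow cone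
around the horizontal axis, where the potential is positive, at a distance comparable to
`scale k`. -/
lemma NearBump.le_bumpKernel (hx : NearBump k x) (hj : k < j) :
    1 / 10 / scale k ^ 2 ≤ bumpKernel j x := by
  have h_far := hx.bumpRadius_lt hj.ne'
  have h_fst := abs_lt.1 hx.abs_fst_sub_scale_lt
  have h_scale := two_mul_scale_le hj
  have hk_pos := scale_pos k
  have hj_pos := scale_pos j
  have h_norm_pos : 0 < ‖x - bumpCenter j‖ := (bumpRadius_pos j).trans h_far
  have h_snd_sq : x 1 ^ 2 ≤ (scale k / 10) ^ 2 := sq_le_sq' (abs_lt.1 hx.abs_snd_lt).1.le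
    (abs_lt.1 hx.abs_snd_lt).2.le
  have h_fst_ge : (2 / 5 * scale k) ^ 2 ≤ (x 0 - scale j) ^ 2 := by gcongr; linarith
  have h_fst_le : (x 0 - scale j) ^ 2 ≤ (11 / 10 * scale k) ^ 2 := by gcongr <;> linarith
  have h_norm : ‖x - bumpCenter j‖ ^ 4 ≤ (122 / 100 * scale k ^ 2) ^ 2 := by
    rw [show ‖x - bumpCenter j‖ ^ 4 = (‖x - bumpCenter j‖ ^ 2) ^ 2 by ring, norm_sub_bumpCenter_sq]
    gcongr
    linarith
  rw [bumpKernel_of_lt h_far]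
  calc 1 / 10 / scale k ^ 2 ≤ 15 / 100 * scale k ^ 2 / (122 / 100 * scale k ^ 2) ^ 2 := by
        rw [div_le_div_iff₀ (by positivity) (by positivity)]
        nlinarith [pow_pos hk_pos 4]
    _ ≤ ((x 0 - scale j) ^ 2 - x 1 ^ 2) / ‖x - bumpCenter j‖ ^ 4 := by
        gcongr
        · nlinarith
        · nlinarith

lemma exists_abs_bumpKernel_le :
    ∃ C, 0 ≤ C ∧ ∀ j x, |bumpKernel j x| ≤ C / (scale j ^ 2 + ‖x - bumpCenter j‖ ^ 2) := by
  obtain ⟨C, hC, h_potential⟩ := exists_abs_potential_le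
  obtain ⟨D, hD, h_density⟩ := exists_density_le
  refine ⟨400 * (C + D), by positivity, fun j x => ?_⟩
  have hr := bumpRadius_pos j
  have hs := scale_pos j
  have h_scale : scale j ^ 2 = 400 * bumpRadius j ^ 2 := by rw [bumpRadius]; ring
  calc |bumpKernel j x| ≤ |bumpPotential j x| + |bumpDensity j x| := abs_sub _ _
    _ ≤ C / (bumpRadius j ^ 2 + ‖x - bumpCenter j‖ ^ 2) +
        D / (bumpRadius j ^ 2 + ‖x - bumpCenter j‖ ^ 2) := by
        rw [abs_of_nonneg (bumpDensity_nonneg j x)]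
        exact add_le_add (h_potential _ _ _ hr) (h_density _ _ _ hr)
    _ = 400 * (C + D) / (400 * (bumpRadius j ^ 2 + ‖x - bumpCenter j‖ ^ 2)) := by field_simp
    _ ≤ 400 * (C + D) / (scale j ^ 2 + ‖x - bumpCenter j‖ ^ 2) := by
        gcongr
        rw [h_scale]
        nlinarith [sq_nonneg ‖x - bumpCenter j‖]

lemma exists_abs_bumpKernel_le_div_norm :
    ∃ C, 0 ≤ C ∧ ∀ j x, x ≠ 0 → |bumpKernel j x| ≤ C / ‖x‖ ^ 2 := by
  obtain ⟨C, hC, h_kernel⟩ := exists_abs_bumpKernel_le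
  refine ⟨2 * C, by positivity, fun j x hx => (h_kernel j x).trans ?_⟩
  have hs := scale_pos j
  have hx_pos : 0 < ‖x‖ := norm_pos_iff.2 hx
  have h_sq : ‖x‖ ^ 2 ≤ 2 * (scale j ^ 2 + ‖x - bumpCenter j‖ ^ 2) := by
    nlinarith [sq_nonneg (‖x - bumpCenter j‖ - scale j),
      norm_le_norm_sub_bumpCenter_add_scale j x]
  rw [div_le_div_iff₀ (by positivity) (by positivity)]
  linarith [mul_le_mul_of_nonneg_left h_sq hC]

lemma summable_geometric_mul_of_abs_le {q K : ℝ} (hq : q ∈ Ioo (0 : ℝ) 1) {a : ℕ → ℝ}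
    (ha : ∀ j, |a j| ≤ K) : Summable fun j => q ^ j * a j :=
  ((summable_geometric_of_lt_one hq.1.le hq.2).mul_right K).of_norm_bounded fun j => by
    rw [norm_mul, norm_pow, Real.norm_of_nonneg hq.1.le]
    exact mul_le_mul_of_nonneg_left (ha j) (pow_nonneg hq.1.le j)

lemma tsum_geometric_mul_nonneg {q c C : ℝ} {a : ℕ → ℝ} (hq : q ∈ Ioo (0 : ℝ) 1)
    (ha : Summable fun j => q ^ j * a j) (h_lt : ∀ j < k, 0 ≤ a j) (h_eq : -C ≤ a k)
    (h_gt : ∀ j, k < j → c ≤ a j) (hC : C ≤ q * (1 - q)⁻¹ * c) : 0 ≤ ∑' j, q ^ j * a j := by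
  have hq_pos := hq.1
  have h_head : 0 ≤ ∑ j ∈ Finset.range k, q ^ j * a j := Finset.sum_nonneg fun j hj =>
    mul_nonneg (by positivity) (h_lt j (Finset.mem_range.1 hj))
  have h_tail : q ^ k * (q * (1 - q)⁻¹ * c) ≤ ∑' j, q ^ (j + (k + 1)) * a (j + (k + 1)) := by
    calc q ^ k * (q * (1 - q)⁻¹ * c) = ∑' j, q ^ j * (q ^ (k + 1) * c) := by
          rw [tsum_mul_right, tsum_geometric_of_lt_one hq.1.le hq.2]
          ring
      _ ≤ ∑' j, q ^ (j + (k + 1)) * a (j + (k + 1)) := by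
          refine ((summable_geometric_of_lt_one hq.1.le hq.2).mul_right _).tsum_le_tsum
            (fun j => ?_) ((summable_nat_add_iff (k + 1)).2 ha)
          rw [← mul_assoc, ← pow_add]
          gcongr
          exact h_gt _ (by omega)
  have h_middle : 0 ≤ q ^ k * (a k + q * (1 - q)⁻¹ * c) :=
    mul_nonneg (by positivity) (by linarith)
  rw [← ha.sum_add_tsum_nat_add (k + 1), Finset.sum_range_succ]
  linarith

lemma summable_bumpKernel {q : ℝ} (hq : q ∈ Ioo (0 : ℝ) 1) (hx : x ≠ 0) :
    Summable fun j => q ^ j * bumpKernel j x := by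
  obtain ⟨C, -, h_kernel⟩ := exists_abs_bumpKernel_le_div_norm
  exact summable_geometric_mul_of_abs_le hq fun j => h_kernel j x hx

/-- For `q` close to `1`, the bumps closer to the origin than the `k`-th one outweigh the negative
part of the kernel of the `k`-th bump. -/
lemma exists_tsum_bumpKernel_nonneg : ∃ q ∈ Ioo (0 : ℝ) 1, ∀ x, initialDatum x ≠ 0 →
    0 ≤ ∑' j, q ^ j * bumpKernel j x := by
  obtain ⟨C, hC, h_kernel⟩ := exists_abs_bumpKernel_le
  obtain ⟨q, hq, h_ratio⟩ : ∃ q ∈ Ioo (0 : ℝ) 1, q * (1 - q)⁻¹ = 10 * C + 1 := by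
    refine ⟨(10 * C + 1) / (10 * C + 2), ⟨by positivity, ?_⟩, ?_⟩
    · rw [div_lt_one (by positivity)]
      linarith
    · rw [show 1 - (10 * C + 1) / (10 * C + 2) = 1 / (10 * C + 2) by field_simp; ring]
      field_simp
  refine ⟨q, hq, fun x hx => ?_⟩
  obtain ⟨k, hk⟩ := exists_nearBump hx
  have hs := scale_pos k
  have h_center : |bumpKernel k x| ≤ C / scale k ^ 2 := by
    refine (h_kernel k x).trans ?_
    gcongr
    exact le_add_of_nonneg_right (by positivity)
  refine tsum_geometric_mul_nonneg hq
    (summable_bumpKernel hq (ne_zero_of_initialDatum_ne_zero hx))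
    (fun j hj => hk.bumpKernel_nonneg hj) (neg_le_of_abs_le h_center)
    (fun j hj => hk.le_bumpKernel hj) ?_
  calc C / scale k ^ 2 ≤ (C + 1 / 10) / scale k ^ 2 := by gcongr; linarith
    _ = q * (1 - q)⁻¹ * (1 / 10 / scale k ^ 2) := by rw [h_ratio]; ring

end BumpDensity

/-! ### Integration against the weighted family -/

/-- The integral of `f` against the `j`-th density. -/
def bumpIntegral (j : ℕ) (f : Plane → ℝ) : ℝ := ∫ x, bumpDensity j x * f x

/-- The integral of `f` against the geometrically weighted sum of all densities, summed bump by
bump. -/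
def weightedIntegral (q : ℝ) (f : Plane → ℝ) : ℝ := ∑' j, q ^ j * bumpIntegral j f

/-- The mass of the geometrically weighted sum of all densities. -/
def totalMass (q : ℝ) : ℝ := densityMass * (1 - q)⁻¹

/-- The condition under which `weightedIntegral q f` is not a junk value. -/
structure WeightedIntegrable (q : ℝ) (f : Plane → ℝ) : Prop where
  integrable (j : ℕ) : Integrable fun x => bumpDensity j x * f x
  summable : Summable fun j => q ^ j * bumpIntegral j f

/-- The logarithmic energy, whose growth along a solution is superlinear. -/
def logEnergy (q : ℝ) (u : Plane → ℝ) : ℝ := weightedIntegral q fun x => Real.log (u x)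

section WeightedIntegral

variable {j : ℕ} {x : Plane} {f g : Plane → ℝ} {q K a c : ℝ}

lemma totalMass_pos (hq : q < 1) : 0 < totalMass q :=
  mul_pos densityMass_pos (inv_pos.2 (sub_pos.2 hq))

lemma continuous_bumpDensity (j : ℕ) : Continuous (bumpDensity j) := continuous_density _ _

lemma integrable_bumpDensity (j : ℕ) : Integrable (bumpDensity j) :=
  integrable_density (bumpRadius_pos j) _

lemma integral_bumpDensity (j : ℕ) : ∫ x, bumpDensity j x = densityMass :=
  integral_density (bumpRadius_pos j) _

lemma initialDatum_of_bumpDensity_ne_zero (hx : bumpDensity j x ≠ 0) :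
    initialDatum x = (j.factorial : ℝ)⁻¹ :=
  initialDatum_of_le (not_lt.1 (mt bumpDensity_of_lt hx))

lemma initialDatum_pos_of_bumpDensity_ne_zero (hx : bumpDensity j x ≠ 0) : 0 < initialDatum x := by
  rw [initialDatum_of_bumpDensity_ne_zero hx]
  positivity

lemma norm_bumpDensity_mul_le (hf : ∀ x, bumpDensity j x ≠ 0 → |f x| ≤ K) (x : Plane) :
    ‖bumpDensity j x * f x‖ ≤ bumpDensity j x * K := by
  rw [norm_mul, Real.norm_of_nonneg (bumpDensity_nonneg j x)]
  by_cases hx : bumpDensity j x = 0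
  · simp [hx]
  · exact mul_le_mul_of_nonneg_left (hf x hx) (bumpDensity_nonneg j x)

lemma integrable_bumpDensity_mul (hf_meas : Measurable f)
    (hf : ∀ x, bumpDensity j x ≠ 0 → |f x| ≤ K) : Integrable fun x => bumpDensity j x * f x :=
  ((integrable_bumpDensity j).mul_const K).mono'
    ((continuous_bumpDensity j).measurable.mul hf_meas).aestronglyMeasurable
    (ae_of_all _ (norm_bumpDensity_mul_le hf))

lemma abs_bumpIntegral_le (hf : ∀ x, bumpDensity j x ≠ 0 → |f x| ≤ K) :
    |bumpIntegral j f| ≤ densityMass * K := by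
  calc |bumpIntegral j f| ≤ ∫ x, bumpDensity j x * K :=
        norm_integral_le_of_norm_le ((integrable_bumpDensity j).mul_const K)
          (ae_of_all _ (norm_bumpDensity_mul_le hf))
    _ = densityMass * K := by rw [integral_mul_const, integral_bumpDensity]

lemma abs_log_inv_factorial_le (j : ℕ) : |Real.log (j.factorial : ℝ)⁻¹| ≤ (j : ℝ) ^ 2 := by
  have h_one_le : (1 : ℝ) ≤ j.factorial := by exact_mod_cast j.factorial_pos
  rw [Real.log_inv, abs_neg, abs_of_nonneg (Real.log_nonneg h_one_le)]
  calc Real.log j.factorial ≤ Real.log ((j : ℝ) ^ j) :=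
        Real.log_le_log (by positivity) (by exact_mod_cast j.factorial_le_pow)
    _ = j * Real.log j := Real.log_pow _ _
    _ ≤ j * j := by gcongr; exact Real.log_le_self j.cast_nonneg
    _ = (j : ℝ) ^ 2 := by ring

lemma summable_geometric_mul_log (hq : q ∈ Ioo (0 : ℝ) 1) (K : ℝ) :
    Summable fun j : ℕ => q ^ j * (|Real.log (j.factorial : ℝ)⁻¹| + K) := by
  have hq_norm : ‖q‖ < 1 := by rw [Real.norm_of_nonneg hq.1.le]; exact hq.2
  have h_log : Summable fun j : ℕ => q ^ j * |Real.log (j.factorial : ℝ)⁻¹| := by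
    refine (summable_pow_mul_geometric_of_norm_lt_one 2 hq_norm).of_norm_bounded fun j => ?_
    rw [norm_mul, norm_pow, Real.norm_of_nonneg hq.1.le, mul_comm, Real.norm_eq_abs, abs_abs]
    exact mul_le_mul_of_nonneg_right (abs_log_inv_factorial_le j) (pow_nonneg hq.1.le j)
  simp_rw [mul_add]
  exact h_log.add ((summable_geometric_of_lt_one hq.1.le hq.2).mul_right K)

lemma WeightedIntegrable.of_abs_le_log (hq : q ∈ Ioo (0 : ℝ) 1) (hf_meas : Measurable f)
    (hf : ∀ j x, bumpDensity j x ≠ 0 → |f x| ≤ |Real.log (j.factorial : ℝ)⁻¹| + K) :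
    WeightedIntegrable q f where
  integrable j := integrable_bumpDensity_mul hf_meas (hf j)
  summable := by
    refine ((summable_geometric_mul_log hq K).mul_left densityMass).of_norm_bounded fun j => ?_
    rw [norm_mul, norm_pow, Real.norm_of_nonneg hq.1.le, mul_left_comm]
    exact mul_le_mul_of_nonneg_left (abs_bumpIntegral_le (hf j)) (pow_nonneg hq.1.le j)

lemma WeightedIntegrable.of_abs_le (hq : q ∈ Ioo (0 : ℝ) 1) (hf_meas : Measurable f)
    (hf : ∀ x, |f x| ≤ K) : WeightedIntegrable q f :=
  .of_abs_le_log hq hf_meas fun _ x _ => (hf x).trans (le_add_of_nonneg_left (abs_nonneg _))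

lemma bumpIntegral_const_mul_add (hf : Integrable fun x => bumpDensity j x * f x) (a c : ℝ) :
    bumpIntegral j (fun x => a * f x + c) = a * bumpIntegral j f + densityMass * c := by
  simp only [bumpIntegral, mul_add, mul_left_comm _ a]
  rw [integral_add (hf.const_mul a) ((integrable_bumpDensity j).mul_const c), integral_const_mul,
    integral_mul_const, integral_bumpDensity]

lemma WeightedIntegrable.hasSum_const_mul_add (hq : q ∈ Ioo (0 : ℝ) 1)
    (hf : WeightedIntegrable q f) (a c : ℝ) :
    HasSum (fun j => q ^ j * bumpIntegral j (fun x => a * f x + c))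
      (a * weightedIntegral q f + totalMass q * c) := by
  simp only [bumpIntegral_const_mul_add (hf.integrable _), mul_add, mul_left_comm _ a]
  rw [totalMass, mul_right_comm, mul_comm _ (1 - q)⁻¹]
  exact (hf.summable.hasSum.mul_left a).add
    ((hasSum_geometric_of_lt_one hq.1.le hq.2).mul_right _)

lemma WeightedIntegrable.const_mul_add_le (hq : q ∈ Ioo (0 : ℝ) 1) (hf : WeightedIntegrable q f)
    (hg : WeightedIntegrable q g)
    (h_le : ∀ j x, bumpDensity j x ≠ 0 → a * f x + c ≤ g x) :
    a * weightedIntegral q f + totalMass q * c ≤ weightedIntegral q g := by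
  have h_int (j : ℕ) : Integrable fun x => bumpDensity j x * (a * f x + c) := by
    simp only [mul_add, mul_left_comm _ a]
    exact ((hf.integrable j).const_mul a).add ((integrable_bumpDensity j).mul_const c)
  refine hasSum_le (fun j => ?_) (hf.hasSum_const_mul_add hq a c) hg.summable.hasSum
  refine mul_le_mul_of_nonneg_left ?_ (pow_nonneg hq.1.le j)
  refine integral_mono (h_int j) (hg.integrable j) fun x => ?_
  by_cases hx : bumpDensity j x = 0
  · simp [hx]
  · exact mul_le_mul_of_nonneg_left (h_le j x hx) (bumpDensity_nonneg j x)

lemma exp_mul_log_add_le {y : ℝ} (hy : 0 < y) (a : ℝ) :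
    Real.exp a * Real.log y + Real.exp a * (1 - a) ≤ y := by
  calc Real.exp a * Real.log y + Real.exp a * (1 - a)
      = Real.exp a * (Real.log y - a + 1) := by ring
    _ ≤ Real.exp a * Real.exp (Real.log y - a) := by gcongr; exact Real.add_one_le_exp _
    _ = y := by rw [← Real.exp_add, add_sub_cancel, Real.exp_log hy]

/-- Jensen's inequality for the exponential. -/
lemma totalMass_mul_exp_logEnergy_le (hq : q ∈ Ioo (0 : ℝ) 1) (hf : WeightedIntegrable q f)
    (hf_log : WeightedIntegrable q fun x => Real.log (f x))
    (hf_pos : ∀ j x, bumpDensity j x ≠ 0 → 0 < f x) :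
    totalMass q * Real.exp (logEnergy q f / totalMass q) ≤ weightedIntegral q f := by
  have h_mass := (totalMass_pos hq.2).ne'
  set a := logEnergy q f / totalMass q
  calc totalMass q * Real.exp a
      = Real.exp a * logEnergy q f + totalMass q * (Real.exp a * (1 - a)) := by
        rw [← mul_div_cancel₀ (logEnergy q f) h_mass]
        ring
    _ ≤ weightedIntegral q f := hf_log.const_mul_add_le hq hf fun j x hx =>
        exp_mul_log_add_le (hf_pos j x hx) a

end WeightedIntegral

/-- The test functions which are comparable to the initial datum, up to the factor `e^K`. -/
structure IsComparable (K : ℝ) (u : Plane → ℝ) : Prop where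
  isTest : IsTest u
  lower (x : Plane) : Real.exp (-K) * initialDatum x ≤ u x
  upper (x : Plane) : u x ≤ Real.exp K * initialDatum x

lemma IsTest.weightedIntegrable {q : ℝ} (hq : q ∈ Ioo (0 : ℝ) 1) {u : Plane → ℝ} (hu : IsTest u) :
    WeightedIntegrable q u := by
  obtain ⟨C, hC⟩ := hu.compact.exists_bound_of_continuous hu.continuous
  exact .of_abs_le hq hu.continuous.measurable hC

lemma IsTest.weightedIntegrable_rieszSq {q : ℝ} (hq : q ∈ Ioo (0 : ℝ) 1) {u : Plane → ℝ}
    (hu : IsTest u) : WeightedIntegrable q (rieszSq u) :=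
  .of_abs_le hq (hu.contDiff_multiplier isEvenSymbol_rieszSqSymbol).continuous.measurable
    (hu.abs_multiplier_le isEvenSymbol_rieszSqSymbol)

lemma IsTest.integrable_mul {K u : Plane → ℝ} (hu : IsTest u) (hK : Continuous K) :
    Integrable fun x => K x * u x :=
  (hK.mul hu.continuous).integrable_of_hasCompactSupport hu.compact.mul_left

lemma continuous_bumpPotential (j : ℕ) : Continuous (bumpPotential j) := continuous_potential _ _

lemma IsTest.integral_bumpKernel_mul {u : Plane → ℝ} (hu : IsTest u) (j : ℕ) :
    ∫ x, bumpKernel j x * u x = bumpIntegral j (rieszSq u) - bumpIntegral j u := by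
  have h_duality : bumpIntegral j (rieszSq u) = ∫ x, bumpPotential j x * u x :=
    integral_density_mul_rieszSq (bumpRadius_pos j) _ hu
  rw [h_duality, bumpIntegral, ← integral_sub (hu.integrable_mul (continuous_bumpPotential j))
    (hu.integrable_mul (continuous_bumpDensity j))]
  simp only [bumpKernel, sub_mul]

namespace IsComparable

variable {K q : ℝ} {u : Plane → ℝ} {x : Plane} {j : ℕ}

lemma nonneg (hu : IsComparable K u) (x : Plane) : 0 ≤ u x :=
  (mul_nonneg (Real.exp_pos _).le (initialDatum_nonneg x)).trans (hu.lower x)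

lemma eq_zero (hu : IsComparable K u) (hx : initialDatum x = 0) : u x = 0 :=
  le_antisymm (by simpa [hx] using hu.upper x) (hu.nonneg x)

lemma pos (hu : IsComparable K u) (hx : 0 < initialDatum x) : 0 < u x :=
  (mul_pos (Real.exp_pos _) hx).trans_le (hu.lower x)

lemma abs_log_sub_log_le (hu : IsComparable K u) (hx : 0 < initialDatum x) :
    |Real.log (u x) - Real.log (initialDatum x)| ≤ K := by
  have h_log (a : ℝ) :
      Real.log (Real.exp a * initialDatum x) = a + Real.log (initialDatum x) := by
    rw [Real.log_mul (Real.exp_ne_zero _) hx.ne', Real.log_exp]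
  have h_lower := Real.log_le_log (by positivity) (hu.lower x)
  have h_upper := Real.log_le_log (hu.pos hx) (hu.upper x)
  rw [h_log] at h_lower h_upper
  rw [abs_le]
  constructor <;> linarith

lemma abs_log_le (hu : IsComparable K u) (hx : bumpDensity j x ≠ 0) :
    |Real.log (u x)| ≤ |Real.log (j.factorial : ℝ)⁻¹| + K := by
  have h_sub := hu.abs_log_sub_log_le (initialDatum_pos_of_bumpDensity_ne_zero hx)
  rw [initialDatum_of_bumpDensity_ne_zero hx] at h_sub
  linarith [abs_sub_abs_le_abs_sub (Real.log (u x)) (Real.log (j.factorial : ℝ)⁻¹)]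

lemma integrable_bumpDensity_mul_log (hu : IsComparable K u) (j : ℕ) :
    Integrable fun x => bumpDensity j x * Real.log (u x) :=
  integrable_bumpDensity_mul hu.isTest.continuous.measurable.log fun _ hx => hu.abs_log_le hx

lemma weightedIntegrable_log (hu : IsComparable K u) (hq : q ∈ Ioo (0 : ℝ) 1) :
    WeightedIntegrable q fun x => Real.log (u x) :=
  .of_abs_le_log hq hu.isTest.continuous.measurable.log fun _ _ hx => hu.abs_log_le hx

lemma logEnergy_sub_le {v : Plane → ℝ} {K' : ℝ} (hu : IsComparable K u) (hv : IsComparable K' v)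
    (hq : q ∈ Ioo (0 : ℝ) 1) :
    logEnergy q u - totalMass q * (K + K') ≤ logEnergy q v := by
  have h_le := (hu.weightedIntegrable_log hq).const_mul_add_le (a := 1) (c := -(K + K')) hq
    (hv.weightedIntegrable_log hq) fun j x hx => by
      have hx_pos := initialDatum_pos_of_bumpDensity_ne_zero hx
      linarith [(abs_le.1 (hu.abs_log_sub_log_le hx_pos)).2,
        (abs_le.1 (hv.abs_log_sub_log_le hx_pos)).1]
  rwa [one_mul, mul_neg, ← sub_eq_add_neg] at h_le

lemma exists_norm_bumpKernel_mul_le (hu : IsComparable K u) :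
    ∃ D, ∀ j x, ‖bumpKernel j x * u x‖ ≤ (tsupport initialDatum).indicator (fun _ => D) x := by
  obtain ⟨C, hC, h_kernel⟩ := exists_abs_bumpKernel_le_div_norm
  refine ⟨C * (Real.exp K * (2 * Real.exp 4)), fun j x => ?_⟩
  by_cases hx : initialDatum x = 0
  · rw [hu.eq_zero hx, mul_zero, norm_zero]
    exact indicator_nonneg (fun _ _ => by positivity) x
  have hx_ne := ne_zero_of_initialDatum_ne_zero hx
  have hu_le : u x ≤ Real.exp K * (2 * Real.exp 4 * ‖x‖ ^ 2) :=
    (hu.upper x).trans (mul_le_mul_of_nonneg_left (initialDatum_le x) (Real.exp_pos K).le)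
  rw [indicator_of_mem (subset_tsupport _ hx), norm_mul, Real.norm_of_nonneg (hu.nonneg x)]
  calc ‖bumpKernel j x‖ * u x ≤ C / ‖x‖ ^ 2 * (Real.exp K * (2 * Real.exp 4 * ‖x‖ ^ 2)) :=
        mul_le_mul (h_kernel j x hx_ne) hu_le (hu.nonneg x) (by positivity)
    _ = C * (Real.exp K * (2 * Real.exp 4)) := by field_simp

lemma hasSum_integral_bumpKernel_mul (hu : IsComparable K u) (hq : q ∈ Ioo (0 : ℝ) 1) :
    HasSum (fun j => ∫ x, q ^ j * (bumpKernel j x * u x))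
      (∫ x, ∑' j, q ^ j * (bumpKernel j x * u x)) := by
  obtain ⟨D, hD⟩ := hu.exists_norm_bumpKernel_mul_le
  have h_kernel (j : ℕ) : Continuous (bumpKernel j) :=
    (continuous_bumpPotential j).sub (continuous_bumpDensity j)
  have h_int (j : ℕ) : Integrable fun x => q ^ j * (bumpKernel j x * u x) :=
    (hu.isTest.integrable_mul (h_kernel j)).const_mul _
  have h_indicator : Integrable ((tsupport initialDatum).indicator fun _ => D) :=
    (integrable_indicator_iff (isClosed_tsupport _).measurableSet).2
      (integrableOn_const isTest_initialDatum.compact.measure_lt_top.ne)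
  refine hasSum_integral_of_summable_integral_norm h_int ?_
  refine Summable.of_nonneg_of_le (fun j => integral_nonneg fun x => norm_nonneg _) (fun j => ?_)
    ((summable_geometric_of_lt_one hq.1.le hq.2).mul_right
      (∫ x, (tsupport initialDatum).indicator (fun _ => D) x))
  rw [← integral_const_mul]
  refine integral_mono (h_int j).norm (h_indicator.const_mul _) fun x => ?_
  calc ‖q ^ j * (bumpKernel j x * u x)‖ = q ^ j * ‖bumpKernel j x * u x‖ := by
        rw [norm_mul, norm_pow, Real.norm_of_nonneg hq.1.le]
    _ ≤ q ^ j * (tsupport initialDatum).indicator (fun _ => D) x :=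
        mul_le_mul_of_nonneg_left (hD j x) (pow_nonneg hq.1.le j)

lemma weightedIntegral_le_rieszSq (hu : IsComparable K u) (hq : q ∈ Ioo (0 : ℝ) 1)
    (h_kernel : ∀ x, initialDatum x ≠ 0 → 0 ≤ ∑' j, q ^ j * bumpKernel j x) :
    weightedIntegral q u ≤ weightedIntegral q (rieszSq u) := by
  rw [← sub_nonneg, weightedIntegral, weightedIntegral,
    ← (hu.isTest.weightedIntegrable_rieszSq hq).summable.tsum_sub
      (hu.isTest.weightedIntegrable hq).summable]
  simp only [← mul_sub, ← hu.isTest.integral_bumpKernel_mul, ← integral_const_mul]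
  rw [(hu.hasSum_integral_bumpKernel_mul hq).tsum_eq]
  refine integral_nonneg fun x => ?_
  simp only [← mul_assoc, tsum_mul_right]
  by_cases hx : initialDatum x = 0
  · simp [hu.eq_zero hx]
  · exact mul_nonneg (h_kernel x hx) (hu.nonneg x)

lemma totalMass_mul_exp_logEnergy_le_rieszSq (hu : IsComparable K u) (hq : q ∈ Ioo (0 : ℝ) 1)
    (h_kernel : ∀ x, initialDatum x ≠ 0 → 0 ≤ ∑' j, q ^ j * bumpKernel j x) :
    totalMass q * Real.exp (logEnergy q u / totalMass q) ≤ weightedIntegral q (rieszSq u) :=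
  (totalMass_mul_exp_logEnergy_le hq (hu.isTest.weightedIntegrable hq)
    (hu.weightedIntegrable_log hq)
    fun _ _ hx => hu.pos (initialDatum_pos_of_bumpDensity_ne_zero hx)).trans
    (hu.weightedIntegral_le_rieszSq hq h_kernel)

end IsComparable

/-! ### Finite lifespan -/

/-- A bound for `R₁² w` on the support of the initial datum up to time `b`. -/
def RieszSqBoundedBy (w : ℝ → Plane → ℝ) (b M : ℝ) : Prop :=
  ∀ t ∈ Icc 0 b, ∀ x ∈ tsupport initialDatum, |rieszSq (w t) x| ≤ M

lemma RieszSqBoundedBy.abs_rieszSq_le {w : ℝ → Plane → ℝ} {b M t : ℝ}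
    (hM : RieszSqBoundedBy w b M) (ht : t ∈ Ioo 0 b) {j : ℕ} {x : Plane}
    (hx : bumpDensity j x ≠ 0) : |rieszSq (w t) x| ≤ M :=
  hM t (Ioo_subset_Icc_self ht) x
    (subset_tsupport _ (initialDatum_pos_of_bumpDensity_ne_zero hx).ne')

namespace IsSmoothSolution

variable {T b M q t : ℝ} {w : ℝ → Plane → ℝ}

lemma isComparable (h : IsSmoothSolution T initialDatum w) (hb : b < T)
    (hM : RieszSqBoundedBy w b M) (ht : t ∈ Icc 0 b) : IsComparable (M * t) (w t) := by
  have htT : t ∈ Ico 0 T := ⟨ht.1, ht.2.trans_lt hb⟩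
  have h_eq := h.eq_mul_exp isTest_initialDatum htT
  have h_exponent {x : Plane} (hx : x ∈ tsupport initialDatum) :
      |∫ s in (0 : ℝ)..t, rieszSq (w s) x| ≤ M * t := by
    rw [← Real.norm_eq_abs]
    refine (intervalIntegral.norm_integral_le_of_norm_le_const fun s hs => ?_).trans_eq
      (by rw [sub_zero, abs_of_nonneg ht.1])
    rw [uIoc_of_le ht.1] at hs
    exact hM s ⟨hs.1.le, hs.2.trans ht.2⟩ x hx
  have h_between (x : Plane) : Real.exp (-(M * t)) * initialDatum x ≤ w t x ∧
      w t x ≤ Real.exp (M * t) * initialDatum x := by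
    rw [h_eq, mul_comm (initialDatum x)]
    by_cases hx : initialDatum x = 0
    · simp [hx]
    obtain ⟨h_lower, h_upper⟩ := abs_le.1 (h_exponent (subset_tsupport _ hx))
    exact ⟨mul_le_mul_of_nonneg_right (Real.exp_le_exp.2 h_lower) (initialDatum_nonneg x),
      mul_le_mul_of_nonneg_right (Real.exp_le_exp.2 h_upper) (initialDatum_nonneg x)⟩
  exact ⟨h.isTest isTest_initialDatum htT, fun x => (h_between x).1, fun x => (h_between x).2⟩

lemma hasDerivAt_bumpIntegral_log (h : IsSmoothSolution T initialDatum w) (hb : b < T)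
    (hM : RieszSqBoundedBy w b M) (ht : t ∈ Ioo 0 b) (j : ℕ) :
    HasDerivAt (fun s => bumpIntegral j fun x => Real.log (w s x))
      (bumpIntegral j (rieszSq (w t))) t := by
  have h_comparable {s : ℝ} (hs : s ∈ Ioo 0 b) := h.isComparable hb hM (Ioo_subset_Icc_self hs)
  have h_nhds : Ioo 0 b ∈ nhds t := isOpen_Ioo.mem_nhds ht
  refine (hasDerivAt_integral_of_dominated_loc_of_deriv_le (μ := volume)
    (F := fun s x => bumpDensity j x * Real.log (w s x))
    (F' := fun s x => bumpDensity j x * rieszSq (w s) x) (bound := fun x => bumpDensity j x * M)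
    h_nhds ?_ ((h_comparable ht).integrable_bumpDensity_mul_log j) ?_ ?_
    ((integrable_bumpDensity j).mul_const M) ?_).2
  · filter_upwards [h_nhds] with s hs
    exact ((h_comparable hs).integrable_bumpDensity_mul_log j).1
  · exact ((continuous_bumpDensity j).mul ((h_comparable ht).isTest.contDiff_multiplier
      isEvenSymbol_rieszSqSymbol).continuous).aestronglyMeasurable
  · exact ae_of_all _ fun x s hs => norm_bumpDensity_mul_le
      (fun y hy => hM.abs_rieszSq_le hs hy) x
  · refine ae_of_all _ fun x s hs => ?_
    by_cases hx : bumpDensity j x = 0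
    · simpa [hx] using hasDerivAt_const s (0 : ℝ)
    have h_pos := (h_comparable hs).pos (initialDatum_pos_of_bumpDensity_ne_zero hx)
    have h_log := (h.hasDerivAt isTest_initialDatum ⟨hs.1, hs.2.trans hb⟩ x).log h_pos.ne'
    rw [mul_div_cancel_left₀ _ h_pos.ne'] at h_log
    exact h_log.const_mul _

lemma hasDerivAt_logEnergy (h : IsSmoothSolution T initialDatum w) (hb : b < T)
    (hM : RieszSqBoundedBy w b M) (hq : q ∈ Ioo (0 : ℝ) 1) (ht : t ∈ Ioo 0 b) :
    HasDerivAt (fun s => logEnergy q (w s)) (weightedIntegral q (rieszSq (w t))) t := by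
  refine hasDerivAt_tsum_of_isPreconnected
    (g := fun j s => q ^ j * bumpIntegral j fun x => Real.log (w s x))
    (g' := fun j s => q ^ j * bumpIntegral j (rieszSq (w s)))
    ((summable_geometric_of_lt_one hq.1.le hq.2).mul_right (densityMass * M)) isOpen_Ioo
    isPreconnected_Ioo (fun j s hs => (h.hasDerivAt_bumpIntegral_log hb hM hs j).const_mul _)
    (fun j s hs => ?_) ht
    ((h.isComparable hb hM (Ioo_subset_Icc_self ht)).weightedIntegrable_log hq).summable ht
  rw [norm_mul, norm_pow, Real.norm_of_nonneg hq.1.le]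
  exact mul_le_mul_of_nonneg_left
    (abs_bumpIntegral_le fun x hx => hM.abs_rieszSq_le hs hx) (pow_nonneg hq.1.le j)

end IsSmoothSolution

/-- Comparison with the Riccati equation: `e^{-F/m}` decreases at least at unit speed. -/
lemma sub_le_exp_of_deriv_ge {F F' : ℝ → ℝ} {b m : ℝ} (hm : 0 < m)
    (hF : ∀ t ∈ Ioo 0 b, HasDerivAt F (F' t) t)
    (hF' : ∀ t ∈ Ioo 0 b, m * Real.exp (F t / m) ≤ F' t) {s t : ℝ} (hs : 0 < s) (hst : s ≤ t)
    (ht : t < b) : t - s ≤ Real.exp (-(F s / m)) := by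
  have h_deriv : ∀ r ∈ Ioo 0 b, HasDerivAt (fun r => Real.exp (-(F r / m)) + r)
      (Real.exp (-(F r / m)) * -(F' r / m) + 1) r := fun r hr =>
    (((hF r hr).div_const m).neg.exp).add (hasDerivAt_id r)
  have h_nonpos : ∀ r ∈ Ioo 0 b, Real.exp (-(F r / m)) * -(F' r / m) + 1 ≤ 0 := fun r hr => by
    have h_le : Real.exp (F r / m) ≤ F' r / m := by
      rw [le_div_iff₀ hm, mul_comm]
      exact hF' r hr
    have h_inv : Real.exp (-(F r / m)) * Real.exp (F r / m) = 1 := by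
      rw [← Real.exp_add, neg_add_cancel, Real.exp_zero]
    nlinarith [Real.exp_pos (-(F r / m))]
  have h_anti : AntitoneOn (fun r => Real.exp (-(F r / m)) + r) (Ioo 0 b) :=
    antitoneOn_of_hasDerivWithinAt_nonpos (convex_Ioo 0 b)
      (fun r hr => (h_deriv r hr).continuousAt.continuousWithinAt)
      (fun r hr => (h_deriv r (interior_subset hr)).hasDerivWithinAt)
      fun r hr => h_nonpos r (interior_subset hr)
  have h_le : Real.exp (-(F t / m)) + t ≤ Real.exp (-(F s / m)) + s :=
    h_anti ⟨hs, hst.trans_lt ht⟩ ⟨hs.trans_le hst, ht⟩ hst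
  linarith [Real.exp_pos (-(F t / m))]

lemma le_exp_of_forall_sub_le_exp {t a M : ℝ} (ht : 0 < t)
    (h_le : ∀ s ∈ Ioo 0 t, t - s ≤ Real.exp (a + M * s)) : t ≤ Real.exp a := by
  have h_lim : Filter.Tendsto (fun s => Real.exp (a + M * s) + s) (nhdsWithin 0 (Ioi 0))
      (nhds (Real.exp a)) := by
    have h_cont : Continuous fun s => Real.exp (a + M * s) + s := by fun_prop
    simpa using (h_cont.tendsto 0).mono_left nhdsWithin_le_nhds
  refine ge_of_tendsto h_lim ?_
  filter_upwards [Ioo_mem_nhdsGT ht] with s hs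
  linarith [h_le s hs]

/-- The logarithmic energy is differentiable only after time `0`, so the Riccati comparison starts
at `s > 0` and `s` then tends to `0`. -/
lemma IsSmoothSolution.lifespan_le {T q : ℝ} {w : ℝ → Plane → ℝ}
    (h : IsSmoothSolution T initialDatum w) (hq : q ∈ Ioo (0 : ℝ) 1)
    (h_kernel : ∀ x, initialDatum x ≠ 0 → 0 ≤ ∑' j, q ^ j * bumpKernel j x) :
    T ≤ Real.exp (-(logEnergy q initialDatum / totalMass q)) := by
  refine le_of_forall_lt_imp_le_of_dense fun t htT => ?_
  rcases le_or_gt t 0 with ht | ht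
  · exact ht.trans (Real.exp_pos _).le
  obtain ⟨b, htb, hb⟩ := exists_between htT
  obtain ⟨M, -, hM⟩ := h.exists_bound isTest_initialDatum hb
  have hM' : RieszSqBoundedBy w b M := fun s hs x hx => (hM s hs x hx).2
  have h_comparable {s : ℝ} (hs : s ∈ Icc 0 b) := h.isComparable hb hM' hs
  have hm := totalMass_pos hq.2
  refine le_exp_of_forall_sub_le_exp (M := M) ht fun s hs => ?_
  have h_initial : logEnergy q initialDatum / totalMass q - M * s ≤
      logEnergy q (w s) / totalMass q := by
    have h_sub := (h_comparable ⟨le_rfl, (ht.trans htb).le⟩).logEnergy_sub_le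
      (h_comparable ⟨hs.1.le, (hs.2.trans htb).le⟩) hq
    rw [h.initial, mul_zero, zero_add] at h_sub
    rw [le_div_iff₀ hm, sub_mul, div_mul_cancel₀ _ hm.ne', mul_comm (M * s)]
    exact h_sub
  calc t - s ≤ Real.exp (-(logEnergy q (w s) / totalMass q)) :=
        sub_le_exp_of_deriv_ge hm (fun r hr => h.hasDerivAt_logEnergy hb hM' hq hr)
          (fun r hr =>
            (h_comparable (Ioo_subset_Icc_self hr)).totalMass_mul_exp_logEnergy_le_rieszSq hq
              h_kernel) hs.1 hs.2.le htb
    _ ≤ Real.exp (-(logEnergy q initialDatum / totalMass q) + M * s) :=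
        Real.exp_le_exp.2 (by linarith)

lemma bddAbove_lifespans_initialDatum : BddAbove (lifespans initialDatum) := by
  obtain ⟨q, hq, h_kernel⟩ := exists_tsum_bumpKernel_nonneg
  refine ⟨Real.exp (-(logEnergy q initialDatum / totalMass q)), ?_⟩
  rintro T ⟨w, h⟩
  exact h.lifespan_le hq h_kernel

end

theorem theorem3p1 :
    ∃ w₀ : Plane → ℝ, (∀ x, 0 ≤ w₀ x) ∧ ContDiff ℝ ∞ w₀ ∧ HasCompactSupport w₀ ∧
      ∃ (T : ℝ) (w : ℝ → Plane → ℝ), 0 < T ∧ IsSmoothSolution T w₀ w ∧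
        (∀ (T' : ℝ) (v : ℝ → Plane → ℝ), IsSmoothSolution T' w₀ v →
          T' ≤ T ∧ ∀ t ∈ Ico 0 T', v t = w t) ∧
        ¬ ∃ W : ℝ × Plane → ℝ, ContDiffOn ℝ ∞ W (Icc 0 T ×ˢ univ) ∧
          ∀ t ∈ Ico 0 T, ∀ x, W (t, x) = w t x := by
  exact ⟨initialDatum, initialDatum_nonneg, isTest_initialDatum.smooth,
    isTest_initialDatum.compact,
    exists_maximal_solution isTest_initialDatum bddAbove_lifespans_initialDatum⟩
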